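/- Let $d\ge 3$, $0<\delta<4$, $\nu>0$, $T>0$, $p\ge 2$ with $p>\frac{2}{2-\sqrt{\delta}}$, $1<\theta<\frac{d}{d-1}$, $\theta'=\frac{\theta}{\theta-1}$, $\beta>\frac d4$, $\kappa>0$, and put $\rho(x)=(1+\kappa|x|^2)^{-\beta}$, $\rho_z(x)=\rho(x-z)$, $\langle v\rangle=\int_{\mathbb R^d}v\,dx$. A vector field $b:[0,\infty)\times\mathbb R^d\to\mathbb R^d$ is called form-bounded with form-bound $\delta>0$ and function $g_\delta$, written $b\in\mathbf F_\delta$, if $|b|\in L^2_{\rm loc}([0,\infty)\times\mathbb R^d)$, $0\le g_\delta\in L^1_{\rm loc}([0,\infty))$, and $$\int_0^\infty\|b(t,\cdot)\xi(t,\cdot)\|_{L^2}^2\,dt\le\delta\int_0^\infty\|\nabla\xi(t,\cdot)\|_{L^2}^2\,dt+\int_0^\infty g_\delta(t)\|\xi(t,\cdot)\|_{L^2}^2\,dt\qquad\text{for all }\xi\in C_c^\infty([0,\infty)\times\mathbb R^d).$$ For all $G_\delta,G_\nu\in\mathbb R$ there is a constant $C>0$, depending only on $d,\delta,\nu,p,T,\theta,\beta,\kappa,G_\delta,G_\nu$,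 such that the following holds. Let $b,\mathsf h\in C_c^\infty((0,\infty)\times\mathbb R^d,\mathbb R^d)$ be such that $b\in\mathbf F_\delta$ with a function $g_\delta$ satisfying $\int_0^Tg_\delta\,dt\le G_\delta$, and $\mathsf h\in\mathbf F_\nu$ with a function $g_\nu$ satisfying $\int_0^Tg_\nu\,dt\le G_\nu$. Let $f$ be a real-valued continuous function with compact support on $\mathbb R\times\mathbb R^d$ (only its values for $t\ge0$ matter), and let $u$ be the solution on $[0,T]\times\mathbb R^d$ of the Cauchy problem $$(\partial_t-\Delta+b\cdot\nabla)u=|\mathsf h|f,\qquad u(0,\cdot)=0,$$ that is, $u$ and $\nabla u$ (spatial gradient) are bounded and continuous on $[0,T]\times\mathbb R^d$, $u(0,\cdot)=0$, and $$\langle u(t)\varphi\rangle=\int_0^t\big\langle|\mathsf h|f\varphi-\nabla u\cdot\nabla\varphi-(b\cdot\nabla u)\varphi\big\rangle\,ds\qquad\text{for all }\varphi\in C_c^\infty(\mathbb R^d),\ t\in[0,T].$$ Then $$\|u\|_{L^\infty([0,T]\times\mathbb R^d)}\le C\sup_{z\in\mathbb Z^d}\left(\int_0^T\Big\langle\big(\mathbf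 1_{\{|\mathsf h|\ge1\}}+\mathbf 1_{\{|\mathsf h|<1\}}|\mathsf h|^p\big)^{\theta'}|f|^{p\theta'}\rho_z^2\Big\rangle\,dt\right)^{\frac1{p\theta'}}.$$ -/

import Mathlib

open MeasureTheory Set
open scoped ContDiff ENNReal

noncomputable section

namespace SingularDrift

/-- Euclidean space `ℝ^d`. Functions on space-time have the type `ℝ × Space d → _`; only their
values at times `t ≥ 0` matter. -/
abbrev Space (d : ℕ) : Type := EuclideanSpace ℝ (Fin d)

/-- The spatial gradient `∇_x w (t, x)` of a function `w` on space-time. -/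
def spatialGrad {d : ℕ} (w : ℝ × Space d → ℝ) (t : ℝ) (x : Space d) : Space d :=
  gradient (fun y => w (t, y)) x

/-- The vector field `b` on `[0, ∞) × ℝ^d` is form-bounded with form-bound `δ > 0` and with the
function `g ≥ 0` in `L^1_loc([0, ∞))`. The test functions in `C_c^∞([0, ∞) × ℝ^d)` are the
restrictions to `t ≥ 0` of the functions in `C_c^∞(ℝ × ℝ^d)`. -/
structure IsFormBounded {d : ℕ} (b : ℝ × Space d → Space d) (δ : ℝ) (g : ℝ → ℝ) : Prop where
  delta_pos : 0 < δ
  g_nonneg : ∀ t, 0 ≤ t → 0 ≤ g t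
  g_locallyIntegrable : LocallyIntegrableOn g (Ici 0)
  aestronglyMeasurable :
    AEStronglyMeasurable b (volume.restrict (Ici (0 : ℝ) ×ˢ (univ : Set (Space d))))
  sq_locallyIntegrable :
    LocallyIntegrableOn (fun z => ‖b z‖ ^ 2) (Ici (0 : ℝ) ×ˢ (univ : Set (Space d)))
  form_bound : ∀ ξ : ℝ × Space d → ℝ, ContDiff ℝ ∞ ξ → HasCompactSupport ξ →
    ∫ t in Ioi (0 : ℝ), ∫ x, ‖ξ (t, x) • b (t, x)‖ ^ 2 ≤
      δ * (∫ t in Ioi (0 : ℝ), ∫ x, ‖spatialGrad ξ t x‖ ^ 2) +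
        ∫ t in Ioi (0 : ℝ), g t * ∫ x, ξ (t, x) ^ 2

/-- `b ∈ C_c^∞((0, ∞) × ℝ^d, ℝ^d)`. -/
structure IsSmoothCompactlySupported {d : ℕ} (b : ℝ × Space d → Space d) : Prop where
  contDiff : ContDiff ℝ ∞ b
  hasCompactSupport : HasCompactSupport b
  tsupport_subset : tsupport b ⊆ Ioi (0 : ℝ) ×ˢ (univ : Set (Space d))

/-- `u` is the solution on `[0, T] × ℝ^d` of the Cauchy problem
`(∂_t - Δ + b · ∇) u = F`, `u(0) = 0`: the function `u` and its spatial gradient are bounded and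
continuous on `[0, T] × ℝ^d`, and the equation holds in the weak sense, integrated in time and
tested against functions of `x` in `C_c^∞(ℝ^d)`. -/
structure IsCauchySolution {d : ℕ} (T : ℝ) (b : ℝ × Space d → Space d) (F : ℝ × Space d → ℝ)
    (u : ℝ × Space d → ℝ) : Prop where
  continuousOn : ContinuousOn u (Icc 0 T ×ˢ univ)
  differentiable : ∀ t ∈ Icc 0 T, Differentiable ℝ (fun x => u (t, x))
  continuousOn_grad : ContinuousOn (fun z => spatialGrad u z.1 z.2) (Icc 0 T ×ˢ univ)
  bounded : ∃ M : ℝ, ∀ t ∈ Icc 0 T, ∀ x, |u (t, x)| ≤ M ∧ ‖spatialGrad u t x‖ ≤ M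
  initial : ∀ x, u (0, x) = 0
  weak_eq : ∀ φ : Space d → ℝ, ContDiff ℝ ∞ φ → HasCompactSupport φ → ∀ t ∈ Icc 0 T,
    ∫ x, u (t, x) * φ x =
      ∫ s in (0 : ℝ)..t, ∫ x,
        (F (s, x) * φ x - inner ℝ (spatialGrad u s x) (gradient φ x)
          - inner ℝ (b (s, x)) (spatialGrad u s x) * φ x)

/-- `1_{r ≥ 1} + 1_{r < 1} r^p`, to be evaluated at `r = |h|`. -/
def cutPow (p r : ℝ) : ℝ := if 1 ≤ r then 1 else r ^ p

/-- The weight `ρ(x) = (1 + κ |x|^2)^{-β}`. -/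
def rho {d : ℕ} (κ β : ℝ) (x : Space d) : ℝ := (1 + κ * ‖x‖ ^ 2) ^ (-β)

/-- The point of `ℝ^d` with the integer coordinates `z`. -/
def latticePoint {d : ℕ} (z : Fin d → ℤ) : Space d := WithLp.toLp 2 (fun i => (z i : ℝ))

/-- `∫_0^T ⟨(1_{|h| ≥ 1} + 1_{|h| < 1} |h|^p)^q |f|^{pq} ρ_y^2⟩ dt`, where `ρ_y(x) = ρ(x - y)`. -/
def weightedIntegral {d : ℕ} (T p q κ β : ℝ) (h : ℝ × Space d → Space d) (f : ℝ × Space d → ℝ)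
    (y : Space d) : ℝ≥0∞ :=
  ∫⁻ t in Icc 0 T, ∫⁻ x, ENNReal.ofReal
    (cutPow p ‖h (t, x)‖ ^ q * |f (t, x)| ^ (p * q) * rho κ β (x - y) ^ 2)

end SingularDrift

end

/-!
The proof is an energy estimate for `|u|^q`, uniform in `q ≥ p`, followed by a Moser iteration.

Energy. Test the equation with `q |u|^{q-2} u η^2`, where `η` is close to `ρ_y`, and put
`w = |u|^{q/2-1} u`. The diffusion contributes `-(4 (q - 1) / q) ∫ |η ∇w|^2`, and the drift
`-2 ∫ (b · η ∇w) (w η)`, which by form-boundedness is at most `2 √δ ∫ |∇(w η)|^2` up to lower order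
terms. Since `p > 2 / (2 - √δ)`, the difference of the two coefficients is at least
`4 (p - 1) / p - 2 √δ > 0` for all `q ≥ p`: the constants do not degenerate as `q → ∞`. The source
is absorbed by the elementary inequality `mul_rpow_le_cutPow`, form-boundedness of `h`, and
Gronwall's inequality; what remains on the right is
`q^p ∫∫ (1_{|h| ≥ 1} + 1_{|h| < 1} |h|^p) |f|^p |u|^{q-p} ρ_y^2`
(`IsDriftSolution.dissipation_le`, `IsDriftSolution.energy_estimate`).

As `u` has no time derivative, the energy inequality is derived from convexity:
`Φ(u(t)) - Φ(u(s)) ≤ Φ'(u(t)) (u(t) - u(s))`, and the right hand side is given by the weak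
formulation on `[s, t]`. Summing over partitions yields the inequality
(`IsHeatSolution.energy_le`). The form bounds are used at almost every fixed time, where they follow
from the time-integrated ones by Lebesgue differentiation (`IsFormBounded.ae_form_bound`).

Iteration. By the Gagliardo–Nirenberg inequality for `(w η)^2` the energy controls the
`L^r` norm of `|u|^q` on `[0, T] × B(y, 1)`, with `r = d / (d - 1)`. Hölder's inequality with
exponents `θ'` and `θ` on the right, and averaging over translations, which replaces balls by
weights again, lead to
`M(q r)^{1/r} ≤ C q^p K^p M((q - p) θ)^{1/θ}`, where `M(a) = sup_y ∫∫ |u|^a ρ_y^2` and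
`K^p = sup_y (∫∫ ...)^{1/θ'}` is the `p`-th power of the quantity in the claim
(`exists_translatedMoment_le`). As `θ < r`, the exponents
`q_0 = p`, `q_{k+1} = p + (r / θ) q_k` grow geometrically, so that `M(q_k r) ≤ (S K)^{q_k r}` with
`S` independent of `k` (`exists_moser_bound`), and `|u| ≤ S K` follows as `k → ∞`. At the first step
the moment on the right is `M(0)`, a constant, so that no a priori bound of `u` enters.
Centres in `ℝ^d` are used throughout; by a Harnack inequality for `ρ` the supremum over them is
comparable to the supremum over the lattice.
-/

namespace SingularDrift

open Filter Topology

variable {d : ℕ}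

/-! ### Gradients and compactly supported functions of class `C^1` -/

lemma hasGradientAt_mul {f g : Space d → ℝ} {f' g' x : Space d}
    (hf : HasGradientAt f f' x) (hg : HasGradientAt g g' x) :
    HasGradientAt (fun y => f y * g y) (f x • g' + g x • f') x := by
  rw [hasGradientAt_iff_hasFDerivAt] at *
  exact (hf.mul hg).congr_fderiv (by simp)

lemma HasDerivAt.comp_hasGradientAt {Φ : ℝ → ℝ} {Φ' : ℝ} {f : Space d → ℝ} {f' x : Space d}
    (hΦ : HasDerivAt Φ Φ' (f x)) (hf : HasGradientAt f f' x) :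
    HasGradientAt (fun y => Φ (f y)) (Φ' • f') x := by
  rw [hasGradientAt_iff_hasFDerivAt] at *
  exact (hΦ.comp_hasFDerivAt x hf).congr_fderiv (by simp)

/-- `ψ` is a compactly supported function of class `C^1` on `ℝ^d`, with gradient `ψ'`. -/
structure IsC1Test (ψ : Space d → ℝ) (ψ' : Space d → Space d) : Prop where
  hasGradientAt : ∀ x, HasGradientAt ψ (ψ' x) x
  continuous_grad : Continuous ψ'
  hasCompactSupport : HasCompactSupport ψ

namespace IsC1Test

variable {ψ φ : Space d → ℝ} {ψ' φ' : Space d → Space d}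

lemma continuous (h : IsC1Test ψ ψ') : Continuous ψ :=
  continuous_iff_continuousAt.2 fun x => (h.hasGradientAt x).continuousAt

lemma fderiv_eq (h : IsC1Test ψ ψ') (x : Space d) :
    fderiv ℝ ψ x = InnerProductSpace.toDual ℝ (Space d) (ψ' x) :=
  (hasGradientAt_iff_hasFDerivAt.1 (h.hasGradientAt x)).fderiv

lemma contDiff (h : IsC1Test ψ ψ') : ContDiff ℝ 1 ψ := by
  rw [contDiff_one_iff_fderiv]
  refine ⟨fun x => (h.hasGradientAt x).differentiableAt, ?_⟩
  have : fderiv ℝ ψ = fun x => InnerProductSpace.toDual ℝ (Space d) (ψ' x) :=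
    funext h.fderiv_eq
  rw [this]
  exact (InnerProductSpace.toDual ℝ (Space d)).continuous.comp h.continuous_grad

lemma of_contDiff {n : WithTop ℕ∞} (h : ContDiff ℝ n ψ) (hn : 1 ≤ n) (hc : HasCompactSupport ψ) :
    IsC1Test ψ (gradient ψ) where
  hasGradientAt x := ((h.differentiable (by intro h0; simp [h0] at hn)) x).hasGradientAt
  continuous_grad :=
    (InnerProductSpace.toDual ℝ (Space d)).symm.continuous.comp (h.continuous_fderiv (by
      intro h0; simp [h0] at hn))
  hasCompactSupport := hc

lemma grad_eq_zero (h : IsC1Test ψ ψ') {x : Space d} (hx : x ∉ tsupport ψ) : ψ' x = 0 := by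
  have h1 : ψ =ᶠ[𝓝 x] fun _ => (0 : ℝ) := by
    rw [notMem_tsupport_iff_eventuallyEq] at hx
    exact hx
  exact (h.hasGradientAt x).unique
    ((hasGradientAt_const (𝕜 := ℝ) x (0 : ℝ)).congr_of_eventuallyEq h1)

lemma mul_left (h : IsC1Test ψ ψ') {f : Space d → ℝ} {f' : Space d → Space d}
    (hf : ∀ x, HasGradientAt f (f' x) x) (hf' : Continuous f') :
    IsC1Test (fun x => f x * ψ x) (fun x => f x • ψ' x + ψ x • f' x) where
  hasGradientAt x := hasGradientAt_mul (hf x) (h.hasGradientAt x)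
  continuous_grad := by
    have : Continuous f := continuous_iff_continuousAt.2 fun x => (hf x).continuousAt
    exact (this.smul h.continuous_grad).add (h.continuous.smul hf')
  hasCompactSupport := h.hasCompactSupport.mul_left

lemma sub (h : IsC1Test ψ ψ') (h2 : IsC1Test φ φ') :
    IsC1Test (fun x => ψ x - φ x) (fun x => ψ' x - φ' x) where
  hasGradientAt x := by
    have h1 := h.hasGradientAt x
    have h3 := h2.hasGradientAt x
    rw [hasGradientAt_iff_hasFDerivAt] at *
    exact (h1.sub h3).congr_fderiv (by simp)
  continuous_grad := h.continuous_grad.sub h2.continuous_grad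
  hasCompactSupport := h.hasCompactSupport.sub h2.hasCompactSupport

/-- Mollification approximates a compactly supported `C^1` function uniformly together with its
gradient, with supports in a fixed compact set. -/
lemma exists_smooth_approx (h : IsC1Test ψ ψ') {ε : ℝ} (hε : 0 < ε) :
    ∃ φ : Space d → ℝ, ContDiff ℝ ∞ φ ∧ HasCompactSupport φ ∧
      tsupport φ ⊆ Metric.cthickening 1 (tsupport ψ) ∧
      ∀ x, |φ x - ψ x| ≤ ε ∧ ‖gradient φ x - ψ' x‖ ≤ ε := by
  classical
  have huc : UniformContinuous ψ :=
    h.hasCompactSupport.uniformContinuous_of_continuous h.continuous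
  have hfd : Continuous (fderiv ℝ ψ) := h.contDiff.continuous_fderiv one_ne_zero
  have huc' : UniformContinuous (fderiv ℝ ψ) :=
    (h.hasCompactSupport.fderiv ℝ).uniformContinuous_of_continuous hfd
  obtain ⟨r₁, hr₁, H₁⟩ := Metric.uniformContinuous_iff.1 huc ε hε
  obtain ⟨r₂, hr₂, H₂⟩ := Metric.uniformContinuous_iff.1 huc' ε hε
  set r : ℝ := min 1 (min r₁ r₂) with hr
  have hr0 : 0 < r := by positivity
  let B : ContDiffBump (0 : Space d) := ⟨r / 2, r, by positivity, by linarith⟩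
  let φ : Space d → ℝ := convolution (B.normed volume) ψ (ContinuousLinearMap.lsmul ℝ ℝ) volume
  have hloc : LocallyIntegrable ψ volume := h.continuous.locallyIntegrable
  have hfφ : ∀ x, HasFDerivAt φ (convolution (B.normed volume) (fderiv ℝ ψ)
      (ContinuousLinearMap.lsmul ℝ ℝ) volume x) x := by
    intro x
    have := h.hasCompactSupport.hasFDerivAt_convolution_right (f := B.normed volume)
      (ContinuousLinearMap.lsmul ℝ ℝ) (B.continuous_normed.locallyIntegrable (μ := volume))
      h.contDiff x
    exact this.congr_fderiv (integral_congr_ae (ae_of_all _ fun y => by ext v; rfl))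
  have hsup : tsupport φ ⊆ Metric.cthickening 1 (tsupport ψ) := by
    refine closure_minimal ?_ Metric.isClosed_cthickening
    refine (support_convolution_subset _).trans ?_
    rintro _ ⟨a, ha, b, hb, rfl⟩
    have ha' : a ∈ Metric.ball (0 : Space d) r := by
      simpa [B.support_normed_eq] using ha
    refine Metric.mem_cthickening_of_dist_le _ b _ _ (subset_tsupport _ hb) ?_
    have : ‖a‖ < r := by simpa using ha'
    have h2 : r ≤ 1 := min_le_left _ _
    simp only [dist_eq_norm, add_sub_cancel_right]
    linarith
  refine ⟨φ, ?_, ?_, hsup, fun x => ⟨?_, ?_⟩⟩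
  · exact B.hasCompactSupport_normed.contDiff_convolution_left _ B.contDiff_normed hloc
  · exact HasCompactSupport.of_support_subset_isCompact h.hasCompactSupport.cthickening
      ((subset_tsupport _).trans hsup)
  · have := B.dist_normed_convolution_le (μ := volume) (x₀ := x) (ε := ε) (g := ψ)
      h.continuous.aestronglyMeasurable (fun y hy => (H₁ (lt_of_lt_of_le (Metric.mem_ball.1 hy)
        ((min_le_right _ _).trans (min_le_left _ _)))).le)
    simpa [Real.dist_eq] using this
  · have := B.dist_normed_convolution_le (μ := volume) (x₀ := x) (ε := ε) (g := fderiv ℝ ψ)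
      hfd.aestronglyMeasurable (fun y hy => (H₂ (lt_of_lt_of_le (Metric.mem_ball.1 hy)
        ((min_le_right _ _).trans (min_le_right _ _)))).le)
    rw [← (hfφ x).fderiv, dist_eq_norm, h.fderiv_eq, ← toDual_gradient, ← map_sub,
      LinearIsometryEquiv.norm_map] at this
    exact this

end IsC1Test

/-! ### Energy inequality for weak solutions -/

lemma continuous_integral_of_compact {X : Type*} [TopologicalSpace X] [FirstCountableTopology X]
    [LocallyCompactSpace X] {F : X → Space d → ℝ} (hF : Continuous F.uncurry)
    {K : Set (Space d)} (hK : IsCompact K) (h0 : ∀ r x, x ∉ K → F r x = 0) :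
    Continuous fun r => ∫ x, F r x := by
  have h := continuous_parametric_integral_of_continuous (μ := volume) hF hK
  refine h.congr fun r => ?_
  exact setIntegral_eq_integral_of_forall_compl_eq_zero fun x hx => h0 r x hx

lemma integrable_of_compact {F : Space d → ℝ} (hF : Continuous F)
    {K : Set (Space d)} (hK : IsCompact K) (h0 : ∀ x, x ∉ K → F x = 0) : Integrable F :=
  hF.integrable_of_hasCompactSupport (HasCompactSupport.intro hK h0)

lemma abs_integral_le_of_compact {F : Space d → ℝ} {K : Set (Space d)} (hK : IsCompact K)
    {C : ℝ} (h0 : ∀ x, x ∉ K → F x = 0) (hC : ∀ x ∈ K, |F x| ≤ C) :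
    |∫ x, F x| ≤ C * volume.real K := by
  rw [← setIntegral_eq_integral_of_forall_compl_eq_zero (s := K) fun x hx => h0 x hx]
  rw [← Real.norm_eq_abs]
  exact norm_setIntegral_le_of_norm_le_const (f := F) hK.measure_lt_top hC

/-- The solution of `∂_t u - Δ u = G`, `u(0) = 0`, on `[0, T] × ℝ^d`, in the weak sense of
`IsCauchySolution`; `du` is the spatial gradient of `u`, and both functions are extended to all
times so that they are continuous everywhere. The drift term is part of `G`. -/
structure IsHeatSolution (T M : ℝ) (G u : ℝ × Space d → ℝ) (du : ℝ × Space d → Space d) :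
    Prop where
  continuous_source : Continuous G
  continuous : Continuous u
  continuous_grad : Continuous du
  hasGradientAt : ∀ t x, HasGradientAt (fun y => u (t, y)) (du (t, x)) x
  abs_le : ∀ z, |u z| ≤ M
  norm_grad_le : ∀ z, ‖du z‖ ≤ M
  initial : ∀ x, u (0, x) = 0
  weak_eq : ∀ φ : Space d → ℝ, ContDiff ℝ ∞ φ → HasCompactSupport φ → ∀ t ∈ Icc 0 T,
    ∫ x, u (t, x) * φ x =
      ∫ s in (0 : ℝ)..t, ∫ x, (G (s, x) * φ x - inner ℝ (du (s, x)) (gradient φ x))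

namespace IsHeatSolution

variable {T M : ℝ} {G u : ℝ × Space d → ℝ} {du : ℝ × Space d → Space d}
  {ψ : Space d → ℝ} {ψ' : Space d → Space d}

lemma continuous_pairing (hu : IsHeatSolution T M G u du) (hψ : IsC1Test ψ ψ') :
    Continuous fun r => ∫ x, (G (r, x) * ψ x - inner ℝ (du (r, x)) (ψ' x)) := by
  have h1 := hu.continuous_source
  have h2 := hu.continuous_grad
  have h3 := hψ.continuous
  have h4 := hψ.continuous_grad
  refine continuous_integral_of_compact (K := tsupport ψ)
    (F := fun r x => G (r, x) * ψ x - inner ℝ (du (r, x)) (ψ' x)) ?_ hψ.hasCompactSupport ?_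
  · simp only [Function.uncurry_def]; fun_prop
  · intro r x hx
    simp [image_eq_zero_of_notMem_tsupport hx, hψ.grad_eq_zero hx]

lemma integrable_pairing (hu : IsHeatSolution T M G u du) (hψ : IsC1Test ψ ψ') (r : ℝ) :
    Integrable fun x => G (r, x) * ψ x - inner ℝ (du (r, x)) (ψ' x) := by
  have h1 := hu.continuous_source
  have h2 := hu.continuous_grad
  have h3 := hψ.continuous
  have h4 := hψ.continuous_grad
  refine integrable_of_compact (by fun_prop) hψ.hasCompactSupport fun x hx => ?_
  simp [image_eq_zero_of_notMem_tsupport hx, hψ.grad_eq_zero hx]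

lemma integrable_mul (hu : IsHeatSolution T M G u du) (hψ : IsC1Test ψ ψ') (t : ℝ) :
    Integrable fun x => u (t, x) * ψ x := by
  have h1 := hu.continuous
  have h3 := hψ.continuous
  refine integrable_of_compact (by fun_prop) hψ.hasCompactSupport fun x hx => ?_
  simp [image_eq_zero_of_notMem_tsupport hx]

/-- By density, test functions of class `C^1` are admissible in the weak formulation. -/
lemma weak_eq_C1 (hu : IsHeatSolution T M G u du) (hψ : IsC1Test ψ ψ') {t : ℝ}
    (ht : t ∈ Icc 0 T) :
    ∫ x, u (t, x) * ψ x =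
      ∫ s in (0 : ℝ)..t, ∫ x, (G (s, x) * ψ x - inner ℝ (du (s, x)) (ψ' x)) := by
  set K := Metric.cthickening 1 (tsupport ψ) with hKdef
  have hK : IsCompact K := hψ.hasCompactSupport.cthickening
  obtain ⟨Gm, hGm⟩ := ((isCompact_Icc (a := (0:ℝ)) (b := T)).prod hK).exists_bound_of_continuousOn
    hu.continuous_source.continuousOn
  set m := volume.real K with hm
  have hm0 : 0 ≤ m := measureReal_nonneg
  have hM0 : 0 ≤ M := (abs_nonneg _).trans (hu.abs_le (0, 0))
  -- both sides are bounded by `C ε` for test functions which are at most `ε` with their gradient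
  set C := M * m + (|Gm| + M) * m * |t - 0| with hC
  have hC0 : 0 ≤ C := by positivity
  set J := ∫ x, u (t, x) * ψ x with hJ
  set J' := ∫ s in (0 : ℝ)..t, ∫ x, (G (s, x) * ψ x - inner ℝ (du (s, x)) (ψ' x)) with hJ'
  suffices h : ∀ ε > 0, |J - J'| ≤ C * ε by
    have h1 : |J - J'| ≤ 0 := by
      refine le_of_forall_pos_le_add fun ε hε => ?_
      refine (h (ε / (C + 1)) (by positivity)).trans ?_
      rw [zero_add, mul_div_assoc', div_le_iff₀ (by positivity)]
      nlinarith
    exact sub_eq_zero.1 (abs_eq_zero.1 (le_antisymm h1 (abs_nonneg _)))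
  intro ε hε
  obtain ⟨φ, hφ, hφc, hφK, hφε⟩ := hψ.exists_smooth_approx hε
  have hφ1 : IsC1Test φ (gradient φ) := IsC1Test.of_contDiff hφ (by simp) hφc
  have hw := hu.weak_eq φ hφ hφc t ht
  have hout : ∀ x, x ∉ K → ψ x = 0 ∧ ψ' x = 0 ∧ φ x = 0 ∧ gradient φ x = 0 := by
    intro x hx
    have hx1 : x ∉ tsupport ψ := fun h => hx (Metric.self_subset_cthickening _ h)
    have hx2 : x ∉ tsupport φ := fun h => hx (hφK h)
    exact ⟨image_eq_zero_of_notMem_tsupport hx1, hψ.grad_eq_zero hx1, image_eq_zero_of_notMem_tsupport hx2,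
      hφ1.grad_eq_zero hx2⟩
  have e1 : J - ∫ x, u (t, x) * φ x = ∫ x, (u (t, x) * ψ x - u (t, x) * φ x) :=
    (integral_sub (hu.integrable_mul hψ t) (hu.integrable_mul hφ1 t)).symm
  have e2 : J' - ∫ s in (0 : ℝ)..t, ∫ x, (G (s, x) * φ x - inner ℝ (du (s, x)) (gradient φ x)) =
      ∫ s in (0 : ℝ)..t, ∫ x, ((G (s, x) * ψ x - inner ℝ (du (s, x)) (ψ' x)) -
        (G (s, x) * φ x - inner ℝ (du (s, x)) (gradient φ x))) := by
    rw [hJ', ← intervalIntegral.integral_sub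
      ((hu.continuous_pairing hψ).intervalIntegrable _ _)
      ((hu.continuous_pairing hφ1).intervalIntegrable _ _)]
    refine intervalIntegral.integral_congr fun s _ => ?_
    exact (integral_sub (hu.integrable_pairing hψ s) (hu.integrable_pairing hφ1 s)).symm
  have b1 : |J - ∫ x, u (t, x) * φ x| ≤ (M * ε) * m := by
    rw [e1]
    refine abs_integral_le_of_compact hK (fun x hx => ?_) fun x _ => ?_
    · simp [(hout x hx).1, (hout x hx).2.2.1]
    · rw [← mul_sub, abs_mul, abs_sub_comm]
      exact mul_le_mul (hu.abs_le _) (hφε x).1 (abs_nonneg _) hM0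
  have b2 : |J' - ∫ s in (0 : ℝ)..t,
      ∫ x, (G (s, x) * φ x - inner ℝ (du (s, x)) (gradient φ x))| ≤
      ((|Gm| + M) * ε * m) * |t - 0| := by
    rw [e2, ← Real.norm_eq_abs]
    refine intervalIntegral.norm_integral_le_of_norm_le_const fun s hs => ?_
    have hs' : s ∈ Icc 0 T := by
      rw [uIoc_of_le ht.1] at hs
      exact ⟨hs.1.le, hs.2.trans ht.2⟩
    refine abs_integral_le_of_compact hK (fun x hx => ?_) fun x hx => ?_
    · simp [hout x hx]
    · have e : (G (s, x) * ψ x - inner ℝ (du (s, x)) (ψ' x)) -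
          (G (s, x) * φ x - inner ℝ (du (s, x)) (gradient φ x)) =
          inner ℝ (du (s, x)) (gradient φ x - ψ' x) - G (s, x) * (φ x - ψ x) := by
        rw [inner_sub_right]; ring
      rw [e]
      refine (abs_sub _ _).trans ?_
      have i1 : |inner ℝ (du (s, x)) (gradient φ x - ψ' x)| ≤ M * ε :=
        (abs_real_inner_le_norm _ _).trans
          (mul_le_mul (hu.norm_grad_le _) (hφε x).2 (norm_nonneg _) hM0)
      have i2 : |G (s, x) * (φ x - ψ x)| ≤ |Gm| * ε := by
        rw [abs_mul]
        exact mul_le_mul ((hGm (s, x) ⟨hs', hx⟩).trans (le_abs_self _)) (hφε x).1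
          (abs_nonneg _) (abs_nonneg _)
      linarith
  have : J - J' = (J - ∫ x, u (t, x) * φ x) - (J' - ∫ s in (0 : ℝ)..t,
      ∫ x, (G (s, x) * φ x - inner ℝ (du (s, x)) (gradient φ x))) := by
    rw [hw]; ring
  rw [this]
  refine (abs_sub _ _).trans ((add_le_add b1 b2).trans (le_of_eq ?_))
  rw [hC]; ring

end IsHeatSolution

/-- If the increments of `E` over `[s, t]` are bounded by `∫_s^t H(r, t) dr` with `H` continuous,
then the increments over `[0, t]` are bounded by the integral of `H` over the diagonal. -/
lemma sub_le_integral_diagonal {T : ℝ} {E : ℝ → ℝ} {H : ℝ → ℝ → ℝ}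
    (hH : Continuous H.uncurry)
    (h : ∀ s t, 0 ≤ s → s ≤ t → t ≤ T → E t - E s ≤ ∫ r in s..t, H r t) {t : ℝ}
    (ht : t ∈ Icc 0 T) : E t - E 0 ≤ ∫ r in (0 : ℝ)..t, H r r := by
  have hdiag : Continuous fun r => H r r := hH.comp (continuous_id.prodMk continuous_id)
  refine le_of_forall_pos_le_add fun ε hε => ?_
  have huc := (isCompact_Icc.prod isCompact_Icc : IsCompact (Icc (0:ℝ) T ×ˢ Icc (0:ℝ) T))
    |>.uniformContinuousOn_of_continuous hH.continuousOn
  set ε' := ε / (t + 1) with hε'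
  have ht1 : 0 < t + 1 := by linarith [ht.1]
  have hε'0 : 0 < ε' := by positivity
  obtain ⟨τ, hτ, hτH⟩ := Metric.uniformContinuousOn_iff.1 huc ε' hε'0
  have step : ∀ s s', 0 ≤ s → s ≤ s' → s' ≤ t → s' - s < τ →
      E s' - E s ≤ (∫ r in s..s', H r r) + ε' * (s' - s) := by
    intro s s' hs hss hs't hd
    refine (h s s' hs hss (hs't.trans ht.2)).trans ?_
    have hc : Continuous fun r => H r s' := hH.comp (continuous_id.prodMk continuous_const)
    have : (∫ r in s..s', H r r) + ε' * (s' - s) = ∫ r in s..s', (H r r + ε') := by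
      rw [intervalIntegral.integral_add (hdiag.intervalIntegrable _ _)
        (continuous_const.intervalIntegrable _ _)]
      simp [mul_comm]
    rw [this]
    refine intervalIntegral.integral_mono_on hss (hc.intervalIntegrable _ _)
      ((hdiag.add continuous_const).intervalIntegrable _ _) fun r hr => ?_
    have hr0 : r ∈ Icc 0 T := ⟨hs.trans hr.1, hr.2.trans (hs't.trans ht.2)⟩
    have hs0 : s' ∈ Icc 0 T := ⟨hs.trans hss, hs't.trans ht.2⟩
    have := hτH (r, s') ⟨hr0, hs0⟩ (r, r) ⟨hr0, hr0⟩ (by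
      rw [Prod.dist_eq, dist_self, Real.dist_eq]
      rw [max_lt_iff]
      refine ⟨hτ, ?_⟩
      rw [abs_lt]; constructor <;> linarith [hr.1, hr.2])
    rw [Real.dist_eq, abs_lt] at this
    simp only [Function.uncurry] at this
    linarith [this.2]
  -- sum over a partition of `[0, t]` of mesh less than `τ`
  obtain ⟨N, hN⟩ := exists_nat_gt (t / τ)
  have hN0 : (0 : ℝ) < N := lt_of_le_of_lt (div_nonneg ht.1 hτ.le) hN
  have hNt : t / N < τ := by
    rw [div_lt_iff₀ hN0]; rw [div_lt_iff₀ hτ] at hN; linarith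
  have ind : ∀ k : ℕ, k ≤ N → E (k * (t / N)) - E 0 ≤
      (∫ r in (0:ℝ)..(k * (t / N)), H r r) + ε' * (k * (t / N)) := by
    intro k
    induction k with
    | zero => intro _; simp
    | succ k ih =>
      intro hk
      have hk' := ih (Nat.le_of_succ_le hk)
      have h0 : 0 ≤ t / N := div_nonneg ht.1 hN0.le
      have hle : ((k + 1 : ℕ) : ℝ) * (t / N) ≤ t := by
        rw [mul_div_assoc', div_le_iff₀ hN0, mul_comm]
        exact mul_le_mul_of_nonneg_left (by exact_mod_cast hk) ht.1
      have := step (k * (t / N)) ((k + 1 : ℕ) * (t / N)) (by positivity)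
        (by push_cast; linarith) hle (by push_cast; linarith)
      have e := intervalIntegral.integral_add_adjacent_intervals
        (hdiag.intervalIntegrable (μ := volume) 0 (k * (t / N)))
        (hdiag.intervalIntegrable (μ := volume) (k * (t / N)) ((k + 1 : ℕ) * (t / N)))
      linarith
  have := ind N le_rfl
  rw [mul_div_cancel₀ _ hN0.ne'] at this
  refine this.trans ?_
  have : ε' * t ≤ ε := by
    rw [hε', div_mul_eq_mul_div, div_le_iff₀ ht1]; nlinarith
  linarith

/-- Energy inequality: testing the equation with `Φ'(u) k` for a convex function `Φ` and a
nonnegative weight `k`. Only an inequality is claimed, which makes it possible to do without the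
time derivative of `u`: by convexity `Φ(u(t)) - Φ(u(s)) ≤ Φ'(u(t)) (u(t) - u(s))`, and the right
hand side is controlled by the weak formulation on `[s, t]` with the test function `Φ'(u(t)) k`. -/
lemma IsHeatSolution.energy_le {T M : ℝ} {G u : ℝ × Space d → ℝ} {du : ℝ × Space d → Space d}
    (hu : IsHeatSolution T M G u du) {k : Space d → ℝ} {k' : Space d → Space d}
    (hk : IsC1Test k k') (hk0 : ∀ x, 0 ≤ k x) {Φ Φ₁ Φ₂ : ℝ → ℝ}
    (hΦ : Continuous Φ) (hΦ₁ : ∀ s, HasDerivAt Φ₁ (Φ₂ s) s) (hΦ₂ : Continuous Φ₂)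
    (hconv : ∀ a b, Φ a - Φ b ≤ Φ₁ a * (a - b)) {t : ℝ} (ht : t ∈ Icc 0 T) :
    (∫ x, Φ (u (t, x)) * k x) - ∫ x, Φ (u (0, x)) * k x ≤
      ∫ r in (0 : ℝ)..t, ∫ x, (G (r, x) * (Φ₁ (u (r, x)) * k x) -
        inner ℝ (du (r, x)) (Φ₁ (u (r, x)) • k' x + (k x * Φ₂ (u (r, x))) • du (r, x))) := by
  have hcΦ₁ : Continuous Φ₁ := continuous_iff_continuousAt.2 fun s => (hΦ₁ s).continuousAt
  have c1 := hu.continuous_source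
  have c2 := hu.continuous_grad
  have c3 := hu.continuous
  have c4 := hk.continuous
  have c5 := hk.continuous_grad
  have htest : ∀ t, IsC1Test (fun x => Φ₁ (u (t, x)) * k x)
      (fun x => Φ₁ (u (t, x)) • k' x + (k x * Φ₂ (u (t, x))) • du (t, x)) := by
    intro t
    have := hk.mul_left (f := fun x => Φ₁ (u (t, x)))
      (f' := fun x => Φ₂ (u (t, x)) • du (t, x))
      (fun x => HasDerivAt.comp_hasGradientAt (hΦ₁ _) (hu.hasGradientAt t x)) (by fun_prop)
    simpa only [smul_smul] using this
  refine sub_le_integral_diagonal (T := T) (E := fun t => ∫ x, Φ (u (t, x)) * k x)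
    (H := fun r t => ∫ x, (G (r, x) * (Φ₁ (u (t, x)) * k x) -
        inner ℝ (du (r, x)) (Φ₁ (u (t, x)) • k' x + (k x * Φ₂ (u (t, x))) • du (t, x)))) ?_ ?_ ht
  · refine continuous_integral_of_compact (K := tsupport k) (F := fun (z : ℝ × ℝ) x =>
        (G (z.1, x) * (Φ₁ (u (z.2, x)) * k x) - inner ℝ (du (z.1, x))
          (Φ₁ (u (z.2, x)) • k' x + (k x * Φ₂ (u (z.2, x))) • du (z.2, x))))
          ?_ hk.hasCompactSupport ?_
    · simp only [Function.uncurry_def]; fun_prop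
    · intro z x hx
      simp [image_eq_zero_of_notMem_tsupport hx, hk.grad_eq_zero hx]
  · intro s t hs hst htT
    have hint : ∀ (F : Space d → ℝ), Continuous F → Integrable fun x => F x * k x := fun F hF =>
      integrable_of_compact (by fun_prop) hk.hasCompactSupport fun x hx => by
        simp [image_eq_zero_of_notMem_tsupport hx]
    have e1 := hu.weak_eq_C1 (htest t) (t := t) ⟨hs.trans hst, htT⟩
    have e2 := hu.weak_eq_C1 (htest t) (t := s) ⟨hs, hst.trans htT⟩
    have e3 := intervalIntegral.integral_interval_sub_left
        ((hu.continuous_pairing (htest t)).intervalIntegrable (μ := volume) 0 t)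
        ((hu.continuous_pairing (htest t)).intervalIntegrable (μ := volume) 0 s)
    rw [← e3, ← e1, ← e2, ← integral_sub (hint _ (by fun_prop)) (hint _ (by fun_prop)),
      ← integral_sub (hu.integrable_mul (htest t) t) (hu.integrable_mul (htest t) s)]
    refine integral_mono ((hint _ (by fun_prop)).sub (hint _ (by fun_prop)))
      ((hu.integrable_mul (htest t) t).sub (hu.integrable_mul (htest t) s)) fun x => ?_
    have := mul_le_mul_of_nonneg_right (hconv (u (t, x)) (u (s, x))) (hk0 x)
    simp only
    linarith

/-! ### Form-boundedness at almost every time -/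

lemma tendsto_integral_of_compact {F : ℕ → Space d → ℝ} {F₀ : Space d → ℝ}
    (hF : ∀ n, Continuous (F n)) {K : Set (Space d)} (hK : IsCompact K) {C : ℝ}
    (h0 : ∀ n x, x ∉ K → F n x = 0) (hC : ∀ n x, |F n x| ≤ C)
    (hlim : ∀ x, Tendsto (fun n => F n x) atTop (𝓝 (F₀ x))) :
    Tendsto (fun n => ∫ x, F n x) atTop (𝓝 (∫ x, F₀ x)) := by
  refine tendsto_integral_of_dominated_convergence (K.indicator fun _ => C)
    (fun n => (hF n).aestronglyMeasurable)
    ((integrable_indicator_iff hK.measurableSet).2 (integrableOn_const hK.measure_ne_top))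
    (fun n => ae_of_all _ fun x => ?_) (ae_of_all _ hlim)
  by_cases hx : x ∈ K
  · rw [indicator_of_mem hx]; exact hC n x
  · rw [indicator_of_notMem hx, h0 n x hx]; simp

namespace IsFormBounded

variable {b : ℝ × Space d → Space d} {δ : ℝ} {g : ℝ → ℝ}

lemma integrableOn_Icc (hb : IsFormBounded b δ g) {s t : ℝ} (hs : 0 ≤ s) :
    IntegrableOn g (Icc s t) :=
  hb.g_locallyIntegrable.integrableOn_compact_subset (fun _ hx => hs.trans hx.1) isCompact_Icc

lemma intervalIntegrable (hb : IsFormBounded b δ g) {s t : ℝ} (hs : 0 ≤ s) (hst : s ≤ t) :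
    IntervalIntegrable g volume s t := by
  rw [intervalIntegrable_iff_integrableOn_Icc_of_le hst]
  exact hb.integrableOn_Icc hs

lemma extend_nonneg (hb : IsFormBounded b δ g) (t : ℝ) : 0 ≤ (Ici (0 : ℝ)).indicator g t :=
  indicator_apply_nonneg fun ht => hb.g_nonneg t ht

lemma intervalIntegrable_indicator (hb : IsFormBounded b δ g) (s t : ℝ) :
    IntervalIntegrable ((Ici (0 : ℝ)).indicator g) volume s t := by
  rw [intervalIntegrable_iff]
  have h := hb.integrableOn_Icc (s := 0) (t := max s t) le_rfl
  rw [IntegrableOn, integrable_indicator_iff measurableSet_Ici, IntegrableOn,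
    Measure.restrict_restrict measurableSet_Ici]
  exact h.mono_set fun x hx => ⟨hx.1, hx.2.2⟩

/-- The form bound tested with `χ(t) φ(x)`, where the cutoff function `χ` of time is `1` on `[s, t]`
and supported in `[s - ε, t + ε]`. -/
lemma form_bound_thickened (hb : IsFormBounded b δ g) (hbc : Continuous b) {φ : Space d → ℝ}
    (hφ : ContDiff ℝ ∞ φ) (hφc : HasCompactSupport φ) {s t ε : ℝ} (hs : 0 ≤ s) (hst : s ≤ t)
    (hε : 0 < ε) :
    ∫ r in s..t, ∫ x, ‖φ x • b (r, x)‖ ^ 2 ≤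
      δ * ((t + ε - (s - ε)) * ∫ x, ‖gradient φ x‖ ^ 2) +
        (∫ r in (s - ε)..(t + ε), (Ici (0 : ℝ)).indicator g r) * ∫ x, φ x ^ 2 := by
  set D := ∫ x, ‖gradient φ x‖ ^ 2 with hD
  set Q := ∫ x, φ x ^ 2 with hQ
  have hD0 : 0 ≤ D := integral_nonneg fun x => by positivity
  have hQ0 : 0 ≤ Q := integral_nonneg fun x => by positivity
  have hφcont := hφ.continuous
  set n2 : ℝ → ℝ := fun r => ∫ x, ‖φ x • b (r, x)‖ ^ 2 with hn2
  have hn20 : ∀ r, 0 ≤ n2 r := fun r => integral_nonneg fun x => by positivity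
  have hn2c : Continuous n2 := by
    refine continuous_integral_of_compact (K := tsupport φ)
      (F := fun r x => ‖φ x • b (r, x)‖ ^ 2) ?_ hφc fun r x hx => ?_
    · simp only [Function.uncurry_def]; fun_prop
    · simp [image_eq_zero_of_notMem_tsupport hx]
  let χ : ContDiffBump ((s + t) / 2 : ℝ) :=
    ⟨(t - s) / 2 + ε / 2, (t - s) / 2 + ε, by linarith, by linarith⟩
  have hχ1 : ∀ r ∈ Icc s t, χ r = 1 := by
    intro r hr
    refine χ.one_of_mem_closedBall ?_
    rw [Metric.mem_closedBall, Real.dist_eq, abs_le]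
    change -((t - s) / 2 + ε / 2) ≤ _ ∧ _ ≤ (t - s) / 2 + ε / 2
    constructor <;> linarith [hr.1, hr.2]
  have hχ0 : ∀ r, r ∉ Ioc (s - ε) (t + ε) → χ r = 0 := by
    intro r hr
    refine χ.zero_of_le_dist ?_
    rw [Real.dist_eq]
    change (t - s) / 2 + ε ≤ _
    by_contra hlt
    rw [not_le, abs_lt] at hlt
    exact hr ⟨by linarith [hlt.1], by linarith [hlt.2]⟩
  have hχle : ∀ r, χ r ^ 2 ≤ 1 := fun r => pow_le_one₀ χ.nonneg χ.le_one
  have hχcs : HasCompactSupport (χ : ℝ → ℝ) := χ.hasCompactSupport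
  have hξc : HasCompactSupport fun z : ℝ × Space d => χ z.1 * φ z.2 := by
    refine HasCompactSupport.intro (hχcs.isCompact.prod hφc.isCompact) fun z hz => ?_
    by_cases h1 : z.1 ∈ tsupport χ
    · rw [image_eq_zero_of_notMem_tsupport (f := φ) (x := z.2) fun h2 => hz ⟨h1, h2⟩,
        mul_zero]
    · rw [image_eq_zero_of_notMem_tsupport h1, zero_mul]
  have key := hb.form_bound (fun z => χ z.1 * φ z.2)
    ((χ.contDiff.comp contDiff_fst).mul (hφ.comp contDiff_snd)) hξc
  have e1 : ∀ r, ∫ x, ‖(χ r * φ x) • b (r, x)‖ ^ 2 = χ r ^ 2 * n2 r := by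
    intro r
    rw [hn2, ← integral_const_mul]
    congr 1 with x
    rw [mul_smul, norm_smul, mul_pow, Real.norm_eq_abs, sq_abs]
  have e2 : ∀ r, ∫ x, ‖spatialGrad (fun z : ℝ × Space d => χ z.1 * φ z.2) r x‖ ^ 2 =
      χ r ^ 2 * D := by
    intro r
    rw [hD, ← integral_const_mul]
    congr 1 with x
    have h1 : HasGradientAt φ (gradient φ x) x :=
      (hφ.differentiable (by simp) x).hasGradientAt
    have h2 := hasGradientAt_mul (hasGradientAt_const (𝕜 := ℝ) x (χ r)) h1
    have h3 := h2.gradient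
    rw [smul_zero, add_zero] at h3
    change ‖gradient (fun y => χ r * φ y) x‖ ^ 2 = _
    rw [h3, norm_smul, mul_pow, Real.norm_eq_abs, sq_abs]
  have e3 : ∀ r, ∫ x, (χ r * φ x) ^ 2 = χ r ^ 2 * Q := by
    intro r
    rw [hQ, ← integral_const_mul]
    congr 1 with x
    rw [mul_pow]
  simp only [e1, e2, e3] at key
  have low : ∫ r in s..t, n2 r ≤ ∫ r in Ioi (0 : ℝ), χ r ^ 2 * n2 r := by
    rw [intervalIntegral.integral_of_le hst]
    have : ∫ r in Ioc s t, n2 r = ∫ r in Ioc s t, χ r ^ 2 * n2 r :=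
      setIntegral_congr_fun measurableSet_Ioc fun r hr => by
        simp [hχ1 r ⟨hr.1.le, hr.2⟩]
    rw [this]
    refine setIntegral_mono_set ?_ (ae_of_all _ fun r => mul_nonneg (sq_nonneg _) (hn20 r))
      (ae_of_all _ fun r hr => lt_of_le_of_lt hs hr.1)
    refine Integrable.integrableOn (Continuous.integrable_of_hasCompactSupport ?_ ?_)
    · exact (χ.continuous.pow 2).mul hn2c
    · exact HasCompactSupport.mul_right (f := fun r => χ r ^ 2)
        (by simp only [sq]; exact hχcs.mul_right)
  have up : ∀ F : ℝ → ℝ, (∀ r, 0 ≤ F r) → IntegrableOn F (Ioc (s - ε) (t + ε)) →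
      ∫ r in Ioi (0 : ℝ), χ r ^ 2 * F r ≤ ∫ r in (s - ε)..(t + ε), F r := by
    intro F hF hFi
    rw [intervalIntegral.integral_of_le (by linarith),
      ← integral_indicator (measurableSet_Ioc (a := s - ε) (b := t + ε))]
    have hFi' : Integrable ((Ioc (s - ε) (t + ε)).indicator F) :=
      (integrable_indicator_iff measurableSet_Ioc).2 hFi
    refine (integral_mono_of_nonneg (ae_of_all _ fun r => mul_nonneg (sq_nonneg _) (hF r))
      hFi'.integrableOn (ae_of_all _ fun r => ?_)).trans
      (setIntegral_le_integral hFi' (ae_of_all _ fun r => Set.indicator_nonneg (fun r _ => hF r) r))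
    by_cases hr : r ∈ Ioc (s - ε) (t + ε)
    · simp only [indicator_of_mem hr]
      exact mul_le_of_le_one_left (hF r) (hχle r)
    · simp [indicator_of_notMem hr, hχ0 r hr]
  have u1 := up (fun _ => D) (fun _ => hD0) (integrableOn_const (by simp))
  have u2 := up (fun r => (Ici (0 : ℝ)).indicator g r * Q)
    (fun r => mul_nonneg (hb.extend_nonneg r) hQ0)
    (((hb.intervalIntegrable_indicator _ _).1).mul_const Q)
  rw [intervalIntegral.integral_const, smul_eq_mul] at u1
  rw [intervalIntegral.integral_mul_const] at u2
  have e4 : ∫ r in Ioi (0 : ℝ), g r * (χ r ^ 2 * Q) =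
      ∫ r in Ioi (0 : ℝ), χ r ^ 2 * ((Ici (0 : ℝ)).indicator g r * Q) := by
    refine setIntegral_congr_fun measurableSet_Ioi fun r hr => ?_
    rw [mem_Ioi] at hr
    simp only [indicator_of_mem (show r ∈ Ici (0 : ℝ) from hr.le)]
    ring
  rw [e4] at key
  exact low.trans (key.trans (add_le_add (mul_le_mul_of_nonneg_left u1 hb.delta_pos.le) u2))

lemma form_bound_interval (hb : IsFormBounded b δ g) (hbc : Continuous b) {φ : Space d → ℝ}
    (hφ : ContDiff ℝ ∞ φ) (hφc : HasCompactSupport φ) {s t : ℝ} (hs : 0 ≤ s) (hst : s ≤ t) :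
    ∫ r in s..t, ∫ x, ‖φ x • b (r, x)‖ ^ 2 ≤
      δ * ((t - s) * ∫ x, ‖gradient φ x‖ ^ 2) +
        (∫ r in s..t, (Ici (0 : ℝ)).indicator g r) * ∫ x, φ x ^ 2 := by
  have hint := hb.intervalIntegrable_indicator
  have hP : Continuous fun y => ∫ r in (0 : ℝ)..y, (Ici (0 : ℝ)).indicator g r :=
    intervalIntegral.continuous_primitive hint 0
  have e : ∀ y z, ∫ r in y..z, (Ici (0 : ℝ)).indicator g r =
      (∫ r in (0 : ℝ)..z, (Ici (0 : ℝ)).indicator g r) -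
        ∫ r in (0 : ℝ)..y, (Ici (0 : ℝ)).indicator g r := fun y z =>
    (intervalIntegral.integral_interval_sub_left (hint 0 z) (hint 0 y)).symm
  have hc : Continuous fun ε : ℝ => δ * ((t + ε - (s - ε)) * ∫ x, ‖gradient φ x‖ ^ 2) +
      (∫ r in (s - ε)..(t + ε), (Ici (0 : ℝ)).indicator g r) * ∫ x, φ x ^ 2 := by
    simp only [fun ε : ℝ => e (s - ε) (t + ε)]
    have h1 : Continuous fun ε : ℝ => ∫ r in (0 : ℝ)..(t + ε), (Ici (0 : ℝ)).indicator g r :=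
      hP.comp (continuous_const.add continuous_id)
    have h2 : Continuous fun ε : ℝ => ∫ r in (0 : ℝ)..(s - ε), (Ici (0 : ℝ)).indicator g r :=
      hP.comp (continuous_const.sub continuous_id)
    fun_prop
  have hl := (hc.tendsto 0).mono_left (nhdsWithin_le_nhds (s := Ioi 0))
  simp only [add_zero, sub_zero] at hl
  exact ge_of_tendsto hl (eventually_mem_nhdsWithin.mono fun ε hε =>
    hb.form_bound_thickened hbc hφ hφc hs hst hε)

/-- The form bound holds at almost every fixed time, for all test functions simultaneously: at a
Lebesgue point of `g` it follows by differentiating the time-integrated inequality. -/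
lemma ae_form_bound_smooth (hb : IsFormBounded b δ g) (hbc : Continuous b) :
    ∀ᵐ t : ℝ, 0 < t → ∀ φ : Space d → ℝ, ContDiff ℝ ∞ φ → HasCompactSupport φ →
      ∫ x, ‖φ x • b (t, x)‖ ^ 2 ≤
        δ * (∫ x, ‖gradient φ x‖ ^ 2) + g t * ∫ x, φ x ^ 2 := by
  have hint := hb.intervalIntegrable_indicator
  have hloc : LocallyIntegrable ((Ici (0 : ℝ)).indicator g) := by
    rw [locallyIntegrable_iff]
    intro k hk
    obtain ⟨R, hR⟩ := hk.isBounded.subset_closedBall 0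
    refine IntegrableOn.mono_set ?_ hR
    rw [Real.closedBall_eq_Icc]
    by_cases h : 0 ≤ R
    · exact (intervalIntegrable_iff_integrableOn_Icc_of_le (by linarith)).1 (hint _ _)
    · rw [Icc_eq_empty (by linarith)]; simp
  filter_upwards [LocallyIntegrable.ae_hasDerivAt_integral hloc] with t ht ht0 φ hφ hφc
  have hφcont := hφ.continuous
  set D := ∫ x, ‖gradient φ x‖ ^ 2 with hD
  set Q := ∫ x, φ x ^ 2 with hQ
  set n2 : ℝ → ℝ := fun r => ∫ x, ‖φ x • b (r, x)‖ ^ 2 with hn2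
  have hn2c : Continuous n2 := by
    refine continuous_integral_of_compact (K := tsupport φ)
      (F := fun r x => ‖φ x • b (r, x)‖ ^ 2) ?_ hφc fun r x hx => ?_
    · simp only [Function.uncurry_def]; fun_prop
    · simp [image_eq_zero_of_notMem_tsupport hx]
  set m : ℝ → ℝ := fun y => δ * (y * D) + (∫ r in (0 : ℝ)..y, (Ici (0 : ℝ)).indicator g r) * Q -
    ∫ r in (0 : ℝ)..y, n2 r with hm
  have hmono : MonotoneOn m (Ici 0) := by
    intro y hy z _ hyz
    have h1 := hb.form_bound_interval hbc hφ hφc hy hyz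
    rw [← intervalIntegral.integral_interval_sub_left (hint 0 z) (hint 0 y),
      ← intervalIntegral.integral_interval_sub_left (hn2c.intervalIntegrable (μ := volume) 0 z)
        (hn2c.intervalIntegrable 0 y)] at h1
    simp only [hm]
    linarith
  have hder : HasDerivAt m (δ * (1 * D) + (Ici (0 : ℝ)).indicator g t * Q - n2 t) t :=
    ((((hasDerivAt_id t).mul_const D).const_mul δ).add ((ht 0).mul_const Q)).sub
      (intervalIntegral.integral_hasDerivAt_right (hn2c.intervalIntegrable _ _)
        hn2c.stronglyMeasurable.stronglyMeasurableAtFilter hn2c.continuousAt)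
  have hnn := hmono.derivWithin_nonneg (x := t)
  rw [(hder.hasDerivWithinAt (s := Ici 0)).derivWithin
    ((uniqueDiffOn_Ici (0 : ℝ)) t ht0.le), indicator_of_mem (show t ∈ Ici (0 : ℝ) from ht0.le)]
    at hnn
  simp only [hn2] at hnn
  linarith

/-- The form bound at almost every time, for test functions of class `C^1`. The exceptional times
do not depend on the test function, which may therefore be taken to be `|u|^{q/2-1} u η` at the
time in question. -/
lemma ae_form_bound (hb : IsFormBounded b δ g) (hbc : Continuous b) :
    ∀ᵐ t : ℝ, 0 < t → ∀ (ψ : Space d → ℝ) (ψ' : Space d → Space d), IsC1Test ψ ψ' →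
      ∫ x, ‖b (t, x)‖ ^ 2 * ψ x ^ 2 ≤ δ * (∫ x, ‖ψ' x‖ ^ 2) + g t * ∫ x, ψ x ^ 2 := by
  filter_upwards [hb.ae_form_bound_smooth hbc] with t ht ht0 ψ ψ' hψ
  choose φ hφ hφc hφK hφε using fun n : ℕ =>
    hψ.exists_smooth_approx (ε := 1 / ((n : ℝ) + 1)) (by positivity)
  have hle1 : ∀ n : ℕ, 1 / ((n : ℝ) + 1) ≤ 1 := fun n => by
    rw [div_le_one (by positivity)]; linarith [n.cast_nonneg (α := ℝ)]
  set K := Metric.cthickening 1 (tsupport ψ) with hKdef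
  have hK : IsCompact K := hψ.hasCompactSupport.cthickening
  have hφ1 : ∀ n, IsC1Test (φ n) (gradient (φ n)) := fun n =>
    IsC1Test.of_contDiff (hφ n) (by simp) (hφc n)
  have hz : ∀ n x, x ∉ K → φ n x = 0 ∧ gradient (φ n) x = 0 := fun n x hx =>
    ⟨image_eq_zero_of_notMem_tsupport fun h => hx (hφK n h), (hφ1 n).grad_eq_zero fun h => hx (hφK n h)⟩
  obtain ⟨C₁, hC₁⟩ := hψ.hasCompactSupport.exists_bound_of_continuous hψ.continuous
  have hψ'c : HasCompactSupport ψ' :=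
    HasCompactSupport.intro hψ.hasCompactSupport fun x hx => hψ.grad_eq_zero hx
  obtain ⟨C₂, hC₂⟩ := hψ'c.exists_bound_of_continuous hψ.continuous_grad
  obtain ⟨C₃, hC₃⟩ := hK.exists_bound_of_continuousOn (f := fun x => b (t, x)) (by fun_prop)
  have hlim0 : Tendsto (fun n : ℕ => 1 / ((n : ℝ) + 1)) atTop (𝓝 0) :=
    tendsto_one_div_add_atTop_nhds_zero_nat
  have l1 : ∀ x, Tendsto (fun n => φ n x) atTop (𝓝 (ψ x)) := fun x => by
    rw [tendsto_iff_dist_tendsto_zero]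
    exact squeeze_zero (fun _ => dist_nonneg) (fun n => (hφε n x).1) hlim0
  have l2 : ∀ x, Tendsto (fun n => gradient (φ n) x) atTop (𝓝 (ψ' x)) := fun x => by
    rw [tendsto_iff_norm_sub_tendsto_zero]
    exact squeeze_zero (fun _ => norm_nonneg _) (fun n => (hφε n x).2) hlim0
  have b1 : ∀ n x, φ n x ^ 2 ≤ (C₁ + 1) ^ 2 := fun n x => by
    have h1 := abs_le.1 ((hφε n x).1.trans (hle1 n))
    have h2 := abs_le.1 (hC₁ x)
    apply sq_le_sq' <;> linarith
  have b2 : ∀ n x, ‖gradient (φ n) x‖ ^ 2 ≤ (C₂ + 1) ^ 2 := fun n x => by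
    have h1 := (hφε n x).2.trans (hle1 n)
    have h2 := hC₂ x
    have h3 := norm_sub_norm_le (gradient (φ n) x) (ψ' x)
    exact pow_le_pow_left₀ (norm_nonneg _) (by linarith) 2
  have t1 : Tendsto (fun n => ∫ x, ‖b (t, x)‖ ^ 2 * φ n x ^ 2) atTop
      (𝓝 (∫ x, ‖b (t, x)‖ ^ 2 * ψ x ^ 2)) := by
    refine tendsto_integral_of_compact (fun n => ?_) hK (C := C₃ ^ 2 * (C₁ + 1) ^ 2)
      (fun n x hx => by simp [hz n x hx]) (fun n x => ?_)
      (fun x => tendsto_const_nhds.mul ((l1 x).pow 2))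
    · have := (hφ n).continuous
      fun_prop
    · rw [abs_of_nonneg (by positivity)]
      by_cases hx : x ∈ K
      · exact mul_le_mul (pow_le_pow_left₀ (norm_nonneg _) (hC₃ x hx) 2) (b1 n x) (sq_nonneg _)
          (sq_nonneg _)
      · simp only [hz n x hx]
        norm_num
        positivity
  have t2 : Tendsto (fun n => ∫ x, ‖gradient (φ n) x‖ ^ 2) atTop (𝓝 (∫ x, ‖ψ' x‖ ^ 2)) :=
    tendsto_integral_of_compact (fun n => ((hφ1 n).continuous_grad.norm.pow 2)) hK
      (C := (C₂ + 1) ^ 2) (fun n x hx => by simp [hz n x hx])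
      (fun n x => by rw [abs_of_nonneg (by positivity)]; exact b2 n x)
      (fun x => (l2 x).norm.pow 2)
  have t3 : Tendsto (fun n => ∫ x, φ n x ^ 2) atTop (𝓝 (∫ x, ψ x ^ 2)) :=
    tendsto_integral_of_compact (fun n => ((hφ n).continuous.pow 2)) hK
      (C := (C₁ + 1) ^ 2) (fun n x hx => by simp [hz n x hx])
      (fun n x => by rw [abs_of_nonneg (by positivity)]; exact b1 n x)
      (fun x => (l1 x).pow 2)
  refine le_of_tendsto_of_tendsto' t1 ((t2.const_mul δ).add (t3.const_mul (g t))) fun n => ?_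
  refine le_trans (le_of_eq ?_) (ht ht0 (φ n) (hφ n) (hφc n))
  congr 1 with x
  rw [norm_smul, mul_pow, Real.norm_eq_abs, sq_abs, mul_comm]

end IsFormBounded

/-! ### Elementary inequalities -/

lemma hasDerivAt_abs_rpow_mul_self {a : ℝ} (ha : 0 ≤ a) (s : ℝ) :
    HasDerivAt (fun s : ℝ => |s| ^ a * s) ((a + 1) * |s| ^ a) s := by
  rcases ha.eq_or_lt with rfl | ha
  · simpa using hasDerivAt_id' s
  rcases lt_trichotomy s 0 with hs | rfl | hs
  · have h1 : HasDerivAt (fun s : ℝ => -((-s) ^ (a + 1))) ((a + 1) * |s| ^ a) s := by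
      have := ((hasDerivAt_id s).neg.rpow_const (p := a + 1) (Or.inr (by linarith))).neg
      refine this.congr_deriv ?_
      rw [abs_of_neg hs]
      simp
      ring
    refine h1.congr_of_eventuallyEq ?_
    filter_upwards [Iio_mem_nhds hs] with y hy
    rw [mem_Iio] at hy
    rw [abs_of_neg hy, Real.rpow_add_one (by linarith)]
    ring
  · have h0 : (|(0 : ℝ)|) ^ a = 0 := by rw [abs_zero, Real.zero_rpow ha.ne']
    rw [h0, mul_zero, hasDerivAt_iff_isLittleO]
    simp only [mul_zero, smul_eq_mul, sub_zero]
    have h1 : (fun s : ℝ => |s| ^ a) =o[𝓝 0] fun _ => (1 : ℝ) := by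
      have h2 := (continuous_abs.rpow_const (p := a) fun _ => Or.inr ha.le).tendsto (0 : ℝ)
      rw [h0] at h2
      exact (Asymptotics.isLittleO_one_iff ℝ).2 h2
    simpa using h1.mul_isBigO (Asymptotics.isBigO_refl (fun s : ℝ => s) (𝓝 0))
  · have h1 : HasDerivAt (fun s : ℝ => s ^ (a + 1)) ((a + 1) * |s| ^ a) s := by
      have := (hasDerivAt_id s).rpow_const (p := a + 1) (Or.inr (by linarith))
      refine this.congr_deriv ?_
      rw [abs_of_pos hs]
      simp
    refine h1.congr_of_eventuallyEq ?_
    filter_upwards [Ioi_mem_nhds hs] with y hy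
    rw [mem_Ioi] at hy
    rw [abs_of_pos hy, Real.rpow_add_one hy.ne']

lemma continuous_abs_rpow {a : ℝ} (ha : 0 ≤ a) : Continuous fun s : ℝ => |s| ^ a :=
  continuous_abs.rpow_const fun _ => Or.inr ha

lemma abs_rpow_half_sq (s a : ℝ) : (|s| ^ (a / 2)) ^ 2 = |s| ^ a := by
  rw [← Real.rpow_natCast, ← Real.rpow_mul (abs_nonneg _)]
  norm_num

lemma abs_rpow_sub_two_mul_sq {q : ℝ} (hq : 2 ≤ q) (s : ℝ) : |s| ^ (q - 2) * s ^ 2 = |s| ^ q := by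
  rcases eq_or_ne s 0 with rfl | hs
  · rw [abs_zero, Real.zero_rpow (by linarith : q ≠ 0)]; simp
  · rw [← sq_abs, ← Real.rpow_natCast, ← Real.rpow_add (abs_pos.2 hs)]
    norm_num

/-- The tangent line inequality for the convex function `|s|^q`. -/
lemma abs_rpow_sub_le {q : ℝ} (hq : 2 ≤ q) (a b : ℝ) :
    |a| ^ q - |b| ^ q ≤ q * (|a| ^ (q - 2) * a) * (a - b) := by
  have hq0 : 0 < q := by linarith
  have h1 := abs_rpow_sub_two_mul_sq hq a
  have h2 : -(|a| ^ (q - 2) * a * b) ≥ -(((q - 1) / q) * |a| ^ q + (1 / q) * |b| ^ q) := by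
    have h3 := Real.geom_mean_le_arith_mean2_weighted (w₁ := (q - 1) / q) (w₂ := 1 / q)
      (p₁ := |a| ^ q) (p₂ := |b| ^ q) (div_nonneg (by linarith) hq0.le) (by positivity)
      (by positivity) (by positivity) (by field_simp; ring)
    rw [← Real.rpow_mul (abs_nonneg _), ← Real.rpow_mul (abs_nonneg _),
      mul_div_cancel₀ _ hq0.ne', mul_div_cancel₀ _ hq0.ne', Real.rpow_one] at h3
    have h4 : |a| ^ (q - 2) * a * b ≤ |a| ^ (q - 1) * |b| := by
      refine (le_abs_self _).trans (le_of_eq ?_)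
      rw [abs_mul, abs_mul, abs_of_nonneg (by positivity : 0 ≤ |a| ^ (q - 2))]
      rcases eq_or_ne a 0 with rfl | ha
      · rw [abs_zero, Real.zero_rpow (by linarith : q - 1 ≠ 0)]; simp
      · rw [← Real.rpow_add_one (abs_pos.2 ha).ne']
        congr 2; ring
    linarith
  have h5 := mul_le_mul_of_nonneg_left h2.le hq0.le
  have h6 : q * -(((q - 1) / q) * |a| ^ q + (1 / q) * |b| ^ q) =
      -((q - 1) * |a| ^ q + |b| ^ q) := by field_simp
  rw [h6] at h5
  have : q * (|a| ^ (q - 2) * a) * (a - b) = q * (|a| ^ (q - 2) * a ^ 2) +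
    q * -(|a| ^ (q - 2) * a * b) := by ring
  rw [this, h1]
  linarith

/-- Absorption of the source term. Where `1 ≤ a`, the exponent `2 - p` of `a` which appears in
Young's inequality is nonpositive, so that no power of `a` is left in front of `F^p`. -/
lemma mul_rpow_le_cutPow {p q ε a F s : ℝ} (hp : 2 ≤ p) (hq : 0 < q) (hε : 0 < ε) (ha : 0 ≤ a)
    (hF : 0 ≤ F) (hs : 0 ≤ s) :
    q * a * F * s ^ (p - 1) ≤
      ε * (a ^ 2 + 1) * s ^ p + q ^ p * ε ^ (1 - p) * (cutPow p a * F ^ p) := by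
  have hp1 : 0 ≤ p - 1 := by linarith
  have hsp : ∀ x : ℝ, 0 ≤ x → x * x ^ (p - 1) = x ^ p := by
    intro x hx
    rcases hx.eq_or_lt with rfl | hx
    · rw [Real.zero_rpow (by linarith : p ≠ 0)]; simp
    · rw [mul_comm, ← Real.rpow_add_one hx.ne']; congr 1; ring
  have hcut0 : 0 ≤ cutPow p a := by
    unfold cutPow; split_ifs <;> positivity
  have hR1 : 0 ≤ ε * (a ^ 2 + 1) * s ^ p := by positivity
  have hR2 : 0 ≤ q ^ p * ε ^ (1 - p) * (cutPow p a * F ^ p) := by positivity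
  have hεp : ε ^ (1 - p) = (ε ^ (p - 1))⁻¹ := by
    rw [← Real.rpow_neg hε.le]; congr 1; ring
  by_cases h1 : 1 ≤ a
  · have ha0 : 0 < a := by linarith
    by_cases h2 : q * F ≤ ε * a * s
    · have : q * a * F * s ^ (p - 1) ≤ ε * (a ^ 2 + 1) * s ^ p := by
        calc q * a * F * s ^ (p - 1) = (q * F) * (a * s ^ (p - 1)) := by ring
          _ ≤ (ε * a * s) * (a * s ^ (p - 1)) :=
            mul_le_mul_of_nonneg_right h2 (by positivity)
          _ = ε * a ^ 2 * s ^ p := by rw [← hsp s hs]; ring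
          _ ≤ ε * (a ^ 2 + 1) * s ^ p := by gcongr; linarith
      linarith
    · have h3 : s ≤ q * F / (ε * a) := by
        rw [le_div_iff₀ (by positivity)]; linarith
      have h4 : s ^ (p - 1) ≤ (q * F / (ε * a)) ^ (p - 1) := Real.rpow_le_rpow hs h3 hp1
      have h5 : q * a * F * s ^ (p - 1) ≤ q ^ p * ε ^ (1 - p) * (cutPow p a * F ^ p) := by
        have ha2 : a ≤ a ^ (p - 1) := by
          conv_lhs => rw [← Real.rpow_one a]
          exact Real.rpow_le_rpow_of_exponent_le h1 (by linarith)
        calc q * a * F * s ^ (p - 1) ≤ q * a * F * (q * F / (ε * a)) ^ (p - 1) :=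
            mul_le_mul_of_nonneg_left h4 (by positivity)
          _ = (q * q ^ (p - 1)) * (F * F ^ (p - 1)) * (ε ^ (p - 1))⁻¹ * (a / a ^ (p - 1)) := by
            rw [Real.div_rpow (by positivity) (by positivity), Real.mul_rpow hq.le hF,
              Real.mul_rpow hε.le ha]
            field_simp
          _ ≤ (q * q ^ (p - 1)) * (F * F ^ (p - 1)) * (ε ^ (p - 1))⁻¹ * 1 := by
            refine mul_le_mul_of_nonneg_left ?_ (by positivity)
            rw [div_le_one (by positivity)]
            exact ha2
          _ = q ^ p * ε ^ (1 - p) * (cutPow p a * F ^ p) := by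
            rw [hsp q hq.le, hsp F hF, hεp, cutPow, if_pos h1]; ring
      linarith
  · by_cases h2 : q * a * F ≤ ε * s
    · have : q * a * F * s ^ (p - 1) ≤ ε * (a ^ 2 + 1) * s ^ p := by
        calc q * a * F * s ^ (p - 1) ≤ (ε * s) * s ^ (p - 1) :=
            mul_le_mul_of_nonneg_right h2 (by positivity)
          _ = ε * 1 * s ^ p := by rw [← hsp s hs]; ring
          _ ≤ ε * (a ^ 2 + 1) * s ^ p := by
            gcongr
            linarith [sq_nonneg a]
      linarith
    · have h3 : s ≤ q * a * F / ε := by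
        rw [le_div_iff₀ hε]; linarith
      have h4 : s ^ (p - 1) ≤ (q * a * F / ε) ^ (p - 1) := Real.rpow_le_rpow hs h3 hp1
      have h5 : q * a * F * s ^ (p - 1) ≤ q ^ p * ε ^ (1 - p) * (cutPow p a * F ^ p) := by
        calc q * a * F * s ^ (p - 1) ≤ q * a * F * (q * a * F / ε) ^ (p - 1) :=
            mul_le_mul_of_nonneg_left h4 (by positivity)
          _ = (q * q ^ (p - 1)) * (F * F ^ (p - 1)) * (ε ^ (p - 1))⁻¹ * (a * a ^ (p - 1)) := by
            rw [Real.div_rpow (by positivity) (by positivity), Real.mul_rpow (by positivity) hF,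
              Real.mul_rpow hq.le ha]
            field_simp
          _ = q ^ p * ε ^ (1 - p) * (cutPow p a * F ^ p) := by
            rw [hsp q hq.le, hsp F hF, hsp a ha, hεp, cutPow, if_neg h1]; ring
      linarith

/-- The quadratic form of the energy inequality, in terms of `P = ∇(w η)` and `N = w ∇η`, so that
`η ∇w = P - N`. -/
lemma quadratic_form_le {b P N : Space d} {ζ k s ε : ℝ} (hk2 : 2 ≤ k) (hk4 : k ≤ 4) (hs : 0 < s)
    (hε : 0 < ε) :
    -(2 * (inner ℝ b (P - N) * ζ)) - 4 * inner ℝ (P - N) N - k * ‖P - N‖ ^ 2 ≤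
      -(k - ε - s) * ‖P‖ ^ 2 + (1 / s + ε) * (‖b‖ ^ 2 * ζ ^ 2) + (2 + 5 / ε) * ‖N‖ ^ 2 := by
  have e1 : inner ℝ (P - N) N = inner ℝ P N - ‖N‖ ^ 2 := by
    rw [inner_sub_left, real_inner_self_eq_norm_sq]
  have e2 : ‖P - N‖ ^ 2 = ‖P‖ ^ 2 - 2 * inner ℝ P N + ‖N‖ ^ 2 := norm_sub_sq_real P N
  rw [inner_sub_right, e1, e2]
  have young : ∀ (x y c : ℝ), 0 < c → 2 * (x * y) ≤ (1 / c) * x ^ 2 + c * y ^ 2 := by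
    intro x y c hc
    have : (1 / c) * x ^ 2 + c * y ^ 2 - 2 * (x * y) = (1 / c) * (x - c * y) ^ 2 := by
      field_simp; ring
    have h2 : 0 ≤ (1 / c) * (x - c * y) ^ 2 := by positivity
    linarith
  have b1 : -(2 * (inner ℝ b P * ζ)) ≤ (1 / s) * (‖b‖ ^ 2 * ζ ^ 2) + s * ‖P‖ ^ 2 := by
    have h1 := young (‖b‖ * |ζ|) ‖P‖ s hs
    have h2 : -(inner ℝ b P * ζ) ≤ ‖b‖ * |ζ| * ‖P‖ := by
      refine (neg_le_abs _).trans ?_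
      rw [abs_mul]
      have := mul_le_mul_of_nonneg_right (abs_real_inner_le_norm b P) (abs_nonneg ζ)
      linarith
    rw [mul_pow, sq_abs] at h1
    linarith
  have b2 : 2 * (inner ℝ b N * ζ) ≤ ε * (‖b‖ ^ 2 * ζ ^ 2) + (1 / ε) * ‖N‖ ^ 2 := by
    have h1 := young ‖N‖ (‖b‖ * |ζ|) ε hε
    have h2 : inner ℝ b N * ζ ≤ ‖N‖ * (‖b‖ * |ζ|) := by
      refine (le_abs_self _).trans ?_
      rw [abs_mul]
      have := mul_le_mul_of_nonneg_right (abs_real_inner_le_norm b N) (abs_nonneg ζ)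
      linarith
    rw [mul_pow, sq_abs] at h1
    linarith
  have b3 : (2 * k - 4) * inner ℝ P N ≤ ε * ‖P‖ ^ 2 + (4 / ε) * ‖N‖ ^ 2 := by
    have h1 := young ‖N‖ (‖P‖) (ε / 2) (by positivity)
    have h2 : (2 * k - 4) * inner ℝ P N ≤ 4 * (‖P‖ * ‖N‖) := by
      have h3 := (le_abs_self _).trans (abs_real_inner_le_norm P N)
      have h4 : 0 ≤ ‖P‖ * ‖N‖ := by positivity
      nlinarith
    have h5 : 1 / (ε / 2) = (4 / ε) / 2 := by field_simp; norm_num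
    rw [h5] at h1
    linarith
  have h5 : (2 + 5 / ε) * ‖N‖ ^ 2 = 2 * ‖N‖ ^ 2 + (4 / ε) * ‖N‖ ^ 2 + (1 / ε) * ‖N‖ ^ 2 := by
    ring
  have h6 : (4 - k) * ‖N‖ ^ 2 ≤ 2 * ‖N‖ ^ 2 :=
    mul_le_mul_of_nonneg_right (by linarith) (by positivity)
  rw [h5]
  nlinarith

/-- Gronwall's inequality with an integrable coefficient `a`: over an interval on which the
integral of `a` is at most `1 / 2` the right hand side at most doubles. -/
lemma gronwall_integrable {T B : ℝ} {a E : ℝ → ℝ} (hE : Continuous E)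
    (hE0 : ∀ t, 0 ≤ E t) (ha : IntervalIntegrable a volume 0 T) (ha0 : ∀ t ∈ Icc 0 T, 0 ≤ a t)
    (h : ∀ t ∈ Icc 0 T, E t ≤ B + ∫ s in (0 : ℝ)..t, a s * E s) (n : ℕ) :
    ∀ t ∈ Icc 0 T, ∫ s in (0 : ℝ)..t, a s ≤ n / 2 →
      B + ∫ s in (0 : ℝ)..t, a s * E s ≤ 2 ^ n * B := by
  have hsub : ∀ s t, 0 ≤ s → s ≤ t → t ≤ T → IntervalIntegrable a volume s t := by
    intro s t hs hst ht
    refine ha.mono_set ?_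
    rw [uIcc_of_le hst, uIcc_of_le (hs.trans (hst.trans ht))]
    exact Icc_subset_Icc hs ht
  have hsubE : ∀ s t, 0 ≤ s → s ≤ t → t ≤ T →
      IntervalIntegrable (fun r => a r * E r) volume s t := fun s t hs hst ht =>
    (hsub s t hs hst ht).mul_continuousOn hE.continuousOn
  set R : ℝ → ℝ := fun t => B + ∫ s in (0 : ℝ)..t, a s * E s with hR
  have hRsub : ∀ s t, 0 ≤ s → s ≤ t → t ≤ T → R t - R s = ∫ r in s..t, a r * E r := by
    intro s t hs hst ht
    rw [← intervalIntegral.integral_interval_sub_left (hsubE 0 t le_rfl (hs.trans hst) ht)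
      (hsubE 0 s le_rfl hs (hst.trans ht))]
    simp only [hR]; ring
  have hRmono : ∀ s t, 0 ≤ s → s ≤ t → t ≤ T → R s ≤ R t := by
    intro s t hs hst ht
    have : 0 ≤ ∫ r in s..t, a r * E r := intervalIntegral.integral_nonneg hst fun r hr =>
      mul_nonneg (ha0 r ⟨hs.trans hr.1, hr.2.trans ht⟩) (hE0 r)
    linarith [hRsub s t hs hst ht]
  have step : ∀ s t, 0 ≤ s → s ≤ t → t ≤ T → ∫ r in s..t, a r ≤ 1 / 2 → R t ≤ 2 * R s := by
    intro s t hs hst ht hA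
    have hRt : 0 ≤ R t := (hE0 t).trans (h t ⟨hs.trans hst, ht⟩)
    have h1 : ∫ r in s..t, a r * E r ≤ ∫ r in s..t, a r * R t := by
      refine intervalIntegral.integral_mono_on hst (hsubE s t hs hst ht)
        ((hsub s t hs hst ht).mul_const _) fun r hr => ?_
      refine mul_le_mul_of_nonneg_left ?_ (ha0 r ⟨hs.trans hr.1, hr.2.trans ht⟩)
      exact (h r ⟨hs.trans hr.1, hr.2.trans ht⟩).trans (hRmono r t (hs.trans hr.1) hr.2 ht)
    rw [intervalIntegral.integral_mul_const] at h1
    have h2 := hRsub s t hs hst ht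
    nlinarith
  have hR0 : R 0 = B := by simp [hR]
  change ∀ t ∈ Icc 0 T, ∫ s in (0 : ℝ)..t, a s ≤ n / 2 → R t ≤ 2 ^ n * B
  induction n with
  | zero =>
    intro t ht hA
    have hA0 : ∫ r in (0 : ℝ)..t, a r ≤ 0 := by simpa using hA
    have hRt : 0 ≤ R t := (hE0 t).trans (h t ht)
    have h1 : ∫ r in (0 : ℝ)..t, a r * E r ≤ ∫ r in (0 : ℝ)..t, a r * R t := by
      refine intervalIntegral.integral_mono_on ht.1 (hsubE 0 t le_rfl ht.1 ht.2)
        ((hsub 0 t le_rfl ht.1 ht.2).mul_const _) fun r hr => ?_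
      refine mul_le_mul_of_nonneg_left ?_ (ha0 r ⟨hr.1, hr.2.trans ht.2⟩)
      exact (h r ⟨hr.1, hr.2.trans ht.2⟩).trans (hRmono r t hr.1 hr.2 ht.2)
    rw [intervalIntegral.integral_mul_const] at h1
    have h2 := hRsub 0 t le_rfl ht.1 ht.2
    rw [pow_zero, one_mul]
    nlinarith
  | succ n ih =>
    intro t ht hA
    by_cases hn : ∫ s in (0 : ℝ)..t, a s ≤ n / 2
    · have h1 := ih t ht hn
      have h2 : 0 ≤ R t := (hE0 t).trans (h t ht)
      rw [pow_succ]
      linarith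
    · rw [not_le] at hn
      have hcont : ContinuousOn (fun y => ∫ s in (0 : ℝ)..y, a s) (Icc 0 t) := by
        have := intervalIntegral.continuousOn_primitive_interval (μ := volume) (f := a)
          (a := 0) (b := t) (by
            rw [uIcc_of_le ht.1]
            exact (intervalIntegrable_iff_integrableOn_Icc_of_le ht.1).1
              (hsub 0 t le_rfl ht.1 ht.2))
        rwa [uIcc_of_le ht.1] at this
      obtain ⟨s, hs, hs2⟩ := intermediate_value_Icc ht.1 hcont
        (show (n : ℝ) / 2 ∈ _ from ⟨by simp; positivity, hn.le⟩)
      simp only at hs2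
      have hsT : s ∈ Icc 0 T := ⟨hs.1, hs.2.trans ht.2⟩
      have h1 := ih s hsT hs2.le
      have h2 := step s t hs.1 hs.2 ht.2 (by
        rw [← intervalIntegral.integral_interval_sub_left (hsub 0 t le_rfl ht.1 ht.2)
          (hsub 0 s le_rfl hs.1 hsT.2), hs2]
        push_cast at hA
        linarith)
      rw [pow_succ]
      linarith

/-! ### Weighted energy estimates -/

/-- A solution of the Cauchy problem for `∂_t - Δ + b · ∇` with right hand side `|h| f`, for
continuous form-bounded `b` and `h`; `u` and its gradient `du` are extended to all times. -/
structure IsDriftSolution (T M δ ν : ℝ) (b h : ℝ × Space d → Space d) (gδ gν : ℝ → ℝ)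
    (f u : ℝ × Space d → ℝ) (du : ℝ × Space d → Space d) : Prop where
  continuous_drift : Continuous b
  formBounded_drift : IsFormBounded b δ gδ
  continuous_source : Continuous h
  formBounded_source : IsFormBounded h ν gν
  continuous_density : Continuous f
  heat : IsHeatSolution T M (fun z => ‖h z‖ * f z - inner ℝ (b z) (du z)) u du

/-- A compactly supported weight `η` with gradient `η'`, dominated by `ϱ` and satisfying
`|∇η| ≤ L η + e ϱ`. No compactly supported weight satisfies this with `e = 0`, but `e` can be made
as small as desired while `L` stays bounded. -/
structure IsCutoffWeight (L e : ℝ) (ϱ η : Space d → ℝ) (η' : Space d → Space d) : Prop where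
  isC1Test : IsC1Test η η'
  nonneg : ∀ x, 0 ≤ η x
  le : ∀ x, η x ≤ ϱ x
  norm_grad_le : ∀ x, ‖η' x‖ ≤ L * η x + e * ϱ x

/-- The gradient of `|u|^{q/2-1} u η`, as a function of the values `U = u`, `D = ∇u`, `η`, and
`η' = ∇η`. -/
noncomputable def powGrad (q U : ℝ) (D : Space d) (η : ℝ) (η' : Space d) : Space d :=
  (|U| ^ (q / 2 - 1) * U) • η' + η • (((q / 2 - 1 + 1) * |U| ^ (q / 2 - 1)) • D)

lemma cutPow_eq (p r : ℝ) : cutPow p r = (min r 1) ^ p := by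
  unfold cutPow
  split_ifs with h
  · rw [min_eq_right h, Real.one_rpow]
  · rw [min_eq_left (not_le.1 h).le]

lemma cutPow_nonneg {p r : ℝ} (hr : 0 ≤ r) : 0 ≤ cutPow p r := by
  rw [cutPow_eq]; positivity

lemma continuous_cutPow_norm {X : Type*} [TopologicalSpace X] {h : X → Space d}
    (hh : Continuous h) {p : ℝ} (hp : 0 ≤ p) : Continuous fun z => cutPow p ‖h z‖ := by
  simp only [cutPow_eq]
  exact (hh.norm.min continuous_const).rpow_const fun _ => Or.inr hp

lemma IsCutoffWeight.powGrad_eq_zero {L e : ℝ} {ϱ η : Space d → ℝ} {η' : Space d → Space d}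
    (hη : IsCutoffWeight L e ϱ η η') (q U : ℝ) (D : Space d) {x : Space d} (hx : x ∉ tsupport η) :
    powGrad q U D (η x) (η' x) = 0 := by
  simp [powGrad, image_eq_zero_of_notMem_tsupport hx, hη.isC1Test.grad_eq_zero hx]

lemma abs_rpow_mul_self_sq {q : ℝ} (hq : 2 ≤ q) (U y : ℝ) :
    (|U| ^ (q / 2 - 1) * U * y) ^ 2 = |U| ^ q * y ^ 2 := by
  rw [← abs_rpow_sub_two_mul_sq hq U, ← abs_rpow_half_sq U (q - 2)]
  have : (q - 2) / 2 = q / 2 - 1 := by ring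
  rw [this]; ring

/-- The integrand of the energy inequality for `Φ(s) = |s|^q` is estimated pointwise by quadratic
expressions in `|u|^{q/2-1} u η` and its gradient. -/
lemma energy_integrand_le {p q ε s U η a f : ℝ} {b D η' : Space d} (hp : 2 ≤ p) (hq : p ≤ q)
    (hε : 0 < ε) (hs : 0 < s) (ha : 0 ≤ a) :
    (a * f - inner ℝ b D) * (q * (|U| ^ (q - 2) * U) * (η * η)) -
      inner ℝ D ((q * (|U| ^ (q - 2) * U)) • (η • η' + η • η') +
        (η * η * (q * ((q - 2 + 1) * |U| ^ (q - 2)))) • D) ≤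
    -(4 * (q - 1) / q - ε - s) * ‖powGrad q U D η η'‖ ^ 2 +
      (1 / s + ε) * (‖b‖ ^ 2 * ((|U| ^ (q / 2 - 1) * U) * η) ^ 2) +
      (2 + 5 / ε) * ‖(|U| ^ (q / 2 - 1) * U) • η'‖ ^ 2 +
      ε * (a ^ 2 * ((|U| ^ (q / 2 - 1) * U) * η) ^ 2) +
      ε * ((|U| ^ (q / 2 - 1) * U) * η) ^ 2 +
      q ^ p * ε ^ (1 - p) * (cutPow p a * |f| ^ p * |U| ^ (q - p) * η ^ 2) := by
  have hq0 : 0 < q := by linarith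
  have hm : |U| ^ (q - 2) = |U| ^ (q / 2 - 1) * |U| ^ (q / 2 - 1) := by
    rw [← Real.rpow_add_of_nonneg (abs_nonneg _) (by linarith) (by linarith)]
    congr 1; ring
  have hUq := abs_rpow_sub_two_mul_sq (hp.trans hq) U
  set N : Space d := (|U| ^ (q / 2 - 1) * U) • η' with hN
  set P : Space d := powGrad q U D η η' with hP
  set m := |U| ^ (q / 2 - 1) with hmdef
  -- `P - N = η ∇w` for `w = |U|^{q/2-1} U`
  have hA : P - N = (η * ((q / 2) * m)) • D := by
    rw [hP, powGrad, hN, add_sub_cancel_left, smul_smul]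
    congr 2; ring
  have hquad := quadratic_form_le (b := b) (P := P) (N := N) (ζ := m * U * η)
    (k := 4 * (q - 1) / q) (by rw [le_div_iff₀ hq0]; linarith)
    (by rw [div_le_iff₀ hq0]; linarith) hs hε
  rw [hA, norm_smul, mul_pow, hN] at hquad
  simp only [inner_smul_left, inner_smul_right, Real.norm_eq_abs, sq_abs,
    RCLike.conj_to_real] at hquad
  rw [← hN] at hquad
  have hsource : a * f * (q * (|U| ^ (q - 2) * U) * (η * η)) ≤
      ε * (a ^ 2 * ((m * U) * η) ^ 2) + ε * ((m * U) * η) ^ 2 +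
      q ^ p * ε ^ (1 - p) * (cutPow p a * |f| ^ p * |U| ^ (q - p) * η ^ 2) := by
    have h1 := mul_rpow_le_cutPow (p := p) (q := q) (ε := ε) (a := a) (F := |f|) (s := |U|) hp hq0
      hε ha (abs_nonneg _) (abs_nonneg _)
    have h2 := mul_le_mul_of_nonneg_right h1
      (by positivity : 0 ≤ |U| ^ (q - p) * η ^ 2)
    have e1 : |U| ^ p * |U| ^ (q - p) = |U| ^ q := by
      rw [← Real.rpow_add_of_nonneg (abs_nonneg _) (by linarith) (by linarith)]
      congr 1; ring
    have e2 : |U| ^ (p - 1) * |U| ^ (q - p) = |U| ^ (q - 2) * |U| := by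
      have : |U| ^ (q - 2) * |U| = |U| ^ (q - 2) * |U| ^ (1 : ℝ) := by rw [Real.rpow_one]
      rw [this, ← Real.rpow_add_of_nonneg (abs_nonneg _) (by linarith) (by linarith),
        ← Real.rpow_add_of_nonneg (abs_nonneg _) (by linarith) (by linarith)]
      congr 1; ring
    have e3 : ((m * U) * η) ^ 2 = |U| ^ q * η ^ 2 := by
      rw [← hUq, hm]; ring
    have h3 : a * f * (q * (|U| ^ (q - 2) * U) * (η * η)) ≤
        q * a * |f| * (|U| ^ (q - 2) * |U|) * η ^ 2 := by
      have h4 : f * U ≤ |f| * |U| := (le_abs_self _).trans (abs_mul _ _).le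
      have h5 := mul_le_mul_of_nonneg_left h4
        (by positivity : 0 ≤ a * q * |U| ^ (q - 2) * η ^ 2)
      linarith
    refine h3.trans ?_
    rw [e3, ← e1, ← e2]
    linarith
  have e4 : (a * f - inner ℝ b D) * (q * (|U| ^ (q - 2) * U) * (η * η)) -
      inner ℝ D ((q * (|U| ^ (q - 2) * U)) • (η • η' + η • η') +
        (η * η * (q * ((q - 2 + 1) * |U| ^ (q - 2)))) • D) =
      a * f * (q * (|U| ^ (q - 2) * U) * (η * η)) +
      (-(2 * (η * (q / 2 * m) * inner ℝ b D * (m * U * η))) -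
        4 * (m * U * (η * (q / 2 * m) * inner ℝ D η')) -
        4 * (q - 1) / q * ((η * (q / 2 * m)) ^ 2 * ‖D‖ ^ 2)) := by
    rw [hm]
    simp only [inner_add_right, inner_smul_right, real_inner_self_eq_norm_sq]
    field_simp
    ring
  rw [e4]
  linarith

namespace IsDriftSolution

variable {T M δ ν : ℝ} {b h : ℝ × Space d → Space d} {gδ gν : ℝ → ℝ}
    {f u : ℝ × Space d → ℝ} {du : ℝ × Space d → Space d}
    {L e : ℝ} {ϱ η : Space d → ℝ} {η' : Space d → Space d} {p q ε s : ℝ}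

lemma isC1Test_pow (hu : IsDriftSolution T M δ ν b h gδ gν f u du)
    (hη : IsCutoffWeight L e ϱ η η') (hq : 2 ≤ q) (t : ℝ) :
    IsC1Test (fun x => |u (t, x)| ^ (q / 2 - 1) * u (t, x) * η x)
      (fun x => powGrad q (u (t, x)) (du (t, x)) (η x) (η' x)) := by
  have c1 := hu.heat.continuous
  have c2 := hu.heat.continuous_grad
  have c3 : Continuous fun x => |u (t, x)| ^ (q / 2 - 1) :=
    (continuous_abs_rpow (by linarith)).comp (by fun_prop : Continuous fun x => u (t, x))
  exact hη.isC1Test.mul_left (fun x => HasDerivAt.comp_hasGradientAt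
    (hasDerivAt_abs_rpow_mul_self (by linarith) _) (hu.heat.hasGradientAt t x)) (by fun_prop)

lemma continuous_powGrad (hu : IsDriftSolution T M δ ν b h gδ gν f u du)
    (hη : IsCutoffWeight L e ϱ η η') (hq : 2 ≤ q) :
    Continuous fun z : ℝ × Space d => powGrad q (u z) (du z) (η z.2) (η' z.2) := by
  have c1 := hu.heat.continuous
  have c2 := hu.heat.continuous_grad
  have c3 : Continuous fun z => |u z| ^ (q / 2 - 1) :=
    (continuous_abs_rpow (by linarith)).comp c1
  have c4 := hη.isC1Test.continuous
  have c5 := hη.isC1Test.continuous_grad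
  unfold powGrad
  fun_prop

/-- At a time at which the form bounds of `b` and `h` hold, the gradient term absorbs the drift as
soon as `σ > 0`. -/
lemma dissipation_le (hu : IsDriftSolution T M δ ν b h gδ gν f u du)
    (hη : IsCutoffWeight L e ϱ η η') (hϱ : Integrable fun x => ϱ x ^ 2)
    (hp : 2 ≤ p) (hq : p ≤ q) (hε : 0 < ε) (hs : 0 < s) (hsδ : s * s = δ) {σ : ℝ}
    (hσ : σ ≤ 4 * (q - 1) / q - 2 * s - ε * (1 + δ + ν)) {t : ℝ}
    (htb : ∀ (ψ : Space d → ℝ) (ψ' : Space d → Space d), IsC1Test ψ ψ' →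
      ∫ x, ‖b (t, x)‖ ^ 2 * ψ x ^ 2 ≤ δ * (∫ x, ‖ψ' x‖ ^ 2) + gδ t * ∫ x, ψ x ^ 2)
    (hth : ∀ (ψ : Space d → ℝ) (ψ' : Space d → Space d), IsC1Test ψ ψ' →
      ∫ x, ‖h (t, x)‖ ^ 2 * ψ x ^ 2 ≤ ν * (∫ x, ‖ψ' x‖ ^ 2) + gν t * ∫ x, ψ x ^ 2) :
    ∫ x, ((‖h (t, x)‖ * f (t, x) - inner ℝ (b (t, x)) (du (t, x))) *
        (q * (|u (t, x)| ^ (q - 2) * u (t, x)) * (η x * η x)) -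
      inner ℝ (du (t, x)) ((q * (|u (t, x)| ^ (q - 2) * u (t, x))) •
          (η x • η' x + η x • η' x) +
        (η x * η x * (q * ((q - 2 + 1) * |u (t, x)| ^ (q - 2)))) • du (t, x))) ≤
    -σ * (∫ x, ‖powGrad q (u (t, x)) (du (t, x)) (η x) (η' x)‖ ^ 2) +
      ((1 / s + ε) * gδ t + ε * gν t + (ε + (2 + 5 / ε) * (2 * L ^ 2))) *
        (∫ x, |u (t, x)| ^ q * η x ^ 2) +
      q ^ p * ε ^ (1 - p) *
        (∫ x, cutPow p ‖h (t, x)‖ * |f (t, x)| ^ p * |u (t, x)| ^ (q - p) * η x ^ 2) +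
      (2 + 5 / ε) * (2 * e ^ 2 * M ^ q * ∫ x, ϱ x ^ 2) := by
  have hq2 : 2 ≤ q := hp.trans hq
  have hq0 : 0 < q := by linarith
  have c1 := hu.heat.continuous
  have c2 := hu.heat.continuous_grad
  have c3 : ∀ a : ℝ, 0 ≤ a → Continuous fun x => |u (t, x)| ^ a := fun a ha =>
    (continuous_abs_rpow ha).comp (by fun_prop : Continuous fun x => u (t, x))
  have c3a := c3 (q - 2) (by linarith)
  have c3b := c3 (q / 2 - 1) (by linarith)
  have c3c := c3 q (by linarith)
  have c3d := c3 (q - p) (by linarith)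
  have c4 := hη.isC1Test.continuous
  have c5 := hη.isC1Test.continuous_grad
  have c6 := hu.continuous_drift
  have c7 := hu.continuous_source
  have c8 := hu.continuous_density
  have c9 : Continuous fun x => |f (t, x)| ^ p :=
    (continuous_abs_rpow (by linarith)).comp (by fun_prop : Continuous fun x => f (t, x))
  have c10 : Continuous fun x => cutPow p ‖h (t, x)‖ :=
    continuous_cutPow_norm (by fun_prop) (by linarith)
  have htest := hu.isC1Test_pow hη hq2 t
  have c11 := htest.continuous_grad
  have hK := hη.isC1Test.hasCompactSupport
  have z1 : ∀ x, x ∉ tsupport η → η x = 0 := fun x hx => image_eq_zero_of_notMem_tsupport hx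
  have z2 : ∀ x, x ∉ tsupport η → η' x = 0 := fun x hx => hη.isC1Test.grad_eq_zero hx
  have z3 : ∀ x, x ∉ tsupport η → powGrad q (u (t, x)) (du (t, x)) (η x) (η' x) = 0 :=
    fun x hx => hη.powGrad_eq_zero q _ _ hx
  set ζ : Space d → ℝ := fun x => |u (t, x)| ^ (q / 2 - 1) * u (t, x) * η x with hζ
  set P : Space d → Space d := fun x => powGrad q (u (t, x)) (du (t, x)) (η x) (η' x) with hP
  have hζc : Continuous ζ := htest.continuous
  have i1 : Integrable fun x => ‖P x‖ ^ 2 :=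
    integrable_of_compact (by fun_prop) hK fun x hx => by simp [hP, z3 x hx]
  have i2 : Integrable fun x => ‖b (t, x)‖ ^ 2 * ζ x ^ 2 :=
    integrable_of_compact (by fun_prop) hK fun x hx => by simp [hζ, z1 x hx]
  have i3 : Integrable fun x => ‖(|u (t, x)| ^ (q / 2 - 1) * u (t, x)) • η' x‖ ^ 2 :=
    integrable_of_compact (by fun_prop) hK fun x hx => by simp [z2 x hx]
  have i4 : Integrable fun x => ‖h (t, x)‖ ^ 2 * ζ x ^ 2 :=
    integrable_of_compact (by fun_prop) hK fun x hx => by simp [hζ, z1 x hx]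
  have i5 : Integrable fun x => ζ x ^ 2 :=
    integrable_of_compact (by fun_prop) hK fun x hx => by simp [hζ, z1 x hx]
  have i6 : Integrable fun x =>
      cutPow p ‖h (t, x)‖ * |f (t, x)| ^ p * |u (t, x)| ^ (q - p) * η x ^ 2 :=
    integrable_of_compact (by fun_prop) hK fun x hx => by simp [z1 x hx]
  have i0 : Integrable fun x => (‖h (t, x)‖ * f (t, x) - inner ℝ (b (t, x)) (du (t, x))) *
        (q * (|u (t, x)| ^ (q - 2) * u (t, x)) * (η x * η x)) -
      inner ℝ (du (t, x)) ((q * (|u (t, x)| ^ (q - 2) * u (t, x))) •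
          (η x • η' x + η x • η' x) +
        (η x * η x * (q * ((q - 2 + 1) * |u (t, x)| ^ (q - 2)))) • du (t, x)) :=
    integrable_of_compact (by fun_prop) hK fun x hx => by simp [z1 x hx]
  have hmono := integral_mono i0
    ((((((i1.const_mul (-(4 * (q - 1) / q - ε - s))).add (i2.const_mul (1 / s + ε))).add
      (i3.const_mul (2 + 5 / ε))).add (i4.const_mul ε)).add (i5.const_mul ε)).add
      (i6.const_mul (q ^ p * ε ^ (1 - p)))) fun x =>
      energy_integrand_le (p := p) (q := q) (ε := ε) (s := s) (U := u (t, x)) (η := η x)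
        (a := ‖h (t, x)‖) (f := f (t, x)) (b := b (t, x)) (D := du (t, x)) (η' := η' x)
        hp hq hε hs (norm_nonneg _)
  simp only [Pi.add_apply] at hmono
  rw [integral_add (by fun_prop) (by fun_prop), integral_add (by fun_prop) (by fun_prop),
    integral_add (by fun_prop) (by fun_prop), integral_add (by fun_prop) (by fun_prop),
    integral_add (by fun_prop) (by fun_prop)] at hmono
  simp only [integral_const_mul] at hmono
  have fb := htb ζ P htest
  have fh := hth ζ P htest
  have eζ : ∫ x, ζ x ^ 2 = ∫ x, |u (t, x)| ^ q * η x ^ 2 := by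
    congr 1 with x; exact abs_rpow_mul_self_sq hq2 _ _
  have hM0 : 0 ≤ M := (abs_nonneg _).trans (hu.heat.abs_le (0, 0))
  -- the gradient of the weight: its part `L η` enters the Gronwall coefficient, its part `e ϱ` the error
  have hN : ∫ x, ‖(|u (t, x)| ^ (q / 2 - 1) * u (t, x)) • η' x‖ ^ 2 ≤
      2 * L ^ 2 * (∫ x, ζ x ^ 2) + 2 * e ^ 2 * M ^ q * ∫ x, ϱ x ^ 2 := by
    rw [← integral_const_mul, ← integral_const_mul,
      ← integral_add (i5.const_mul _) (hϱ.const_mul _)]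
    refine integral_mono i3 ((i5.const_mul _).add (hϱ.const_mul _)) fun x => ?_
    simp only
    rw [hζ, abs_rpow_mul_self_sq hq2, norm_smul, Real.norm_eq_abs, mul_pow, sq_abs]
    have e1 : (|u (t, x)| ^ (q / 2 - 1) * u (t, x)) ^ 2 = |u (t, x)| ^ q := by
      simpa using abs_rpow_mul_self_sq hq2 (u (t, x)) 1
    rw [e1]
    have h1 : ‖η' x‖ ^ 2 ≤ 2 * (L * η x) ^ 2 + 2 * (e * ϱ x) ^ 2 := by
      have h2 := pow_le_pow_left₀ (norm_nonneg _) (hη.norm_grad_le x) 2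
      nlinarith [sq_nonneg (L * η x - e * ϱ x)]
    have h3 : |u (t, x)| ^ q ≤ M ^ q :=
      Real.rpow_le_rpow (abs_nonneg _) (hu.heat.abs_le _) hq0.le
    have h4 : 0 ≤ |u (t, x)| ^ q := by positivity
    have h5 := mul_le_mul_of_nonneg_left h1 h4
    have h6 := mul_le_mul_of_nonneg_right h3 (by positivity : 0 ≤ 2 * (e * ϱ x) ^ 2)
    nlinarith
  have hE0 : 0 ≤ ∫ x, ζ x ^ 2 := integral_nonneg fun x => sq_nonneg _
  have hP0 : 0 ≤ ∫ x, ‖P x‖ ^ 2 := integral_nonneg fun x => by positivity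
  rw [← eζ]
  refine hmono.trans ?_
  have j1 := mul_le_mul_of_nonneg_left fb (by positivity : 0 ≤ 1 / s + ε)
  have j2 := mul_le_mul_of_nonneg_left fh hε.le
  have j3 := mul_le_mul_of_nonneg_left hN (by positivity : 0 ≤ 2 + 5 / ε)
  have j4 : (-(4 * (q - 1) / q - ε - s) + (1 / s + ε) * δ + ε * ν) * (∫ x, ‖P x‖ ^ 2) ≤
      -σ * ∫ x, ‖P x‖ ^ 2 := by
    refine mul_le_mul_of_nonneg_right ?_ hP0
    have : 1 / s * δ = s := by rw [← hsδ]; field_simp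
    nlinarith
  linarith

/-- The energy estimate: the constant depends on the data only through the integral of the
coefficient in Gronwall's inequality. -/
lemma energy_estimate (hu : IsDriftSolution T M δ ν b h gδ gν f u du)
    (hη : IsCutoffWeight L e ϱ η η') (hϱ : Integrable fun x => ϱ x ^ 2)
    (hT : 0 ≤ T) (hp : 2 ≤ p) (hq : p ≤ q) (hε : 0 < ε) (hs : 0 < s) (hsδ : s * s = δ) {σ : ℝ}
    (hσ0 : 0 ≤ σ) (hσ : σ ≤ 4 * (q - 1) / q - 2 * s - ε * (1 + δ + ν)) {n : ℕ}
    (hn : (1 / s + ε) * (∫ t in (0 : ℝ)..T, gδ t) + ε * (∫ t in (0 : ℝ)..T, gν t) +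
      (ε + (2 + 5 / ε) * (2 * L ^ 2)) * T ≤ n / 2) {B : ℝ}
    (hB : B = ∫ t in (0 : ℝ)..T, (q ^ p * ε ^ (1 - p) *
        (∫ x, cutPow p ‖h (t, x)‖ * |f (t, x)| ^ p * |u (t, x)| ^ (q - p) * η x ^ 2) +
      (2 + 5 / ε) * (2 * e ^ 2 * M ^ q * ∫ x, ϱ x ^ 2))) :
    (∀ t ∈ Icc 0 T, ∫ x, |u (t, x)| ^ q * η x ^ 2 ≤ 2 ^ n * B) ∧
      σ * (∫ t in (0 : ℝ)..T, ∫ x, ‖powGrad q (u (t, x)) (du (t, x)) (η x) (η' x)‖ ^ 2) ≤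
        2 ^ n * B := by
  have hq2 : 2 ≤ q := hp.trans hq
  have hq0 : 0 < q := by linarith
  have c1 := hu.heat.continuous
  have c2 := hu.heat.continuous_grad
  have c3 : ∀ a : ℝ, 0 ≤ a → Continuous fun z => |u z| ^ a := fun a ha =>
    (continuous_abs_rpow ha).comp c1
  have c3a := c3 (q - 2) (by linarith)
  have c3c := c3 q (by linarith)
  have c3d := c3 (q - p) (by linarith)
  have c4 := hη.isC1Test.continuous
  have c5 := hη.isC1Test.continuous_grad
  have c6 := hu.continuous_drift
  have c7 := hu.continuous_source
  have c8 := hu.continuous_density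
  have c9 : Continuous fun z => |f z| ^ p :=
    (continuous_abs_rpow (by linarith)).comp c8
  have c10 : Continuous fun z => cutPow p ‖h z‖ := continuous_cutPow_norm c7 (by linarith)
  have c11 := hu.continuous_powGrad hη hq2
  have hK := hη.isC1Test.hasCompactSupport
  have z1 : ∀ x, x ∉ tsupport η → η x = 0 := fun x hx => image_eq_zero_of_notMem_tsupport hx
  have z3 : ∀ t x, x ∉ tsupport η → powGrad q (u (t, x)) (du (t, x)) (η x) (η' x) = 0 :=
    fun t x hx => hη.powGrad_eq_zero q _ _ hx
  set E : ℝ → ℝ := fun t => ∫ x, |u (t, x)| ^ q * η x ^ 2 with hE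
  set D : ℝ → ℝ := fun t => ∫ x, ‖powGrad q (u (t, x)) (du (t, x)) (η x) (η' x)‖ ^ 2 with hD
  set S : ℝ → ℝ := fun t =>
    ∫ x, cutPow p ‖h (t, x)‖ * |f (t, x)| ^ p * |u (t, x)| ^ (q - p) * η x ^ 2 with hS
  set err : ℝ := (2 + 5 / ε) * (2 * e ^ 2 * M ^ q * ∫ x, ϱ x ^ 2) with herr
  set Γ : ℝ := q ^ p * ε ^ (1 - p) with hΓ
  set c₀ : ℝ := ε + (2 + 5 / ε) * (2 * L ^ 2) with hc₀
  set a : ℝ → ℝ := fun t => (1 / s + ε) * gδ t + ε * gν t + c₀ with ha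
  have hEc : Continuous E := by
    refine continuous_integral_of_compact (F := fun t x => |u (t, x)| ^ q * η x ^ 2) ?_ hK ?_
    · simp only [Function.uncurry_def]; fun_prop
    · intro t x hx; simp [z1 x hx]
  have hDc : Continuous D := by
    refine continuous_integral_of_compact
      (F := fun t x => ‖powGrad q (u (t, x)) (du (t, x)) (η x) (η' x)‖ ^ 2) ?_ hK ?_
    · simp only [Function.uncurry_def]; fun_prop
    · intro t x hx; rw [z3 t x hx]; simp
  have hSc : Continuous S := by
    refine continuous_integral_of_compact (F := fun t x =>
      cutPow p ‖h (t, x)‖ * |f (t, x)| ^ p * |u (t, x)| ^ (q - p) * η x ^ 2) ?_ hK ?_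
    · simp only [Function.uncurry_def]; fun_prop
    · intro t x hx; simp [z1 x hx]
  have hE0 : ∀ t, 0 ≤ E t := fun t => integral_nonneg fun x => by positivity
  have hD0 : ∀ t, 0 ≤ D t := fun t => integral_nonneg fun x => by positivity
  have hS0 : ∀ t, 0 ≤ S t := fun t => integral_nonneg fun x => by
    have := cutPow_nonneg (p := p) (norm_nonneg (h (t, x)))
    positivity
  have hM0 : 0 ≤ M := (abs_nonneg _).trans (hu.heat.abs_le (0, 0))
  have herr0 : 0 ≤ err := by
    have : 0 ≤ ∫ x, ϱ x ^ 2 := integral_nonneg fun x => sq_nonneg _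
    positivity
  have hΓ0 : 0 ≤ Γ := by positivity
  have hc₀0 : 0 ≤ c₀ := by positivity
  have hgδ : ∀ t ∈ Icc 0 T, IntervalIntegrable gδ volume 0 t := fun t ht =>
    hu.formBounded_drift.intervalIntegrable le_rfl ht.1
  have hgν : ∀ t ∈ Icc 0 T, IntervalIntegrable gν volume 0 t := fun t ht =>
    hu.formBounded_source.intervalIntegrable le_rfl ht.1
  have hai : ∀ t ∈ Icc 0 T, IntervalIntegrable a volume 0 t := fun t ht =>
    (((hgδ t ht).const_mul _).add ((hgν t ht).const_mul _)).add intervalIntegrable_const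
  have ha0 : ∀ t ∈ Icc 0 T, 0 ≤ a t := fun t ht => by
    have h1 := hu.formBounded_drift.g_nonneg t ht.1
    have h2 := hu.formBounded_source.g_nonneg t ht.1
    positivity
  have main : ∀ t ∈ Icc 0 T, E t + σ * (∫ r in (0 : ℝ)..t, D r) ≤
      B + ∫ r in (0 : ℝ)..t, a r * E r := by
    intro t ht
    have hkk : IsC1Test (fun x => η x * η x) (fun x => η x • η' x + η x • η' x) :=
      hη.isC1Test.mul_left hη.isC1Test.hasGradientAt c5
    have en := hu.heat.energy_le hkk (fun x => mul_self_nonneg _) (Φ := fun s => |s| ^ q)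
      (Φ₁ := fun s => q * (|s| ^ (q - 2) * s))
      (Φ₂ := fun s => q * ((q - 2 + 1) * |s| ^ (q - 2))) (continuous_abs_rpow hq0.le)
      (fun s => (hasDerivAt_abs_rpow_mul_self (by linarith) s).const_mul q)
      (by have := continuous_abs_rpow (a := q - 2) (by linarith); fun_prop)
      (fun a b => abs_rpow_sub_le hq2 a b) ht
    have e0 : ∫ x, |u (0, x)| ^ q * (η x * η x) = 0 := by
      simp [hu.heat.initial, Real.zero_rpow hq0.ne']
    have e1 : ∫ x, |u (t, x)| ^ q * (η x * η x) = E t := by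
      simp only [hE, sq]
    rw [e0, e1, sub_zero] at en
    have hEa : IntervalIntegrable (fun r => a r * E r) volume 0 t :=
      (hai t ht).mul_continuousOn hEc.continuousOn
    have hDi : IntervalIntegrable (fun r => -σ * D r) volume 0 t :=
      (hDc.intervalIntegrable _ _).const_mul _
    have hSi : ∀ y z, IntervalIntegrable (fun r => Γ * S r + err) volume y z := fun y z =>
      Continuous.intervalIntegrable (by fun_prop) _ _
    have hle : ∫ r in (0 : ℝ)..t, (∫ x, ((‖h (r, x)‖ * f (r, x) -
        inner ℝ (b (r, x)) (du (r, x))) *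
        (q * (|u (r, x)| ^ (q - 2) * u (r, x)) * (η x * η x)) -
        inner ℝ (du (r, x)) ((q * (|u (r, x)| ^ (q - 2) * u (r, x))) •
          (η x • η' x + η x • η' x) +
        (η x * η x * (q * ((q - 2 + 1) * |u (r, x)| ^ (q - 2)))) • du (r, x)))) ≤
        ∫ r in (0 : ℝ)..t, (-σ * D r + a r * E r + (Γ * S r + err)) := by
      refine intervalIntegral.integral_mono_ae_restrict ht.1 ?_ ((hDi.add hEa).add (hSi 0 t)) ?_
      · refine Continuous.intervalIntegrable (continuous_integral_of_compact
          (F := fun r x => ((‖h (r, x)‖ * f (r, x) -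
        inner ℝ (b (r, x)) (du (r, x))) *
        (q * (|u (r, x)| ^ (q - 2) * u (r, x)) * (η x * η x)) -
        inner ℝ (du (r, x)) ((q * (|u (r, x)| ^ (q - 2) * u (r, x))) •
          (η x • η' x + η x • η' x) +
        (η x * η x * (q * ((q - 2 + 1) * |u (r, x)| ^ (q - 2)))) • du (r, x)))) ?_ hK ?_) _ _
        · simp only [Function.uncurry_def]; fun_prop
        · intro r x hx; simp [z1 x hx]
      · have hne : ∀ᵐ r : ℝ, r ≠ 0 := by simp [ae_iff]
        refine (ae_restrict_iff' measurableSet_Icc).2 ?_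
        filter_upwards [hu.formBounded_drift.ae_form_bound c6,
          hu.formBounded_source.ae_form_bound c7, hne] with r h1 h2 h3 hr
        have hr0 : 0 < r := lt_of_le_of_ne hr.1 (Ne.symm h3)
        have := hu.dissipation_le hη hϱ hp hq hε hs hsδ hσ (h1 hr0) (h2 hr0)
        simp only [hD, hE, hS, ha]
        linarith
    rw [intervalIntegral.integral_add (hDi.add hEa) (hSi 0 t),
      intervalIntegral.integral_add hDi hEa, intervalIntegral.integral_const_mul] at hle
    have hBt : ∫ r in (0 : ℝ)..t, (Γ * S r + err) ≤ B := by
      rw [hB, ← intervalIntegral.integral_add_adjacent_intervals (hSi 0 t) (hSi t T)]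
      have : 0 ≤ ∫ r in t..T, (Γ * S r + err) := intervalIntegral.integral_nonneg ht.2
        fun r _ => add_nonneg (mul_nonneg hΓ0 (hS0 r)) herr0
      linarith
    linarith
  have hTT : T ∈ Icc 0 T := ⟨hT, le_rfl⟩
  have haint : ∀ t ∈ Icc 0 T, ∫ r in (0 : ℝ)..t, a r ≤ n / 2 := by
    intro t ht
    have h1 : ∫ r in (0 : ℝ)..T, a r ≤ n / 2 := by
      refine le_trans (le_of_eq ?_) hn
      simp only [ha]
      rw [intervalIntegral.integral_add
        (((hgδ T hTT).const_mul _).add ((hgν T hTT).const_mul _)) intervalIntegrable_const,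
        intervalIntegral.integral_add ((hgδ T hTT).const_mul _) ((hgν T hTT).const_mul _),
        intervalIntegral.integral_const_mul, intervalIntegral.integral_const_mul,
        intervalIntegral.integral_const]
      simp [mul_comm]
    refine le_trans ?_ h1
    exact intervalIntegral.integral_mono_interval le_rfl ht.1 ht.2
      ((ae_restrict_iff' measurableSet_Ioc).2 (ae_of_all _ fun r hr => ha0 r ⟨hr.1.le, hr.2⟩))
      (hai T hTT)
  have hDint : ∀ t ∈ Icc 0 T, 0 ≤ σ * ∫ r in (0 : ℝ)..t, D r := fun t ht =>
    mul_nonneg hσ0 (intervalIntegral.integral_nonneg ht.1 fun r _ => hD0 r)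
  have gr := gronwall_integrable (B := B) hEc hE0 (hai T hTT) ha0
    (fun t ht => by linarith [main t ht, hDint t ht]) n
  refine ⟨fun t ht => ?_, ?_⟩
  · have h1 := gr t ht (haint t ht)
    linarith [main t ht, hDint t ht]
  · have h1 := gr T hTT (haint T hTT)
    linarith [main T hTT, hE0 T]

end IsDriftSolution

/-! ### Gain of integrability -/

/-- The Gagliardo–Nirenberg inequality for `ψ^2`: with `r = d / (d - 1)`, the function `ψ^2`
belongs to `L^r` with a bound that is linear in `∫ |ψ'|^2`, hence integrable in time. This uses
`r ≤ 2`. -/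
lemma IsC1Test.lintegral_sq_rpow_le {ψ : Space d → ℝ} {ψ' : Space d → Space d}
    (hψ : IsC1Test ψ ψ') {r : ℝ} (hr : Real.HolderConjugate (d : ℝ) r) (hr2 : r ≤ 2) {Y : ℝ}
    (hY : 0 < Y) (hE : ∫ x, ψ x ^ 2 ≤ Y) :
    ∫⁻ x, ENNReal.ofReal ((ψ x ^ 2) ^ r) ≤
      lintegralPowLePowLIntegralFDerivConst (volume : Measure (Space d)) r *
        ENNReal.ofReal (2 ^ r * Y ^ r * (1 + (∫ x, ‖ψ' x‖ ^ 2) / Y)) := by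
  have hr0 : 0 < r := hr.symm.pos
  have hr1 : 1 ≤ r := hr.symm.lt.le
  set D := ∫ x, ‖ψ' x‖ ^ 2 with hD
  have hD0 : 0 ≤ D := integral_nonneg fun x => by positivity
  have hsq : IsC1Test (fun x => ψ x * ψ x) (fun x => ψ x • ψ' x + ψ x • ψ' x) :=
    hψ.mul_left hψ.hasGradientAt hψ.continuous_grad
  have hfin : Real.HolderConjugate (Module.finrank ℝ (Space d) : ℝ) r := by simpa using hr
  have key := lintegral_pow_le_pow_lintegral_fderiv (volume : Measure (Space d)) hsq.contDiff
    hsq.hasCompactSupport hfin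
  have c1 := hψ.continuous
  have c2 := hψ.continuous_grad
  have hK := hψ.hasCompactSupport
  have i1 : Integrable fun x => ψ x ^ 2 :=
    integrable_of_compact (by fun_prop) hK fun x hx => by simp [image_eq_zero_of_notMem_tsupport hx]
  have i2 : Integrable fun x => ‖ψ' x‖ ^ 2 :=
    integrable_of_compact (by fun_prop) hK fun x hx => by simp [hψ.grad_eq_zero hx]
  have e1 : ∀ x, ‖ψ x * ψ x‖ₑ ^ r = ENNReal.ofReal ((ψ x ^ 2) ^ r) := by
    intro x
    rw [← ofReal_norm, ENNReal.ofReal_rpow_of_nonneg (norm_nonneg _) hr0.le,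
      Real.norm_eq_abs, abs_mul_self, sq]
  simp only [e1] at key
  -- Young's inequality with a parameter adapted to the size of the gradient
  set l := Real.sqrt ((D + Y) / Y) with hl
  have hl2 : l ^ 2 = (D + Y) / Y := Real.sq_sqrt (by positivity)
  have hl0 : 0 < l := Real.sqrt_pos.2 (by positivity)
  have hl1 : 1 ≤ l := by
    rw [hl, Real.one_le_sqrt, le_div_iff₀ hY]; linarith
  have e2 : ∫⁻ x, ‖fderiv ℝ (fun x => ψ x * ψ x) x‖ₑ ≤ ENNReal.ofReal (2 * Y * l) := by
    have h1 : ∀ x, ‖fderiv ℝ (fun x => ψ x * ψ x) x‖ₑ ≤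
        ENNReal.ofReal (l * ψ x ^ 2 + (1 / l) * ‖ψ' x‖ ^ 2) := by
      intro x
      rw [← ofReal_norm]
      refine ENNReal.ofReal_le_ofReal ?_
      rw [hsq.fderiv_eq, LinearIsometryEquiv.norm_map]
      refine (norm_add_le _ _).trans ?_
      rw [norm_smul, Real.norm_eq_abs]
      have h2 : l * ψ x ^ 2 + (1 / l) * ‖ψ' x‖ ^ 2 - (|ψ x| * ‖ψ' x‖ + |ψ x| * ‖ψ' x‖) =
          (1 / l) * (l * |ψ x| - ‖ψ' x‖) ^ 2 := by
        rw [← sq_abs (ψ x)]; field_simp; ring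
      have h3 : 0 ≤ (1 / l) * (l * |ψ x| - ‖ψ' x‖) ^ 2 := by positivity
      linarith
    refine (lintegral_mono h1).trans ?_
    have i3 : Integrable fun x => l * ψ x ^ 2 + (1 / l) * ‖ψ' x‖ ^ 2 :=
      (i1.const_mul l).add (i2.const_mul (1 / l))
    rw [← ofReal_integral_eq_lintegral_ofReal i3 (ae_of_all _ fun x => by
      simp only [Pi.zero_apply]; positivity)]
    refine ENNReal.ofReal_le_ofReal ?_
    rw [integral_add (i1.const_mul l) (i2.const_mul _), integral_const_mul, integral_const_mul]
    have h4 : (1 / l) * D ≤ Y * l := by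
      rw [one_div, inv_mul_le_iff₀ hl0]
      have : l * (Y * l) = Y * l ^ 2 := by ring
      rw [this, hl2, mul_div_cancel₀ _ hY.ne']
      linarith
    have h5 := mul_le_mul_of_nonneg_left hE hl0.le
    linarith
  refine key.trans ?_
  gcongr
  refine (ENNReal.rpow_le_rpow e2 hr0.le).trans ?_
  rw [ENNReal.ofReal_rpow_of_nonneg (by positivity) hr0.le]
  refine ENNReal.ofReal_le_ofReal ?_
  rw [Real.mul_rpow (by positivity) hl0.le, Real.mul_rpow (by positivity) hY.le]
  refine mul_le_mul_of_nonneg_left ?_ (by positivity)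
  calc l ^ r ≤ l ^ (2 : ℝ) := Real.rpow_le_rpow_of_exponent_le hl1 hr2
    _ = 1 + D / Y := by
      rw [Real.rpow_two, hl2]; field_simp; ring

namespace IsDriftSolution

variable {T M δ ν : ℝ} {b h : ℝ × Space d → Space d} {gδ gν : ℝ → ℝ}
    {f u : ℝ × Space d → ℝ} {du : ℝ × Space d → Space d}
    {L e : ℝ} {ϱ η : Space d → ℝ} {η' : Space d → Space d} {q : ℝ}

/-- The parabolic embedding: the energy controls `|u|^{q/2} η` in `L^{2r}` over space-time. -/
lemma lintegral_rpow_le_of_energy (hu : IsDriftSolution T M δ ν b h gδ gν f u du)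
    (hη : IsCutoffWeight L e ϱ η η') (hT : 0 ≤ T) (hq : 2 ≤ q) {r : ℝ}
    (hr : Real.HolderConjugate (d : ℝ) r) (hr2 : r ≤ 2) {Y σ : ℝ} (hY : 0 < Y) (hσ : 0 < σ)
    (hE : ∀ t ∈ Icc 0 T, ∫ x, |u (t, x)| ^ q * η x ^ 2 ≤ Y)
    (hD : σ * (∫ t in (0 : ℝ)..T, ∫ x, ‖powGrad q (u (t, x)) (du (t, x)) (η x) (η' x)‖ ^ 2) ≤ Y) :
    ∫⁻ t in Icc 0 T, ∫⁻ x, ENNReal.ofReal ((|u (t, x)| ^ q * η x ^ 2) ^ r) ≤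
      lintegralPowLePowLIntegralFDerivConst (volume : Measure (Space d)) r *
        ENNReal.ofReal (2 ^ r * Y ^ r * (T + 1 / σ)) := by
  set D : ℝ → ℝ := fun t => ∫ x, ‖powGrad q (u (t, x)) (du (t, x)) (η x) (η' x)‖ ^ 2 with hDdef
  have c11 := hu.continuous_powGrad hη hq
  have hK := hη.isC1Test.hasCompactSupport
  have hDc : Continuous D := by
    refine continuous_integral_of_compact
      (F := fun t x => ‖powGrad q (u (t, x)) (du (t, x)) (η x) (η' x)‖ ^ 2) ?_ hK ?_
    · simp only [Function.uncurry_def]; fun_prop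
    · intro t x hx; rw [hη.powGrad_eq_zero q _ _ hx]; simp
  have hD0 : ∀ t, 0 ≤ D t := fun t => integral_nonneg fun x => by positivity
  have slice : ∀ t ∈ Icc 0 T, ∫⁻ x, ENNReal.ofReal ((|u (t, x)| ^ q * η x ^ 2) ^ r) ≤
      lintegralPowLePowLIntegralFDerivConst (volume : Measure (Space d)) r *
        ENNReal.ofReal (2 ^ r * Y ^ r * (1 + D t / Y)) := by
    intro t ht
    have h1 := (hu.isC1Test_pow hη hq t).lintegral_sq_rpow_le hr hr2 hY (by
      simp only [abs_rpow_mul_self_sq hq]; exact hE t ht)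
    simp only [abs_rpow_mul_self_sq hq] at h1
    exact h1
  refine (setLIntegral_mono' measurableSet_Icc slice).trans ?_
  rw [lintegral_const_mul' _ _ ENNReal.coe_ne_top]
  gcongr
  have hc : Continuous fun t => 2 ^ r * Y ^ r * (1 + D t / Y) := by fun_prop
  rw [← ofReal_integral_eq_lintegral_ofReal hc.continuousOn.integrableOn_Icc
    (ae_of_all _ fun t => by have := hD0 t; positivity)]
  refine ENNReal.ofReal_le_ofReal ?_
  rw [integral_Icc_eq_integral_Ioc, ← intervalIntegral.integral_of_le hT,
    intervalIntegral.integral_const_mul]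
  refine mul_le_mul_of_nonneg_left ?_ (by positivity)
  rw [intervalIntegral.integral_add (by simp)
    ((hDc.div_const Y).intervalIntegrable _ _), intervalIntegral.integral_div]
  simp only [intervalIntegral.integral_const, smul_eq_mul, mul_one, sub_zero]
  refine add_le_add le_rfl ?_
  rw [div_le_div_iff₀ hY hσ]
  linarith

end IsDriftSolution

/-! ### The weight -/

section Rho

variable {κ β : ℝ}

lemma one_le_one_add_mul_norm_sq (hκ : 0 < κ) (x : Space d) : 1 ≤ 1 + κ * ‖x‖ ^ 2 := by
  have : 0 ≤ κ * ‖x‖ ^ 2 := by positivity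
  linarith

lemma rho_pos (hκ : 0 < κ) (x : Space d) : 0 < rho κ β x :=
  Real.rpow_pos_of_pos (by linarith [one_le_one_add_mul_norm_sq hκ x]) _

lemma contDiff_rho (hκ : 0 < κ) : ContDiff ℝ ∞ (rho κ β : Space d → ℝ) := by
  unfold rho
  refine ContDiff.rpow_const_of_ne ?_ fun x => ?_
  · exact contDiff_const.add (contDiff_const.mul (contDiff_norm_sq ℝ))
  · exact (by linarith [one_le_one_add_mul_norm_sq hκ x] : 0 < 1 + κ * ‖x‖ ^ 2).ne'

lemma hasGradientAt_rho (hκ : 0 < κ) (x : Space d) :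
    HasGradientAt (rho κ β : Space d → ℝ)
      ((-β * (1 + κ * ‖x‖ ^ 2) ^ (-β - 1)) • ((2 * κ) • x)) x := by
  have h0 : (1 + κ * ‖x‖ ^ 2) ≠ 0 := by linarith [one_le_one_add_mul_norm_sq hκ x]
  have h1 : HasGradientAt (fun y : Space d => 1 + κ * ‖y‖ ^ 2) ((2 * κ) • x) x := by
    rw [hasGradientAt_iff_hasFDerivAt]
    have := ((hasStrictFDerivAt_norm_sq x).hasFDerivAt.const_mul κ).const_add 1
    refine this.congr_fderiv ?_
    ext v
    simp
    ring
  exact HasDerivAt.comp_hasGradientAt (Φ := fun s => s ^ (-β))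
    (Real.hasDerivAt_rpow_const (Or.inl h0)) h1

lemma norm_gradient_rho_le (hκ : 0 < κ) (hβ : 0 < β) (x : Space d) :
    ‖gradient (rho κ β : Space d → ℝ) x‖ ≤ β * (κ + 1) * rho κ β x := by
  rw [(hasGradientAt_rho hκ x).gradient]
  have h1 := one_le_one_add_mul_norm_sq hκ x
  have h0 : 0 < 1 + κ * ‖x‖ ^ 2 := by linarith
  rw [norm_smul, norm_smul, Real.norm_eq_abs, Real.norm_eq_abs, abs_mul, abs_neg, abs_of_pos hβ,
    abs_of_pos (Real.rpow_pos_of_pos h0 _), abs_of_pos (by positivity), rho]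
  have h2 : (1 + κ * ‖x‖ ^ 2) ^ (-β) = (1 + κ * ‖x‖ ^ 2) ^ (-β - 1) * (1 + κ * ‖x‖ ^ 2) := by
    rw [← Real.rpow_add_one h0.ne']; congr 1; ring
  rw [h2]
  have h3 : 2 * κ * ‖x‖ ≤ (κ + 1) * (1 + κ * ‖x‖ ^ 2) := by
    nlinarith [mul_nonneg hκ.le (sq_nonneg (‖x‖ - 1)), mul_nonneg hκ.le (sq_nonneg (κ * ‖x‖)),
      mul_nonneg (mul_nonneg hκ.le hκ.le) (sq_nonneg ‖x‖)]
  have h4 : 0 ≤ β * (1 + κ * ‖x‖ ^ 2) ^ (-β - 1) := by positivity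
  have := mul_le_mul_of_nonneg_left h3 h4
  linarith

/-- Harnack inequality for the weight. -/
lemma rho_le_mul_rho (hκ : 0 < κ) (hβ : 0 < β) {R : ℝ} {x y : Space d} (hxy : ‖x - y‖ ≤ R) :
    rho κ β x ≤ (2 * (1 + κ * R ^ 2)) ^ β * rho κ β y := by
  have hx := one_le_one_add_mul_norm_sq hκ x
  have hy := one_le_one_add_mul_norm_sq hκ y
  have hR : 0 ≤ R := (norm_nonneg _).trans hxy
  have h1 : ‖y‖ ≤ ‖x‖ + R := by
    have := norm_sub_norm_le y x
    rw [norm_sub_rev] at this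
    linarith
  have h2 : ‖y‖ ^ 2 ≤ 2 * ‖x‖ ^ 2 + 2 * R ^ 2 := by
    have := pow_le_pow_left₀ (norm_nonneg _) h1 2
    nlinarith [sq_nonneg (‖x‖ - R)]
  have h3 : 1 + κ * ‖y‖ ^ 2 ≤ (2 * (1 + κ * R ^ 2)) * (1 + κ * ‖x‖ ^ 2) := by
    have h4 := mul_le_mul_of_nonneg_left h2 hκ.le
    have h5 : 0 ≤ (κ * R ^ 2) * (κ * ‖x‖ ^ 2) := by positivity
    nlinarith
  have h6 := Real.rpow_le_rpow (by linarith) h3 hβ.le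
  rw [Real.mul_rpow (by positivity) (by linarith)] at h6
  have hxp : 0 < (1 + κ * ‖x‖ ^ 2) ^ β := Real.rpow_pos_of_pos (by linarith) _
  have hyp : 0 < (1 + κ * ‖y‖ ^ 2) ^ β := Real.rpow_pos_of_pos (by linarith) _
  rw [rho, rho, Real.rpow_neg (by linarith), Real.rpow_neg (by linarith), ← div_eq_mul_inv,
    le_div_iff₀ hyp, inv_mul_le_iff₀ hxp]
  linarith

lemma integrable_rho_sq (hκ : 0 < κ) (hβ : (d : ℝ) / 4 < β) :
    Integrable fun x : Space d => rho κ β x ^ 2 := by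
  have h1 : Integrable fun x : Space d => (1 + ‖x‖ ^ 2) ^ (-(4 * β) / 2) :=
    integrable_rpow_neg_one_add_norm_sq (by simp; linarith)
  have h2 := h1.comp_smul (R := Real.sqrt κ) (Real.sqrt_pos.2 hκ).ne'
  refine h2.congr (ae_of_all _ fun x => ?_)
  have h0 : 0 ≤ 1 + κ * ‖x‖ ^ 2 := by linarith [one_le_one_add_mul_norm_sq hκ x]
  simp only [norm_smul, mul_pow, Real.norm_eq_abs, sq_abs, Real.sq_sqrt hκ.le]
  rw [rho, ← Real.rpow_natCast ((1 + κ * ‖x‖ ^ 2) ^ (-β)) 2, ← Real.rpow_mul h0]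
  congr 1
  push_cast
  ring

lemma continuous_rho (hκ : 0 < κ) : Continuous (rho κ β : Space d → ℝ) :=
  (contDiff_rho hκ).continuous

/-- Multiplying `ρ` by a cutoff function which varies on a large scale. -/
lemma exists_isCutoffWeight (hκ : 0 < κ) (hβ : 0 < β) {e : ℝ} (he : 0 < e) (y : Space d) :
    ∃ (η : Space d → ℝ) (η' : Space d → Space d),
      IsCutoffWeight (β * (κ + 1)) e (fun x => rho κ β (x - y)) η η' ∧
        ∀ x ∈ Metric.ball y 1, η x = rho κ β (x - y) := by
  let χ : ContDiffBump (0 : Space d) := ⟨1, 2, one_pos, one_lt_two⟩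
  have hχ : IsC1Test χ (gradient χ) :=
    IsC1Test.of_contDiff (n := 1) χ.contDiff le_rfl χ.hasCompactSupport
  have hχ'c : HasCompactSupport (gradient χ) :=
    HasCompactSupport.intro χ.hasCompactSupport fun x hx => hχ.grad_eq_zero hx
  obtain ⟨C, hC⟩ := hχ'c.exists_bound_of_continuous hχ.continuous_grad
  have hC0 : 0 ≤ C := (norm_nonneg _).trans (hC 0)
  set c : ℝ := min 1 (e / (C + 1)) with hc
  have hc0 : 0 < c := by positivity
  have hc1 : c ≤ 1 := min_le_left _ _
  have hce : c * C ≤ e := by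
    have : c ≤ e / (C + 1) := min_le_right _ _
    rw [le_div_iff₀ (by positivity)] at this
    linarith
  have haff : ∀ x, HasFDerivAt (fun x : Space d => c • (x - y))
      (c • ContinuousLinearMap.id ℝ (Space d)) x := fun x =>
    ((hasFDerivAt_id x).sub_const y).const_smul c
  have hχg : ∀ x, HasGradientAt (fun x => χ (c • (x - y)))
      (c • gradient χ (c • (x - y))) x := by
    intro x
    have h1 := hχ.hasGradientAt (c • (x - y))
    rw [hasGradientAt_iff_hasFDerivAt] at *
    refine (h1.comp x (haff x)).congr_fderiv ?_
    ext v
    simp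
  have hχs : HasCompactSupport fun x => χ (c • (x - y)) := by
    refine HasCompactSupport.intro (isCompact_closedBall y (2 / c)) fun x hx => ?_
    refine χ.zero_of_le_dist ?_
    rw [Metric.mem_closedBall, not_le, div_lt_iff₀ hc0, dist_eq_norm] at hx
    change 2 ≤ _
    rw [dist_zero_right, norm_smul, Real.norm_eq_abs, abs_of_pos hc0]
    linarith
  have ht : IsC1Test (fun x => χ (c • (x - y))) (fun x => c • gradient χ (c • (x - y))) :=
    ⟨hχg, by have := hχ.continuous_grad; fun_prop, hχs⟩
  have hρg : ∀ x, HasGradientAt (fun x => rho κ β (x - y)) (gradient (rho κ β) (x - y)) x := by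
    intro x
    have h1 : HasGradientAt (rho κ β : Space d → ℝ) (gradient (rho κ β) (x - y)) (x - y) :=
      ((contDiff_rho hκ).differentiable (by simp) (x - y)).hasGradientAt
    rw [hasGradientAt_iff_hasFDerivAt] at *
    refine (h1.comp x ((hasFDerivAt_id x).sub_const y)).congr_fderiv ?_
    ext v
    simp
  have hρc : Continuous (gradient (rho κ β : Space d → ℝ)) :=
    (InnerProductSpace.toDual ℝ (Space d)).symm.continuous.comp
      ((contDiff_rho hκ).continuous_fderiv (by simp))
  refine ⟨_, _, ⟨ht.mul_left hρg (by fun_prop), fun x => ?_, fun x => ?_, fun x => ?_⟩,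
    fun x hx => ?_⟩
  · exact mul_nonneg (rho_pos hκ _).le χ.nonneg
  · exact mul_le_of_le_one_right (rho_pos hκ _).le χ.le_one
  · have hρ := rho_pos (β := β) hκ (x - y)
    have h1 := norm_gradient_rho_le hκ hβ (x - y)
    have h2 := hC (c • (x - y))
    have h3 : 0 ≤ χ (c • (x - y)) := χ.nonneg
    refine (norm_add_le _ _).trans ?_
    rw [norm_smul, norm_smul, norm_smul, Real.norm_eq_abs, Real.norm_eq_abs, Real.norm_eq_abs,
      abs_of_pos hρ, abs_of_pos hc0, abs_of_nonneg h3]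
    have h4 : c * ‖gradient χ (c • (x - y))‖ ≤ e :=
      (mul_le_mul_of_nonneg_left h2 hc0.le).trans hce
    have h5 := mul_le_mul_of_nonneg_left h1 h3
    have h6 := mul_le_mul_of_nonneg_left h4 hρ.le
    linarith
  · have : χ (c • (x - y)) = 1 := by
      refine χ.one_of_mem_closedBall ?_
      rw [mem_closedBall_zero_iff, norm_smul, Real.norm_eq_abs, abs_of_pos hc0]
      change _ ≤ 1
      rw [Metric.mem_ball, dist_eq_norm] at hx
      exact mul_le_one₀ hc1 (norm_nonneg _) hx.le
    simp [this]

end Rho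

/-! ### Local bounds and averaging over translations -/

/-- Lebesgue measure on `[0, T] × ℝ^d`. -/
noncomputable def slabMeasure (d : ℕ) (T : ℝ) : Measure (ℝ × Space d) :=
  (volume.restrict (Icc 0 T)).prod volume

/-- The measure `ρ_y^2 dx dt` on `[0, T] × ℝ^d`. -/
noncomputable def weightedMeasure (T κ β : ℝ) (y : Space d) : Measure (ℝ × Space d) :=
  (slabMeasure d T).withDensity fun z => ENNReal.ofReal (rho κ β (z.2 - y) ^ 2)

section Measure

variable {T κ β : ℝ}

instance : SFinite (slabMeasure d T) := by unfold slabMeasure; infer_instance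

lemma measurable_weight (hκ : 0 < κ) (y : Space d) :
    Measurable fun z : ℝ × Space d => ENNReal.ofReal (rho κ β (z.2 - y) ^ 2) := by
  have := continuous_rho (d := d) (β := β) hκ
  exact (by fun_prop : Continuous fun z : ℝ × Space d => rho κ β (z.2 - y) ^ 2).measurable.ennreal_ofReal

lemma lintegral_weightedMeasure (hκ : 0 < κ) (y : Space d) {F : ℝ × Space d → ℝ≥0∞}
    (hF : Measurable F) :
    ∫⁻ z, F z ∂weightedMeasure T κ β y =
      ∫⁻ z, F z * ENNReal.ofReal (rho κ β (z.2 - y) ^ 2) ∂slabMeasure d T := by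
  rw [weightedMeasure, lintegral_withDensity_eq_lintegral_mul _ (measurable_weight hκ y) hF]
  simp only [Pi.mul_apply, mul_comm]

lemma weightedMeasure_univ (hκ : 0 < κ) (hβ : (d : ℝ) / 4 < β) (y : Space d) :
    weightedMeasure T κ β y univ =
      ENNReal.ofReal T * ENNReal.ofReal (∫ x : Space d, rho κ β x ^ 2) := by
  rw [weightedMeasure, withDensity_apply _ MeasurableSet.univ, Measure.restrict_univ, slabMeasure,
    lintegral_prod _ (measurable_weight hκ y).aemeasurable]
  have h1 : ∫⁻ x : Space d, ENNReal.ofReal (rho κ β (x - y) ^ 2) =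
      ENNReal.ofReal (∫ x : Space d, rho κ β x ^ 2) := by
    rw [lintegral_sub_right_eq_self (fun x : Space d => ENNReal.ofReal (rho κ β x ^ 2)) y,
      ofReal_integral_eq_lintegral_ofReal (integrable_rho_sq hκ hβ)
        (ae_of_all _ fun x => sq_nonneg _)]
  simp only [h1, lintegral_const, Measure.restrict_apply MeasurableSet.univ, univ_inter,
    Real.volume_Icc, sub_zero]
  rw [mul_comm]

/-- Averaging over translations: integrals against `ρ_z^2` are controlled by the integrals over
unit balls, uniformly in their centres. -/
lemma exists_lintegral_weightedMeasure_le (hκ : 0 < κ) (hβ : (d : ℝ) / 4 < β) :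
    ∃ C : ℝ, 0 ≤ C ∧ ∀ (T : ℝ) (F : ℝ × Space d → ℝ≥0∞), Measurable F → ∀ y₀ : Space d,
      ∫⁻ z, F z ∂weightedMeasure T κ β y₀ ≤ ENNReal.ofReal C *
        ⨆ y : Space d, ∫⁻ z in univ ×ˢ Metric.ball y 1, F z ∂slabMeasure d T := by
  have hβ0 : 0 < β := lt_of_le_of_lt (by positivity) hβ
  set H : ℝ := (2 * (1 + κ * 1 ^ 2)) ^ β with hH
  set m : ℝ := ∫ x : Space d, rho κ β x ^ 2 with hm
  have hm0 : 0 ≤ m := integral_nonneg fun x => sq_nonneg _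
  set v : ℝ≥0∞ := volume (Metric.ball (0 : Space d) 1) with hv
  have hv0 : v ≠ 0 := (Metric.measure_ball_pos volume _ one_pos).ne'
  have hvt : v ≠ ⊤ := measure_ball_lt_top.ne
  have hvr : 0 < v.toReal := ENNReal.toReal_pos hv0 hvt
  refine ⟨v.toReal⁻¹ * (H ^ 2 * m), by positivity, fun T F hF y₀ => ?_⟩
  set A := ⨆ y : Space d, ∫⁻ z in univ ×ˢ Metric.ball y 1, F z ∂slabMeasure d T with hA
  set w : Space d → ℝ≥0∞ := fun x => ENNReal.ofReal (rho κ β (x - y₀) ^ 2) with hw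
  have hwm : Measurable w := by
    have := continuous_rho (d := d) (β := β) hκ
    exact (by fun_prop : Continuous fun x : Space d => rho κ β (x - y₀) ^ 2).measurable.ennreal_ofReal
  let U : Set ((ℝ × Space d) × Space d) := {p | dist p.1.2 p.2 < 1}
  have hU : MeasurableSet U :=
    (isOpen_lt (by fun_prop) continuous_const).measurableSet
  -- write `v` as the integral over `y` of the indicator of `|x - y| < 1` and exchange integrals
  have key : v * ∫⁻ z, F z * w z.2 ∂slabMeasure d T ≤ ENNReal.ofReal (H ^ 2 * m) * A := by
    calc v * ∫⁻ z, F z * w z.2 ∂slabMeasure d T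
        = ∫⁻ z, (∫⁻ y : Space d, U.indicator (fun p => F p.1 * w p.1.2) (z, y))
            ∂slabMeasure d T := by
          rw [← lintegral_const_mul' _ _ hvt]
          refine lintegral_congr fun z => ?_
          have h1 : ∀ y : Space d, U.indicator (fun p => F p.1 * w p.1.2) (z, y) =
              (Metric.ball z.2 1).indicator (fun _ => F z * w z.2) y := by
            intro y
            simp only [indicator, U, mem_ofPred_eq, Metric.mem_ball, dist_comm]
          simp only [h1]
          rw [lintegral_indicator Metric.isOpen_ball.measurableSet, setLIntegral_const,
            Measure.addHaar_ball_center, mul_comm]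
      _ = ∫⁻ y : Space d, (∫⁻ z, U.indicator (fun p => F p.1 * w p.1.2) (z, y)
            ∂slabMeasure d T) := by
          refine lintegral_lintegral_swap (Measurable.aemeasurable ?_)
          exact Measurable.indicator (by fun_prop) hU
      _ ≤ ∫⁻ y : Space d, ENNReal.ofReal (H ^ 2) * w y * A := by
          refine lintegral_mono fun y => ?_
          have h2 : ∀ z : ℝ × Space d, U.indicator (fun p => F p.1 * w p.1.2) (z, y) ≤
              (univ ×ˢ Metric.ball y 1).indicator
                (fun z => ENNReal.ofReal (H ^ 2) * w y * F z) z := by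
            intro z
            by_cases hz : dist z.2 y < 1
            · rw [indicator_of_mem (show (z, y) ∈ U from hz),
                indicator_of_mem (show z ∈ univ ×ˢ Metric.ball y 1 from ⟨mem_univ _, hz⟩),
                mul_comm]
              refine mul_le_mul_left ?_ _
              rw [hw, ← ENNReal.ofReal_mul (by positivity)]
              refine ENNReal.ofReal_le_ofReal ?_
              rw [← mul_pow]
              refine pow_le_pow_left₀ (rho_pos hκ _).le (rho_le_mul_rho hκ hβ0 ?_) 2
              rw [sub_sub_sub_cancel_right, ← dist_eq_norm]
              exact hz.le
            · rw [indicator_of_notMem (show (z, y) ∉ U from hz)]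
              exact zero_le
          refine (lintegral_mono h2).trans ?_
          rw [lintegral_indicator (MeasurableSet.univ.prod Metric.isOpen_ball.measurableSet),
            lintegral_const_mul _ hF]
          gcongr
          exact le_iSup (fun y : Space d => ∫⁻ z in univ ×ˢ Metric.ball y 1, F z ∂slabMeasure d T) y
      _ = ENNReal.ofReal (H ^ 2 * m) * A := by
          rw [lintegral_mul_const _ (by fun_prop), lintegral_const_mul _ hwm, hw,
            lintegral_sub_right_eq_self (fun x : Space d => ENNReal.ofReal (rho κ β x ^ 2)) y₀,
            ENNReal.ofReal_mul (by positivity), hm,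
            ofReal_integral_eq_lintegral_ofReal (integrable_rho_sq hκ hβ)
              (ae_of_all _ fun x => sq_nonneg _)]
  rw [lintegral_weightedMeasure hκ y₀ hF, ENNReal.ofReal_mul (by positivity),
    ENNReal.ofReal_inv_of_pos hvr, ENNReal.ofReal_toReal hvt, mul_assoc]
  rwa [← ENNReal.mul_le_iff_le_inv hv0 hvt]

end Measure

set_option maxHeartbeats 800000 in
/-- One step of the iteration, locally: for `r = d / (d - 1)`, the `L^{qr}` norm over a unit ball is
estimated by the right hand side of the energy inequality for `|u|^q`, with a constant whose growth
in `q` is explicit. -/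
lemma exists_local_bound {δ ν p T κ β Gδ Gν r : ℝ} (hδ : 0 < δ) (hν : 0 < ν) (hp2 : 2 ≤ p)
    (hp : 2 < p * (2 - Real.sqrt δ)) (hT : 0 < T) (hκ : 0 < κ) (hβ : (d : ℝ) / 4 < β)
    (hr : Real.HolderConjugate (d : ℝ) r) (hr2 : r ≤ 2) :
    ∃ C : ℝ, 0 < C ∧ ∀ (M : ℝ) (b h : ℝ × Space d → Space d) (gδ gν : ℝ → ℝ)
      (f u : ℝ × Space d → ℝ) (du : ℝ × Space d → Space d),
      IsDriftSolution T M δ ν b h gδ gν f u du → ∫ t in (0 : ℝ)..T, gδ t ≤ Gδ →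
      ∫ t in (0 : ℝ)..T, gν t ≤ Gν → ∀ q, p ≤ q → ∀ y : Space d,
      ∫⁻ z in univ ×ˢ Metric.ball y 1, ENNReal.ofReal (|u z| ^ (q * r)) ∂slabMeasure d T ≤
        ENNReal.ofReal C * (ENNReal.ofReal (q ^ p) * ∫⁻ z,
          ENNReal.ofReal (cutPow p ‖h z‖ * |f z| ^ p * |u z| ^ (q - p))
            ∂weightedMeasure T κ β y) ^ r := by
  have hβ0 : 0 < β := lt_of_le_of_lt (by positivity) hβ
  have hr0 : 0 < r := hr.symm.pos
  set s := Real.sqrt δ with hs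
  have hs0 : 0 < s := Real.sqrt_pos.2 hδ
  have hsδ : s * s = δ := Real.mul_self_sqrt hδ.le
  have hp0 : 0 < p := by linarith
  -- `σ₀ > 0` is where `p > 2 / (2 - √δ)` is used; half of `σ₀` pays for the terms with `ε`
  set σ₀ : ℝ := 4 * (p - 1) / p - 2 * s with hσ₀
  have hσ₀0 : 0 < σ₀ := by
    rw [hσ₀, sub_pos, lt_div_iff₀ hp0]; linarith
  set ε : ℝ := σ₀ / (2 * (1 + δ + ν)) with hε
  have hε0 : 0 < ε := by positivity
  set σ : ℝ := σ₀ / 2 with hσ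
  have hσ0 : 0 < σ := by positivity
  set L : ℝ := β * (κ + 1) with hL
  obtain ⟨n, hn⟩ := exists_nat_ge (2 * ((1 / s + ε) * Gδ + ε * Gν +
    (ε + (2 + 5 / ε) * (2 * L ^ 2)) * T))
  -- lower bound of the weight on the unit ball
  set c₁ : ℝ := (1 + κ) ^ (-β) with hc₁
  have hc₁0 : 0 < c₁ := Real.rpow_pos_of_pos (by linarith) _
  set Cd : NNReal := lintegralPowLePowLIntegralFDerivConst (volume : Measure (Space d)) r with hCd
  set m : ℝ := ∫ x : Space d, rho κ β x ^ 2 with hm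
  have hm0 : 0 ≤ m := integral_nonneg fun x => sq_nonneg _
  set C : ℝ := ((c₁ ^ 2) ^ r)⁻¹ * (Cd * (2 ^ r * (T + 1 / σ))) with hC
  have hC0 : 0 ≤ C := by positivity
  refine ⟨(C + 1) * (2 ^ n * ε ^ (1 - p)) ^ r, by positivity, ?_⟩
  intro M b h gδ gν f u du hu hGδ hGν q hq y
  have hq2 : 2 ≤ q := hp2.trans hq
  have hq0 : 0 < q := by linarith
  have hM0 : 0 ≤ M := (abs_nonneg _).trans (hu.heat.abs_le (0, 0))
  have hcoef : σ ≤ 4 * (q - 1) / q - 2 * s - ε * (1 + δ + ν) := by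
    have e1 : ε * (1 + δ + ν) = σ₀ / 2 := by rw [hε]; field_simp
    have e2 : 4 * (p - 1) / p ≤ 4 * (q - 1) / q := by
      rw [div_le_div_iff₀ hp0 hq0]; nlinarith only [hq]
    linarith only [e1, e2, hσ, hσ₀]
  have hn' : (1 / s + ε) * (∫ t in (0 : ℝ)..T, gδ t) + ε * (∫ t in (0 : ℝ)..T, gν t) +
      (ε + (2 + 5 / ε) * (2 * L ^ 2)) * T ≤ n / 2 := by
    have h1 := mul_le_mul_of_nonneg_left hGδ (by positivity : 0 ≤ 1 / s + ε)
    have h2 := mul_le_mul_of_nonneg_left hGν hε0.le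
    linarith only [h1, h2, hn]
  set J : ℝ≥0∞ := ∫⁻ z, ENNReal.ofReal (cutPow p ‖h z‖ * |f z| ^ p * |u z| ^ (q - p))
    ∂weightedMeasure T κ β y with hJ
  by_cases hJt : J = ⊤
  · rw [hJt, ENNReal.mul_top (by simp; positivity), ENNReal.top_rpow_of_pos hr0,
      ENNReal.mul_top (by simp; positivity)]
    exact le_top
  set j := J.toReal with hj
  have hj0 : 0 ≤ j := ENNReal.toReal_nonneg
  set Y₀ : ℝ := 2 ^ n * (q ^ p * ε ^ (1 - p) * j) with hY₀
  have hY₀0 : 0 ≤ Y₀ := by positivity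
  have c1 := hu.heat.continuous
  have c2 := hu.heat.continuous_grad
  have c3 : ∀ a : ℝ, 0 ≤ a → Continuous fun z => |u z| ^ a := fun a ha =>
    (continuous_abs_rpow ha).comp c1
  have c3b := c3 q hq0.le
  have c3d := c3 (q - p) (by linarith)
  have c7 := hu.continuous_source
  have c8 := hu.continuous_density
  have c9 : Continuous fun z => |f z| ^ p := (continuous_abs_rpow (by linarith)).comp c8
  have c10 : Continuous fun z => cutPow p ‖h z‖ := continuous_cutPow_norm c7 (by linarith)
  have hgm : Measurable fun z =>
      ENNReal.ofReal (cutPow p ‖h z‖ * |f z| ^ p * |u z| ^ (q - p)) :=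
    (by fun_prop : Continuous fun z => cutPow p ‖h z‖ * |f z| ^ p * |u z| ^ (q - p))
      |>.measurable.ennreal_ofReal
  -- the estimate with `Y > Y₀` in place of `Y₀`, the gap being used up by the cutoff
  have main : ∀ Y > Y₀, ∫⁻ z in univ ×ˢ Metric.ball y 1, ENNReal.ofReal (|u z| ^ (q * r))
      ∂slabMeasure d T ≤ ENNReal.ofReal (C * Y ^ r) := by
    intro Y hY
    have hY0 : 0 < Y := lt_of_le_of_lt hY₀0 hY
    -- `e ^ 2 * W` is the contribution of the error term of the cutoff
    set W : ℝ := 2 ^ n * ((2 + 5 / ε) * (2 * M ^ q * m)) * T with hW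
    have hW0 : 0 ≤ W := by positivity
    set e : ℝ := Real.sqrt ((Y - Y₀) / (W + 1)) with he
    have hYY : 0 < Y - Y₀ := by linarith
    have he0 : 0 < e := Real.sqrt_pos.2 (by positivity)
    have he2 : e ^ 2 * (W + 1) = Y - Y₀ := by
      rw [he, Real.sq_sqrt (by positivity)]; field_simp
    obtain ⟨η, η', hη, hηball⟩ := exists_isCutoffWeight (d := d) hκ hβ0 he0 y
    have hK := hη.isC1Test.hasCompactSupport
    have c4 := hη.isC1Test.continuous
    have z1 : ∀ x, x ∉ tsupport η → η x = 0 := fun x hx => image_eq_zero_of_notMem_tsupport hx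
    have hϱi : Integrable fun x : Space d => rho κ β (x - y) ^ 2 :=
      (integrable_rho_sq hκ hβ).comp_sub_right y
    have hϱm : ∫ x : Space d, rho κ β (x - y) ^ 2 = m :=
      integral_sub_right_eq_self (fun x : Space d => rho κ β x ^ 2) y
    set S : ℝ → ℝ := fun t =>
      ∫ x, cutPow p ‖h (t, x)‖ * |f (t, x)| ^ p * |u (t, x)| ^ (q - p) * η x ^ 2 with hS
    have hnn : ∀ z : ℝ × Space d, 0 ≤ cutPow p ‖h z‖ * |f z| ^ p * |u z| ^ (q - p) := fun z => by
      have := cutPow_nonneg (p := p) (norm_nonneg (h z))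
      positivity
    have hGc : Continuous fun z : ℝ × Space d =>
        cutPow p ‖h z‖ * |f z| ^ p * |u z| ^ (q - p) * η z.2 ^ 2 := by fun_prop
    have hGi : ∀ t : ℝ, Integrable fun x =>
        cutPow p ‖h (t, x)‖ * |f (t, x)| ^ p * |u (t, x)| ^ (q - p) * η x ^ 2 := fun t =>
      integrable_of_compact (hGc.comp (Continuous.prodMk_right t)) hK
        fun x hx => by simp [z1 x hx]
    have hSc : Continuous S := by
      refine continuous_integral_of_compact (F := fun t x =>
        cutPow p ‖h (t, x)‖ * |f (t, x)| ^ p * |u (t, x)| ^ (q - p) * η x ^ 2) ?_ hK ?_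
      · simp only [Function.uncurry_def]; fun_prop
      · intro t x hx; simp [z1 x hx]
    have hS0 : ∀ t, 0 ≤ S t := fun t => integral_nonneg fun x =>
      mul_nonneg (hnn (t, x)) (sq_nonneg _)
    have hprod : Measurable fun z : ℝ × Space d =>
        ENNReal.ofReal (cutPow p ‖h z‖ * |f z| ^ p * |u z| ^ (q - p)) *
          ENNReal.ofReal (rho κ β (z.2 - y) ^ 2) := hgm.mul (measurable_weight hκ y)
    have hSj : ∫ t in (0 : ℝ)..T, S t ≤ j := by
      rw [hj, ← ENNReal.ofReal_le_iff_le_toReal hJt, intervalIntegral.integral_of_le hT.le,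
        ← integral_Icc_eq_integral_Ioc, ofReal_integral_eq_lintegral_ofReal
          hSc.continuousOn.integrableOn_Icc (ae_of_all _ hS0), hJ,
        lintegral_weightedMeasure hκ y hgm, slabMeasure,
        lintegral_prod _ hprod.aemeasurable]
      refine lintegral_mono fun t => ?_
      simp only [hS]
      rw [ofReal_integral_eq_lintegral_ofReal
        (hGi t) (ae_of_all _ fun x => mul_nonneg (hnn (t, x)) (sq_nonneg _))]
      refine lintegral_mono fun x => ?_
      rw [← ENNReal.ofReal_mul (hnn (t, x))]
      refine ENNReal.ofReal_le_ofReal (mul_le_mul_of_nonneg_left ?_ (hnn (t, x)))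
      exact pow_le_pow_left₀ (hη.nonneg x) (hη.le x) 2
    have hest := hu.energy_estimate hη hϱi hT.le hp2 hq hε0 hs0 hsδ hσ0.le hcoef hn' rfl
    set B := ∫ t in (0 : ℝ)..T, (q ^ p * ε ^ (1 - p) * S t +
      (2 + 5 / ε) * (2 * e ^ 2 * M ^ q * ∫ x : Space d, rho κ β (x - y) ^ 2)) with hB
    have hBY : 2 ^ n * B ≤ Y := by
      rw [hB, intervalIntegral.integral_add
        ((hSc.intervalIntegrable _ _).const_mul _) intervalIntegrable_const,
        intervalIntegral.integral_const_mul, intervalIntegral.integral_const, hϱm, smul_eq_mul,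
        sub_zero]
      have h1 := mul_le_mul_of_nonneg_left hSj
        (by positivity : 0 ≤ (2 : ℝ) ^ n * (q ^ p * ε ^ (1 - p)))
      have h2 : 2 ^ n * (T * ((2 + 5 / ε) * (2 * e ^ 2 * M ^ q * m))) = e ^ 2 * W := by
        rw [hW]; ring
      have h3 : 0 < e ^ 2 := by positivity
      rw [mul_add, h2]
      linarith only [h1, h3, he2, hY₀]
    have emb := hu.lintegral_rpow_le_of_energy hη hT.le hq2 hr hr2 hY0 hσ0
      (fun t ht => (hest.1 t ht).trans hBY) (hest.2.trans hBY)
    have hlow : ∀ z ∈ (univ : Set ℝ) ×ˢ Metric.ball y 1, ENNReal.ofReal (|u z| ^ (q * r)) ≤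
        ENNReal.ofReal ((c₁ ^ 2) ^ r)⁻¹ *
          ENNReal.ofReal ((|u z| ^ q * η z.2 ^ 2) ^ r) := by
      intro z hz
      rw [← ENNReal.ofReal_mul (by positivity)]
      refine ENNReal.ofReal_le_ofReal ?_
      rw [← div_eq_inv_mul, le_div_iff₀ (by positivity), Real.rpow_mul (abs_nonneg _),
        ← Real.mul_rpow (by positivity) (by positivity)]
      refine Real.rpow_le_rpow (by positivity) ?_ hr0.le
      refine mul_le_mul_of_nonneg_left ?_ (by positivity)
      refine pow_le_pow_left₀ hc₁0.le ?_ 2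
      rw [hηball z.2 hz.2, rho, hc₁]
      refine Real.rpow_le_rpow_of_nonpos
        (by linarith [one_le_one_add_mul_norm_sq hκ (z.2 - y)]) ?_ (by linarith)
      have h1 : ‖z.2 - y‖ ≤ 1 := by
        have := hz.2
        rw [Metric.mem_ball, dist_eq_norm] at this
        exact this.le
      have h2 : ‖z.2 - y‖ ^ 2 ≤ 1 := pow_le_one₀ (norm_nonneg _) h1
      have := mul_le_mul_of_nonneg_left h2 hκ.le
      linarith
    have hηm : Measurable fun z : ℝ × Space d =>
        ENNReal.ofReal ((|u z| ^ q * η z.2 ^ 2) ^ r) :=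
      ((by fun_prop : Continuous fun z : ℝ × Space d => |u z| ^ q * η z.2 ^ 2).rpow_const
        fun _ => Or.inr hr0.le).measurable.ennreal_ofReal
    calc ∫⁻ z in univ ×ˢ Metric.ball y 1, ENNReal.ofReal (|u z| ^ (q * r)) ∂slabMeasure d T
        ≤ ∫⁻ z in univ ×ˢ Metric.ball y 1, ENNReal.ofReal ((c₁ ^ 2) ^ r)⁻¹ *
          ENNReal.ofReal ((|u z| ^ q * η z.2 ^ 2) ^ r) ∂slabMeasure d T :=
          setLIntegral_mono' (MeasurableSet.univ.prod Metric.isOpen_ball.measurableSet) hlow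
      _ ≤ ∫⁻ z, ENNReal.ofReal ((c₁ ^ 2) ^ r)⁻¹ *
          ENNReal.ofReal ((|u z| ^ q * η z.2 ^ 2) ^ r) ∂slabMeasure d T :=
          setLIntegral_le_lintegral _ _
      _ = ENNReal.ofReal ((c₁ ^ 2) ^ r)⁻¹ * ∫⁻ t in Icc 0 T, ∫⁻ x,
          ENNReal.ofReal ((|u (t, x)| ^ q * η x ^ 2) ^ r) := by
          rw [lintegral_const_mul _ hηm, slabMeasure, lintegral_prod _ hηm.aemeasurable]
      _ ≤ ENNReal.ofReal ((c₁ ^ 2) ^ r)⁻¹ *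
          (Cd * ENNReal.ofReal (2 ^ r * Y ^ r * (T + 1 / σ))) := by gcongr
      _ = ENNReal.ofReal (C * Y ^ r) := by
          rw [← ENNReal.ofReal_coe_nnreal, ← ENNReal.ofReal_mul (by positivity),
            ← ENNReal.ofReal_mul (by positivity), hC]
          congr 1; ring
  have hlim : Tendsto (fun Y : ℝ => ENNReal.ofReal (C * Y ^ r)) (𝓝[>] Y₀)
      (𝓝 (ENNReal.ofReal (C * Y₀ ^ r))) := by
    refine (ENNReal.continuous_ofReal.comp (continuous_const.mul
      (Real.continuous_rpow_const hr0.le))).continuousAt.tendsto.mono_left nhdsWithin_le_nhds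
  refine (ge_of_tendsto hlim (eventually_mem_nhdsWithin.mono main)).trans ?_
  rw [← ENNReal.ofReal_toReal hJt, ← hj, ← ENNReal.ofReal_mul (by positivity),
    ENNReal.ofReal_rpow_of_nonneg (by positivity) hr0.le, ← ENNReal.ofReal_mul (by positivity)]
  refine ENNReal.ofReal_le_ofReal ?_
  have e1 : Y₀ = (2 ^ n * ε ^ (1 - p)) * (q ^ p * j) := by rw [hY₀]; ring
  rw [e1, Real.mul_rpow (by positivity) (by positivity), ← mul_assoc]
  gcongr
  linarith

/-! ### Moser iteration -/

/-- `sup_y ∫∫ |u|^a ρ_y^2 dx dt`. -/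
noncomputable def translatedMoment (T κ β : ℝ) (u : ℝ × Space d → ℝ) (a : ℝ) : ℝ≥0∞ :=
  ⨆ y : Space d, ∫⁻ z, ENNReal.ofReal (|u z| ^ a) ∂weightedMeasure T κ β y

lemma weightedIntegral_eq {T p θ' κ β : ℝ} (hκ : 0 < κ) (hp : 0 ≤ p) (hθ' : 0 ≤ θ')
    {h : ℝ × Space d → Space d} {f : ℝ × Space d → ℝ} (hh : Continuous h) (hf : Continuous f)
    (y : Space d) :
    weightedIntegral T p θ' κ β h f y =
      ∫⁻ z, ENNReal.ofReal (cutPow p ‖h z‖ * |f z| ^ p) ^ θ' ∂weightedMeasure T κ β y := by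
  have c9 : Continuous fun z => |f z| ^ p := (continuous_abs_rpow hp).comp hf
  have c10 : Continuous fun z => cutPow p ‖h z‖ := continuous_cutPow_norm hh hp
  have hm : Measurable fun z => ENNReal.ofReal (cutPow p ‖h z‖ * |f z| ^ p) ^ θ' :=
    (by fun_prop : Continuous fun z => cutPow p ‖h z‖ * |f z| ^ p).measurable.ennreal_ofReal.pow_const _
  have hprod : Measurable fun z => ENNReal.ofReal (cutPow p ‖h z‖ * |f z| ^ p) ^ θ' *
      ENNReal.ofReal (rho κ β (z.2 - y) ^ 2) := hm.mul (measurable_weight hκ y)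
  rw [lintegral_weightedMeasure hκ y hm, slabMeasure, lintegral_prod _ hprod.aemeasurable,
    weightedIntegral]
  refine lintegral_congr fun t => lintegral_congr fun x => ?_
  have h0 := cutPow_nonneg (p := p) (norm_nonneg (h (t, x)))
  rw [ENNReal.ofReal_rpow_of_nonneg (by positivity) hθ', ← ENNReal.ofReal_mul (by positivity),
    Real.mul_rpow h0 (by positivity), ← Real.rpow_mul (abs_nonneg _)]

/-- One step of the iteration. -/
lemma exists_translatedMoment_le {δ ν p T κ β Gδ Gν r θ θ' : ℝ} (hδ : 0 < δ) (hν : 0 < ν)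
    (hp2 : 2 ≤ p) (hp : 2 < p * (2 - Real.sqrt δ)) (hT : 0 < T) (hκ : 0 < κ)
    (hβ : (d : ℝ) / 4 < β) (hr : Real.HolderConjugate (d : ℝ) r) (hr2 : r ≤ 2)
    (hθ : Real.HolderConjugate θ' θ) :
    ∃ C : ℝ, 0 < C ∧ ∀ (M : ℝ) (b h : ℝ × Space d → Space d) (gδ gν : ℝ → ℝ)
      (f u : ℝ × Space d → ℝ) (du : ℝ × Space d → Space d),
      IsDriftSolution T M δ ν b h gδ gν f u du → ∫ t in (0 : ℝ)..T, gδ t ≤ Gδ →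
      ∫ t in (0 : ℝ)..T, gν t ≤ Gν → ∀ q, p ≤ q →
      translatedMoment T κ β u (q * r) ^ (1 / r) ≤ ENNReal.ofReal (C * q ^ p) *
        ((⨆ y : Space d, weightedIntegral T p θ' κ β h f y) ^ (1 / θ') *
          translatedMoment T κ β u ((q - p) * θ) ^ (1 / θ)) := by
  obtain ⟨C₁, hC₁, H₁⟩ := exists_local_bound (d := d) (Gδ := Gδ) (Gν := Gν) hδ hν hp2 hp hT hκ hβ
    hr hr2
  obtain ⟨C₂, hC₂, H₂⟩ := exists_lintegral_weightedMeasure_le (d := d) hκ hβ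
  have hr0 : 0 < r := hr.symm.pos
  have hθ'0 : 0 < θ' := hθ.pos
  have hθ0 : 0 < θ := hθ.symm.pos
  refine ⟨((C₂ + 1) * C₁) ^ (1 / r), by positivity, ?_⟩
  intro M b h gδ gν f u du hu hGδ hGν q hq
  have hq0 : 0 < q := by linarith
  have c1 := hu.heat.continuous
  have c3 : ∀ a : ℝ, 0 ≤ a → Continuous fun z => |u z| ^ a := fun a ha =>
    (continuous_abs_rpow ha).comp c1
  have c3d := c3 (q - p) (by linarith)
  have c7 := hu.continuous_source
  have c8 := hu.continuous_density
  have c9 : Continuous fun z => |f z| ^ p := (continuous_abs_rpow (by linarith)).comp c8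
  have c10 : Continuous fun z => cutPow p ‖h z‖ := continuous_cutPow_norm c7 (by linarith)
  set Wsup := ⨆ y : Space d, weightedIntegral T p θ' κ β h f y with hWsup
  set V := translatedMoment T κ β u ((q - p) * θ) with hV
  have holder : ∀ y : Space d, ∫⁻ z,
      ENNReal.ofReal (cutPow p ‖h z‖ * |f z| ^ p * |u z| ^ (q - p)) ∂weightedMeasure T κ β y ≤
      Wsup ^ (1 / θ') * V ^ (1 / θ) := by
    intro y
    have hm1 : Measurable fun z => ENNReal.ofReal (cutPow p ‖h z‖ * |f z| ^ p) :=
      (by fun_prop : Continuous fun z => cutPow p ‖h z‖ * |f z| ^ p).measurable.ennreal_ofReal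
    have hm2 : Measurable fun z => ENNReal.ofReal (|u z| ^ (q - p)) :=
      c3d.measurable.ennreal_ofReal
    have h1 := ENNReal.lintegral_mul_le_Lp_mul_Lq (weightedMeasure T κ β y) hθ
      hm1.aemeasurable hm2.aemeasurable
    have e1 : ∀ z, ENNReal.ofReal (|u z| ^ (q - p)) ^ θ =
        ENNReal.ofReal (|u z| ^ ((q - p) * θ)) := fun z => by
      rw [ENNReal.ofReal_rpow_of_nonneg (by positivity) hθ0.le, ← Real.rpow_mul (abs_nonneg _)]
    simp only [e1] at h1
    rw [← weightedIntegral_eq hκ (by linarith) hθ'0.le c7 c8 y] at h1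
    have e2 : ∀ z, ENNReal.ofReal (cutPow p ‖h z‖ * |f z| ^ p * |u z| ^ (q - p)) =
        ENNReal.ofReal (cutPow p ‖h z‖ * |f z| ^ p) * ENNReal.ofReal (|u z| ^ (q - p)) := fun z => by
      rw [ENNReal.ofReal_mul]
      have := cutPow_nonneg (p := p) (norm_nonneg (h z))
      positivity
    simp only [e2]
    refine h1.trans (mul_le_mul' (ENNReal.rpow_le_rpow ?_ (by positivity))
      (ENNReal.rpow_le_rpow ?_ (by positivity)))
    · exact le_iSup (fun y : Space d => weightedIntegral T p θ' κ β h f y) y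
    · exact le_iSup (fun y : Space d => ∫⁻ z, ENNReal.ofReal (|u z| ^ ((q - p) * θ))
        ∂weightedMeasure T κ β y) y
  have hmom : translatedMoment T κ β u (q * r) ≤ ENNReal.ofReal (C₂ + 1) *
      (ENNReal.ofReal C₁ * (ENNReal.ofReal (q ^ p) * (Wsup ^ (1 / θ') * V ^ (1 / θ))) ^ r) := by
    refine iSup_le fun y₀ => (H₂ T _ ((c3 (q * r) (by positivity)).measurable.ennreal_ofReal)
      y₀).trans (mul_le_mul' (ENNReal.ofReal_le_ofReal (by linarith)) (iSup_le fun y => ?_))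
    refine (H₁ M b h gδ gν f u du hu hGδ hGν q hq y).trans ?_
    gcongr
    exact holder y
  refine (ENNReal.rpow_le_rpow hmom (by positivity : 0 ≤ 1 / r)).trans (le_of_eq ?_)
  rw [← mul_assoc, ← ENNReal.ofReal_mul (by positivity), ENNReal.mul_rpow_of_nonneg _ _
    (by positivity), ← ENNReal.rpow_mul, mul_one_div_cancel hr0.ne', ENNReal.rpow_one,
    ENNReal.ofReal_rpow_of_nonneg (by positivity) (by positivity), ← mul_assoc,
    ← ENNReal.ofReal_mul (by positivity)]

/-- The exponents of the iteration: `q_0 = p`, `q_{k+1} = p + lam q_k`. -/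
noncomputable def moserExponent (p lam : ℝ) : ℕ → ℝ
  | 0 => p
  | k + 1 => p + lam * moserExponent p lam k

lemma le_moserExponent {p lam : ℝ} (hp : 0 ≤ p) (hlam : 0 ≤ lam) (k : ℕ) :
    p ≤ moserExponent p lam k := by
  induction k with
  | zero => exact le_rfl
  | succ k ih =>
    have : 0 ≤ lam * moserExponent p lam k := mul_nonneg hlam (hp.trans ih)
    rw [moserExponent]; linarith

lemma natCast_mul_le_moserExponent {p lam : ℝ} (hp : 0 ≤ p) (hlam : 1 ≤ lam) (k : ℕ) :
    k * p ≤ moserExponent p lam k := by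
  induction k with
  | zero => simpa [moserExponent] using hp
  | succ k ih =>
    have h1 := le_moserExponent hp (zero_le_one.trans hlam) k
    have h2 : 1 * moserExponent p lam k ≤ lam * moserExponent p lam k :=
      mul_le_mul_of_nonneg_right hlam (hp.trans h1)
    rw [moserExponent]; push_cast; linarith

lemma moserExponent_le {p lam : ℝ} (hp : 0 ≤ p) (hlam : 1 < lam) (k : ℕ) :
    moserExponent p lam k ≤ p * lam / (lam - 1) * lam ^ k := by
  have h0 : 0 < lam - 1 := by linarith
  have key : moserExponent p lam k = p * lam / (lam - 1) * lam ^ k - p / (lam - 1) := by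
    induction k with
    | zero => rw [moserExponent]; field_simp
    | succ k ih => rw [moserExponent, ih]; field_simp; ring
  have : 0 ≤ p / (lam - 1) := by positivity
  linarith

/-- Solution of the recursive inequality of the iteration. The factor
`A^{-(α k + γ)}` with `α = 1 / (lam - 1)` and `γ = (2 + α) / (lam - 1)` absorbs the
constants `C q_{k+1}^p ≤ A^{k+2}` of all the steps. -/
lemma exists_moser_bound {p lam C m : ℝ} (hp : 1 ≤ p) (hlam : 1 < lam) (hC : 0 < C) :
    ∃ S : ℝ, 1 ≤ S ∧ ∀ (x : ℕ → ℝ≥0∞) (K : ℝ≥0∞), x 0 ≤ ENNReal.ofReal m * K ^ p →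
      (∀ k, x (k + 1) ≤
        ENNReal.ofReal (C * moserExponent p lam (k + 1) ^ p) * (K ^ p * x k ^ lam)) →
      ∀ k, x k ≤ (ENNReal.ofReal S * K) ^ moserExponent p lam k := by
  have h0 : 0 < lam - 1 := by linarith
  have hp0 : 0 ≤ p := by linarith
  set Q : ℝ := p * lam / (lam - 1) with hQ
  have hQ0 : 0 ≤ Q := by positivity
  set A : ℝ := max 1 (max (C * Q ^ p) (lam ^ p)) with hA
  have hA1 : 1 ≤ A := le_max_left _ _
  have hA0 : 0 < A := by linarith
  set α : ℝ := 1 / (lam - 1) with hα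
  set γ : ℝ := (2 + α) / (lam - 1) with hγ
  have hα0 : 0 ≤ α := by positivity
  have hγ0 : 0 ≤ γ := by positivity
  set S : ℝ := max 1 (m * A ^ γ) with hS
  have hS1 : 1 ≤ S := le_max_left _ _
  have hS0 : 0 < S := by linarith
  refine ⟨S, hS1, fun x K hx0 hstep => ?_⟩
  have hqk : ∀ k, 0 ≤ moserExponent p lam k := fun k =>
    hp0.trans (le_moserExponent hp0 (by linarith) k)
  have ind : ∀ k : ℕ, x k ≤ ENNReal.ofReal (S ^ moserExponent p lam k * A ^ (-(α * k + γ))) *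
      K ^ moserExponent p lam k := by
    intro k
    induction k with
    | zero =>
      refine hx0.trans ?_
      rw [moserExponent]
      gcongr
      have h1 : m * A ^ γ ≤ S ^ p := (le_max_right _ _).trans (by
        conv_lhs => rw [← hS, ← Real.rpow_one S]
        exact Real.rpow_le_rpow_of_exponent_le hS1 hp)
      have h2 : A ^ (-(α * (0 : ℕ) + γ)) = (A ^ γ)⁻¹ := by
        rw [← Real.rpow_neg hA0.le]; simp
      rw [h2, ← div_eq_mul_inv, le_div_iff₀ (by positivity)]
      exact h1
    | succ k ih =>
      have hlam0 : 0 ≤ lam := by linarith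
      have h1 : x k ^ lam ≤ ENNReal.ofReal (S ^ (lam * moserExponent p lam k) *
          A ^ (-(α * k + γ) * lam)) * K ^ (lam * moserExponent p lam k) := by
        refine (ENNReal.rpow_le_rpow ih hlam0).trans (le_of_eq ?_)
        rw [ENNReal.mul_rpow_of_nonneg _ _ hlam0,
          ENNReal.ofReal_rpow_of_nonneg (by positivity) hlam0,
          Real.mul_rpow (by positivity) (by positivity), ← Real.rpow_mul hS0.le,
          ← Real.rpow_mul hA0.le, ← ENNReal.rpow_mul, mul_comm lam]
      have h2 : C * moserExponent p lam (k + 1) ^ p ≤ A ^ ((k : ℝ) + 2) := by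
        have h3 : moserExponent p lam (k + 1) ^ p ≤ (Q * lam ^ (k + 1)) ^ p :=
          Real.rpow_le_rpow (hqk _) (moserExponent_le hp0 hlam _) hp0
        calc C * moserExponent p lam (k + 1) ^ p ≤ C * (Q * lam ^ (k + 1)) ^ p := by gcongr
          _ = (C * Q ^ p) * (lam ^ p) ^ (k + 1) := by
            rw [Real.mul_rpow hQ0 (by positivity), ← Real.rpow_natCast (lam ^ p) (k + 1),
              ← Real.rpow_mul hlam0, ← Real.rpow_natCast lam (k + 1), ← Real.rpow_mul hlam0]
            ring_nf
          _ ≤ A * A ^ (k + 1) := by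
            gcongr
            · exact (le_max_left _ _).trans (le_max_right _ _)
            · exact (le_max_right _ _).trans (le_max_right _ _)
          _ = A ^ ((k : ℝ) + 2) := by
            rw [← pow_succ', ← Real.rpow_natCast]; push_cast; ring_nf
      refine (hstep k).trans ?_
      calc ENNReal.ofReal (C * moserExponent p lam (k + 1) ^ p) * (K ^ p * x k ^ lam)
          ≤ ENNReal.ofReal (A ^ ((k : ℝ) + 2)) * (K ^ p *
            (ENNReal.ofReal (S ^ (lam * moserExponent p lam k) * A ^ (-(α * k + γ) * lam)) *
              K ^ (lam * moserExponent p lam k))) := by gcongr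
        _ = ENNReal.ofReal (A ^ ((k : ℝ) + 2) *
            (S ^ (lam * moserExponent p lam k) * A ^ (-(α * k + γ) * lam))) *
            (K ^ p * K ^ (lam * moserExponent p lam k)) := by
            rw [ENNReal.ofReal_mul (show 0 ≤ A ^ ((k : ℝ) + 2) by positivity)]; ring
        _ ≤ ENNReal.ofReal (S ^ moserExponent p lam (k + 1) * A ^ (-(α * (k + 1 : ℕ) + γ))) *
            K ^ moserExponent p lam (k + 1) := by
            rw [← ENNReal.rpow_add_of_nonneg _ _ hp0 (mul_nonneg hlam0 (hqk k)), moserExponent]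
            gcongr ENNReal.ofReal ?_ * _
            have h4 : S ^ (lam * moserExponent p lam k) ≤
                S ^ (p + lam * moserExponent p lam k) :=
              Real.rpow_le_rpow_of_exponent_le hS1 (by linarith)
            have h5 : A ^ ((k : ℝ) + 2) * A ^ (-(α * k + γ) * lam) ≤
                A ^ (-(α * (k + 1 : ℕ) + γ)) := by
              rw [← Real.rpow_add hA0]
              refine Real.rpow_le_rpow_of_exponent_le hA1 ?_
              have e1 : α * (lam - 1) = 1 := by rw [hα]; field_simp
              have e2 : γ * (lam - 1) = 2 + α := by rw [hγ]; field_simp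
              push_cast
              have e3 : (k : ℝ) * (α * (lam - 1)) = k := by rw [e1, mul_one]
              nlinarith
            calc A ^ ((k : ℝ) + 2) *
                  (S ^ (lam * moserExponent p lam k) * A ^ (-(α * k + γ) * lam))
                = S ^ (lam * moserExponent p lam k) *
                  (A ^ ((k : ℝ) + 2) * A ^ (-(α * k + γ) * lam)) := by ring
              _ ≤ _ := mul_le_mul h4 h5 (by positivity) (by positivity)
  intro k
  refine (ind k).trans ?_
  rw [ENNReal.mul_rpow_of_nonneg _ _ (hqk k), ENNReal.ofReal_rpow_of_nonneg hS0.le (hqk k)]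
  gcongr
  refine mul_le_of_le_one_right (by positivity) ?_
  exact Real.rpow_le_one_of_one_le_of_nonpos hA1 (by
    have : 0 ≤ α * k := by positivity
    linarith)

/-- A function whose moments of order `a → ∞` are bounded by `N^a` is bounded by `N`. -/
lemma ae_le_of_lintegral_rpow_le {Ω : Type*} [MeasurableSpace Ω] {μ : Measure Ω}
    {F : Ω → ℝ≥0∞} (hF : Measurable F) {N : ℝ≥0∞} {a : ℕ → ℝ}
    (ha : Tendsto a atTop atTop) (h : ∀ k, ∫⁻ z, F z ^ a k ∂μ ≤ N ^ a k) :
    ∀ᵐ z ∂μ, F z ≤ N := by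
  rcases eq_or_ne N ⊤ with rfl | hN
  · exact ae_of_all _ fun z => le_top
  have hnull : ∀ c : ℝ≥0∞, N < c → c ≠ ⊤ → μ {z | c ≤ F z} = 0 := by
    intro c hc hct
    have hc0 : c ≠ 0 := (zero_le.trans_lt hc).ne'
    have hlt : N / c < 1 := (ENNReal.div_lt_iff (Or.inl hc0) (Or.inl hct)).2 (by simpa using hc)
    have hbound : ∀ᶠ k in atTop, μ {z | c ≤ F z} ≤ (N / c) ^ a k := by
      filter_upwards [ha.eventually_gt_atTop 0] with k hk
      have h1 : c ^ a k * μ {z | c ^ a k ≤ F z ^ a k} ≤ N ^ a k :=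
        (mul_meas_ge_le_lintegral (hF.pow_const _) _).trans (h k)
      have h2 : {z | c ^ a k ≤ F z ^ a k} = {z | c ≤ F z} := by
        ext z; exact ENNReal.rpow_le_rpow_iff hk
      rw [h2] at h1
      rw [ENNReal.div_rpow_of_nonneg _ _ hk.le,
        ENNReal.le_div_iff_mul_le (Or.inl (ENNReal.rpow_pos_of_nonneg (zero_le.trans_lt hc) hk.le).ne')
          (Or.inl (ENNReal.rpow_ne_top_of_nonneg hk.le hct)), mul_comm]
      exact h1
    have hlim : Tendsto (fun k => (N / c) ^ a k) atTop (𝓝 0) :=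
      (ENNReal.tendsto_rpow_atTop_of_base_lt_one hlt).comp ha
    exact le_antisymm (ge_of_tendsto hlim hbound) zero_le
  have hall : ∀ᵐ z ∂μ, ∀ n : ℕ, F z < N + ((n : ℝ≥0∞) + 1)⁻¹ := by
    rw [ae_all_iff]
    intro n
    have h1 := hnull (N + ((n : ℝ≥0∞) + 1)⁻¹)
      (ENNReal.lt_add_right hN (by simp [ENNReal.add_eq_top])) (by simp [hN])
    rw [ae_iff]
    simpa only [not_lt] using h1
  filter_upwards [hall] with z hz
  refine ENNReal.le_of_forall_pos_le_add fun ε hε _ => ?_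
  obtain ⟨n, hn⟩ := ENNReal.exists_inv_nat_lt (a := (ε : ℝ≥0∞)) (by simpa using hε.ne')
  refine (hz n).le.trans (add_le_add le_rfl (le_trans ?_ hn.le))
  exact ENNReal.inv_le_inv.2 le_self_add

/-! ### The supremum bound -/

/-- A solution on `[0, T]` is extended to all times by its values at `t = 0` and `t = T`. -/
lemma IsCauchySolution.exists_isDriftSolution {T δ ν : ℝ} {b h : ℝ × Space d → Space d}
    {gδ gν : ℝ → ℝ} {f u : ℝ × Space d → ℝ} (hT : 0 ≤ T) (hb : Continuous b)
    (hbf : IsFormBounded b δ gδ) (hh : Continuous h) (hhf : IsFormBounded h ν gν)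
    (hf : Continuous f) (hu : IsCauchySolution T b (fun z => ‖h z‖ * f z) u) :
    ∃ (M : ℝ) (v : ℝ × Space d → ℝ) (dv : ℝ × Space d → Space d),
      IsDriftSolution T M δ ν b h gδ gν f v dv ∧ ∀ t ∈ Icc 0 T, ∀ x, v (t, x) = u (t, x) := by
  obtain ⟨M, hM⟩ := hu.bounded
  let c : ℝ → ℝ := fun t => max 0 (min t T)
  have hcI : ∀ t, c t ∈ Icc 0 T := fun t => ⟨le_max_left _ _, max_le hT (min_le_right _ _)⟩
  have hcid : ∀ t ∈ Icc 0 T, c t = t := fun t ht => by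
    simp only [c]; rw [min_eq_left ht.2, max_eq_right ht.1]
  have hcc : Continuous c := by fun_prop
  have hmap : Continuous fun z : ℝ × Space d => (c z.1, z.2) := by fun_prop
  have hmem : ∀ z : ℝ × Space d, (c z.1, z.2) ∈ Icc 0 T ×ˢ (univ : Set (Space d)) :=
    fun z => ⟨hcI _, mem_univ _⟩
  have hvc : Continuous fun z : ℝ × Space d => u (c z.1, z.2) :=
    hu.continuousOn.comp_continuous hmap hmem
  have hdc : Continuous fun z : ℝ × Space d => spatialGrad u (c z.1) z.2 :=
    hu.continuousOn_grad.comp_continuous hmap hmem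
  refine ⟨M, fun z => u (c z.1, z.2), fun z => spatialGrad u (c z.1) z.2,
    ⟨hb, hbf, hh, hhf, hf, ⟨?_, hvc, hdc, fun t x => ?_, fun z => (hM _ (hcI _) _).1,
      fun z => (hM _ (hcI _) _).2, fun x => ?_, fun φ hφ hφc t ht => ?_⟩⟩, fun t ht x => ?_⟩
  · exact (hh.norm.mul hf).sub (hb.inner hdc)
  · exact (hu.differentiable _ (hcI t) x).hasGradientAt
  · simp only [hcid 0 ⟨le_rfl, hT⟩, hu.initial]
  · simp only [hcid t ht]
    rw [hu.weak_eq φ hφ hφc t ht]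
    refine intervalIntegral.integral_congr fun s hs => ?_
    rw [uIcc_of_le ht.1] at hs
    refine integral_congr_ae (ae_of_all _ fun x => ?_)
    simp only [hcid s ⟨hs.1, hs.2.trans ht.2⟩]
    ring
  · simp only [hcid t ht]

lemma exists_latticePoint_near (y : Space d) :
    ∃ z : Fin d → ℤ, ‖y - latticePoint z‖ ≤ Real.sqrt d := by
  refine ⟨fun i => ⌊y i⌋, ?_⟩
  rw [EuclideanSpace.norm_eq]
  refine Real.sqrt_le_sqrt ?_
  have h1 : ∀ i ∈ Finset.univ, ‖(y - latticePoint fun i => ⌊y i⌋) i‖ ^ 2 ≤ (1 : ℝ) := by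
    intro i _
    have h2 := Int.floor_le (y i)
    have h3 := Int.lt_floor_add_one (y i)
    have h4 : (y - latticePoint fun i => ⌊y i⌋) i = y i - ⌊y i⌋ := by simp [latticePoint]
    rw [h4, Real.norm_eq_abs, sq_abs]
    nlinarith
  simpa using Finset.sum_le_sum h1

/-- Weighted integrals with nearby centres are comparable. -/
lemma weightedIntegral_le_mul {T p q κ β R : ℝ} (hκ : 0 < κ) (hβ : 0 < β)
    (h : ℝ × Space d → Space d) (f : ℝ × Space d → ℝ) {y z : Space d} (hyz : ‖y - z‖ ≤ R) :
    weightedIntegral T p q κ β h f y ≤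
      ENNReal.ofReal (((2 * (1 + κ * R ^ 2)) ^ β) ^ 2) * weightedIntegral T p q κ β h f z := by
  unfold weightedIntegral
  rw [← lintegral_const_mul' _ _ ENNReal.ofReal_ne_top]
  refine lintegral_mono fun t => ?_
  rw [← lintegral_const_mul' _ _ ENNReal.ofReal_ne_top]
  refine lintegral_mono fun x => ?_
  rw [← ENNReal.ofReal_mul (by positivity)]
  refine ENNReal.ofReal_le_ofReal ?_
  have h1 : rho κ β (x - y) ≤ (2 * (1 + κ * R ^ 2)) ^ β * rho κ β (x - z) :=
    rho_le_mul_rho hκ hβ (by rw [sub_sub_sub_cancel_left, norm_sub_rev]; exact hyz)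
  have h2 := pow_le_pow_left₀ (rho_pos hκ _).le h1 2
  rw [mul_pow] at h2
  have h3 : 0 ≤ cutPow p ‖h (t, x)‖ ^ q * |f (t, x)| ^ (p * q) := by
    have := cutPow_nonneg (p := p) (norm_nonneg (h (t, x)))
    positivity
  have := mul_le_mul_of_nonneg_left h2 h3
  linarith

/-- The bound by weighted integrals centred at arbitrary points of `ℝ^d`. -/
lemma exists_ae_bound {δ ν p T κ β Gδ Gν r θ θ' : ℝ} (hδ : 0 < δ) (hν : 0 < ν)
    (hp2 : 2 ≤ p) (hp : 2 < p * (2 - Real.sqrt δ)) (hT : 0 < T) (hκ : 0 < κ)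
    (hβ : (d : ℝ) / 4 < β) (hr : Real.HolderConjugate (d : ℝ) r) (hr2 : r ≤ 2)
    (hθ : Real.HolderConjugate θ' θ) (hθr : θ < r) :
    ∃ C : ℝ, 0 < C ∧ ∀ (M : ℝ) (b h : ℝ × Space d → Space d) (gδ gν : ℝ → ℝ)
      (f u : ℝ × Space d → ℝ) (du : ℝ × Space d → Space d),
      IsDriftSolution T M δ ν b h gδ gν f u du → ∫ t in (0 : ℝ)..T, gδ t ≤ Gδ →
      ∫ t in (0 : ℝ)..T, gν t ≤ Gν → ∀ᵐ z ∂slabMeasure d T,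
      ENNReal.ofReal |u z| ≤ ENNReal.ofReal C *
        (⨆ y : Space d, weightedIntegral T p θ' κ β h f y) ^ (1 / (p * θ')) := by
  obtain ⟨C, hC, H⟩ := exists_translatedMoment_le (d := d) (Gδ := Gδ) (Gν := Gν) hδ hν hp2 hp hT
    hκ hβ hr hr2 hθ
  have hr0 : 0 < r := hr.symm.pos
  have hθ'0 : 0 < θ' := hθ.pos
  have hθ0 : 0 < θ := hθ.symm.pos
  have hp0 : 0 < p := by linarith
  set lam : ℝ := r / θ with hlam
  have hlam1 : 1 < lam := (one_lt_div hθ0).2 hθr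
  set m₀ : ℝ := T * ∫ x : Space d, rho κ β x ^ 2 with hm₀
  have hm₀0 : 0 ≤ m₀ := mul_nonneg hT.le (integral_nonneg fun x => sq_nonneg _)
  obtain ⟨S, hS1, hS⟩ := exists_moser_bound (p := p) (lam := lam) (C := C)
    (m := C * p ^ p * m₀ ^ (1 / θ)) (by linarith) hlam1 hC
  refine ⟨S, by linarith, fun M b h gδ gν f u du hu hGδ hGν => ?_⟩
  set Wsup := ⨆ y : Space d, weightedIntegral T p θ' κ β h f y with hWsup
  set K := Wsup ^ (1 / (p * θ')) with hK
  have hKp : Wsup ^ (1 / θ') = K ^ p := by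
    rw [hK, ← ENNReal.rpow_mul]; congr 1; field_simp
  have hq0 : ∀ k, 0 < moserExponent p lam k := fun k =>
    hp0.trans_le (le_moserExponent hp0.le (by linarith) k)
  have hiter := hS (fun k => translatedMoment T κ β u (moserExponent p lam k * r) ^ (1 / r)) K
    (by
      have h1 := H M b h gδ gν f u du hu hGδ hGν p le_rfl
      refine h1.trans ?_
      rw [hKp, sub_self, zero_mul, ENNReal.ofReal_mul (by positivity), mul_assoc,
        ENNReal.ofReal_mul (by positivity), mul_assoc,
        ← ENNReal.ofReal_rpow_of_nonneg hm₀0 (by positivity), mul_comm (K ^ p)]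
      rw [ENNReal.ofReal_mul hC.le, mul_assoc]
      gcongr
      refine iSup_le fun y => ?_
      simp only [Real.rpow_zero, ENNReal.ofReal_one, lintegral_const, one_mul]
      rw [weightedMeasure_univ hκ hβ, hm₀, ENNReal.ofReal_mul hT.le])
    (fun k => by
      have h1 := H M b h gδ gν f u du hu hGδ hGν (moserExponent p lam (k + 1))
        (le_moserExponent hp0.le (by linarith) _)
      -- the exponents are chosen so that no Hölder inequality between moments is needed
      have h2 : (moserExponent p lam (k + 1) - p) * θ = moserExponent p lam k * r := by
        rw [moserExponent, hlam]; field_simp; ring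
      rw [hKp, h2] at h1
      have h3 : 1 / r * lam = 1 / θ := by rw [hlam]; field_simp
      simpa only [← ENNReal.rpow_mul, h3] using h1)
  have c1 := hu.heat.continuous
  have hFm : Measurable fun z => ENNReal.ofReal |u z| := c1.abs.measurable.ennreal_ofReal
  have hmom : ∀ k, ∫⁻ z, ENNReal.ofReal |u z| ^ (moserExponent p lam k * r)
      ∂weightedMeasure T κ β (0 : Space d) ≤
      (ENNReal.ofReal S * K) ^ (moserExponent p lam k * r) := by
    intro k
    have h1 := ENNReal.rpow_le_rpow (hiter k) hr0.le
    rw [← ENNReal.rpow_mul, one_div_mul_cancel hr0.ne', ENNReal.rpow_one, ← ENNReal.rpow_mul] at h1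
    refine le_trans ?_ h1
    have h2 : ∀ z, ENNReal.ofReal |u z| ^ (moserExponent p lam k * r) =
        ENNReal.ofReal (|u z| ^ (moserExponent p lam k * r)) := fun z =>
      ENNReal.ofReal_rpow_of_nonneg (abs_nonneg _) (mul_pos (hq0 k) hr0).le
    simp only [h2]
    exact le_iSup (fun y : Space d => ∫⁻ z, ENNReal.ofReal (|u z| ^ (moserExponent p lam k * r))
      ∂weightedMeasure T κ β y) 0
  have htend : Tendsto (fun k => moserExponent p lam k * r) atTop atTop := by
    refine Tendsto.atTop_mul_const hr0 ?_
    exact tendsto_atTop_mono (natCast_mul_le_moserExponent hp0.le hlam1.le)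
      (tendsto_natCast_atTop_atTop.atTop_mul_const hp0)
  have hae := ae_le_of_lintegral_rpow_le hFm htend hmom
  rw [weightedMeasure, ae_withDensity_iff (measurable_weight hκ 0)] at hae
  filter_upwards [hae] with z hz
  refine hz ?_
  have := rho_pos (β := β) hκ (z.2 - 0)
  simp only [ne_eq, ENNReal.ofReal_eq_zero, not_le]
  positivity

end SingularDrift

theorem proposition3 (d : ℕ) (hd : 3 ≤ d) (δ ν p T θ β κ Gδ Gν : ℝ)
    (hδ : 0 < δ) (hδ4 : δ < 4) (hν : 0 < ν)
    (hp : 2 / (2 - Real.sqrt δ) < p) (hp2 : 2 ≤ p) (hT : 0 < T)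
    (hθ : 1 < θ) (hθd : θ < (d : ℝ) / ((d : ℝ) - 1))
    (hβ : (d : ℝ) / 4 < β) (hκ : 0 < κ) :
    ∃ C : ℝ, 0 < C ∧
      ∀ (b h : ℝ × SingularDrift.Space d → SingularDrift.Space d) (gδ gν : ℝ → ℝ)
        (f u : ℝ × SingularDrift.Space d → ℝ),
        SingularDrift.IsSmoothCompactlySupported b →
        SingularDrift.IsFormBounded b δ gδ → ∫ t in (0 : ℝ)..T, gδ t ≤ Gδ →
        SingularDrift.IsSmoothCompactlySupported h →
        SingularDrift.IsFormBounded h ν gν → ∫ t in (0 : ℝ)..T, gν t ≤ Gν →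
        Continuous f → HasCompactSupport f →
        SingularDrift.IsCauchySolution T b (fun z => ‖h z‖ * f z) u →
        eLpNorm u ∞ (volume.restrict (Icc 0 T ×ˢ (univ : Set (SingularDrift.Space d)))) ≤
          ENNReal.ofReal C *
            ⨆ z : Fin d → ℤ,
              SingularDrift.weightedIntegral T p (θ / (θ - 1)) κ β h f
                (SingularDrift.latticePoint z) ^ (1 / (p * (θ / (θ - 1)))) := by
  have hβ0 : 0 < β := lt_of_le_of_lt (by positivity) hβ
  have hd3 : (3 : ℝ) ≤ d := by exact_mod_cast hd
  have hd1 : 0 < (d : ℝ) - 1 := by linarith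
  have hs2 : Real.sqrt δ < 2 := by
    rw [Real.sqrt_lt' two_pos]; linarith
  have hp' : 2 < p * (2 - Real.sqrt δ) := by
    rwa [div_lt_iff₀ (by linarith)] at hp
  have hr : Real.HolderConjugate (d : ℝ) ((d : ℝ) / ((d : ℝ) - 1)) :=
    Real.HolderConjugate.conjExponent (by linarith)
  have hr2 : (d : ℝ) / ((d : ℝ) - 1) ≤ 2 := by
    rw [div_le_iff₀ hd1]; linarith
  have hθθ : Real.HolderConjugate (θ / (θ - 1)) θ :=
    (Real.HolderConjugate.conjExponent hθ).symm
  have hpθ : 0 < p * (θ / (θ - 1)) := mul_pos (by linarith) hθθ.pos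
  set θ' := θ / (θ - 1) with hθ'
  obtain ⟨C, hC, H⟩ := SingularDrift.exists_ae_bound (d := d) (Gδ := Gδ) (Gν := Gν) hδ hν hp2 hp'
    hT hκ hβ hr hr2 hθθ hθd
  set c : ℝ := ((2 * (1 + κ * Real.sqrt d ^ 2)) ^ β) ^ 2 with hc
  have hc0 : 0 < c := by positivity
  refine ⟨C * c ^ (1 / (p * θ')), by positivity, ?_⟩
  intro b h gδ gν f u hb hbf hGδ hh hhf hGν hf _ hu
  obtain ⟨M, v, dv, hv, hvu⟩ := hu.exists_isDriftSolution hT.le hb.contDiff.continuous hbf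
    hh.contDiff.continuous hhf hf
  have hae := H M b h gδ gν f v dv hv hGδ hGν
  have hslab : SingularDrift.slabMeasure d T =
      volume.restrict (Icc 0 T ×ˢ (univ : Set (SingularDrift.Space d))) := by
    rw [SingularDrift.slabMeasure, Measure.volume_eq_prod, ← Measure.prod_restrict,
      Measure.restrict_univ]
  have hsup : (⨆ y : SingularDrift.Space d, SingularDrift.weightedIntegral T p θ' κ β h f y) ≤
      ENNReal.ofReal c * ⨆ z : Fin d → ℤ,
        SingularDrift.weightedIntegral T p θ' κ β h f (SingularDrift.latticePoint z) := by
    refine iSup_le fun y => ?_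
    obtain ⟨z, hz⟩ := SingularDrift.exists_latticePoint_near y
    refine (SingularDrift.weightedIntegral_le_mul hκ hβ0 h f hz).trans ?_
    gcongr
    exact le_iSup (fun z : Fin d → ℤ =>
      SingularDrift.weightedIntegral T p θ' κ β h f (SingularDrift.latticePoint z)) z
  have hpow : (⨆ z : Fin d → ℤ, SingularDrift.weightedIntegral T p θ' κ β h f
      (SingularDrift.latticePoint z)) ^ (1 / (p * θ')) =
      ⨆ z : Fin d → ℤ, SingularDrift.weightedIntegral T p θ' κ β h f
        (SingularDrift.latticePoint z) ^ (1 / (p * θ')) :=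
    (ENNReal.orderIsoRpow (1 / (p * θ')) (by positivity)).map_iSup _
  rw [hslab] at hae
  rw [eLpNorm_exponent_top, eLpNormEssSup_eq_essSup_enorm]
  refine essSup_le_of_ae_le _ ?_
  filter_upwards [hae, ae_restrict_mem (measurableSet_Icc.prod MeasurableSet.univ)] with z hz hzI
  rw [hvu z.1 hzI.1 z.2] at hz
  rw [← ofReal_norm, Real.norm_eq_abs]
  refine hz.trans ((mul_le_mul_right (ENNReal.rpow_le_rpow hsup (by positivity)) _).trans
    (le_of_eq ?_))
  rw [ENNReal.mul_rpow_of_nonneg _ _ (by positivity), hpow,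
    ENNReal.ofReal_rpow_of_nonneg hc0.le (by positivity), ← mul_assoc,
    ← ENNReal.ofReal_mul hC.le]
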